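/- Let $D$ be a planar diagram of an oriented knot $L$, with a base point away from the crossings, and let $n_\pm$ be the numbers of positive and negative crossings. Let $A_t=\mathbb Q[X]$ be the Frobenius algebra of rank two over $\mathbb Q[t]$ with $X^2=t$, $\epsilon(1)=0$, $\epsilon(X)=1$, $\Delta(1)=1\otimes X+X\otimes 1$, $\Delta(X)=X\otimes X+t\,1\otimes 1$, and let $C_t(D)$ be the Khovanov complex of $D$ for it: the total complex of the cube of resolutions, with a tensor power of $A_t$ over $\mathbb Q[t]$ (one factor for each circle) at the vertex $v$, in cohomological degree $|v|-n_-$, and graded so that $\deg X=2$, $\deg t=4$ and $1\otimes\dots\otimes 1$ at $v$ has degree $-\#\mathrm{circles}(v)-|v|-n_++2n_-$. Here $|v|$ is the number of $1$-smoothings. Let $X$ act by multiplication in the factor of the circle through the base point. Put $C(D)=C_t(D)/tC_t(D)$, a complex over $A=\mathbb Q[X]/(X^2)$, with total cohomology $\mathrm H(L)$, and let $\widetilde{\mathrm H}(L)$ be the total cohomology of the reduced complex $C(D)/XC(D)$. Let $s(L)$ be the Rasmussen invariant, normalized to be $2$ for the positive trefoil. Write $M\{i\}$ for $M$ with degrees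 raised by $i$. Then $C_t(D)$ is a complex of graded $\mathbb Q[X]$-modules, and the following hold. (1) $C_t(D)$ is isomorphic, as a complex of graded $\mathbb Q[X]$-modules, to the direct sum of finitely many complexes $$0\longrightarrow \mathbb Q[X]\{2m+i\}\xrightarrow{\ X^m\ }\mathbb Q[X]\{i\}\longrightarrow 0\qquad(\ast)$$ with various $m>0$ and $i\in\mathbb Z$, placed in various cohomological degrees, of a contractible complex, and of the complex $0\to\mathbb Q[X]\{-s(L)-1\}\to 0$ in cohomological degree $0$. (2) For every such decomposition, $C(D)$ is isomorphic, as a complex of graded $A$-modules, to the direct sum of a contractible complex, of the complexes $0\to A\{2m+i\}\xrightarrow{0}A\{i\}\to 0$ for the terms $(\ast)$ with $m>1$, of the complexes $0\to A\{2+i\}\xrightarrow{X}A\{i\}\to 0$ for the terms $(\ast)$ with $m=1$ (in the same cohomological degrees), and of $0\to A\{-s(L)-1\}\to 0$ in cohomological degree $0$. (3) No complex $0\to A\xrightarrow{X}A\xrightarrow{X}\cdots\xrightarrow{X}A\to 0$ with at least three terms $A$, in whatever cohomological degrees, is a direct summand of $C(D)$, even as a complex of ungraded modules. (4) $\mathrm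 H(L)$ and $\widetilde{\mathrm H}(L)$ are finite-dimensional over $\mathbb Q$, and for every decomposition as in (1), $\dim_{\mathbb Q}\mathrm H(L)-\dim_{\mathbb Q}\widetilde{\mathrm H}(L)-1$ is twice the number of terms $(\ast)$ with $m>1$. -/

import Mathlib

open CategoryTheory CategoryTheory.Limits Polynomial

noncomputable section

/-! ### Graded modules over `ℚ[X]`, where `deg X = 2` -/

/-- A `ℤ`-graded module over `ℚ[X]`, where `X` has degree `2`. -/
structure GrMod where
  carrier : Type
  [addCommGroup : AddCommGroup carrier]
  [module : Module ℚ[X] carrier]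
  /-- the homogeneous elements of each degree -/
  gr : ℤ → AddSubgroup carrier
  isInternal : DirectSum.IsInternal gr
  monomial_smul_mem : ∀ (k : ℕ) (c : ℚ) (j : ℤ) (x : carrier),
    x ∈ gr j → (monomial k c : ℚ[X]) • x ∈ gr (j + 2 * k)

namespace GrMod

attribute [instance] GrMod.addCommGroup GrMod.module

instance : CoeSort GrMod Type := ⟨GrMod.carrier⟩

/-- Morphisms of graded modules: `ℚ[X]`-linear maps that preserve the degree. -/
@[ext]
structure Hom (M N : GrMod) where
  lin : M →ₗ[ℚ[X]] N
  map_gr : ∀ (j : ℤ) (x : M), x ∈ M.gr j → lin x ∈ N.gr j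

instance : Category GrMod where
  Hom := Hom
  id M := ⟨LinearMap.id, fun _ _ h => h⟩
  comp f g := ⟨g.lin ∘ₗ f.lin, fun j x h => g.map_gr j _ (f.map_gr j x h)⟩

/-- The underlying linear map of a morphism. -/
def lin {M N : GrMod} (f : M ⟶ N) : M →ₗ[ℚ[X]] N := Hom.lin f

/-- A degree-preserving linear map, as a morphism. -/
def ofLin {M N : GrMod} (f : M →ₗ[ℚ[X]] N) (hf : ∀ (j : ℤ) (x : M), x ∈ M.gr j → f x ∈ N.gr j) :
    M ⟶ N := Hom.mk f hf

theorem lin_mem {M N : GrMod} (f : M ⟶ N) (j : ℤ) (x : M) (hx : x ∈ M.gr j) :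
    lin f x ∈ N.gr j := Hom.map_gr f j x hx

theorem hom_ext' {M N : GrMod} {f g : M ⟶ N} (h : lin f = lin g) : f = g := Hom.ext h

@[simp] theorem lin_ofLin {M N : GrMod} (f : M →ₗ[ℚ[X]] N)
    (hf : ∀ (j : ℤ) (x : M), x ∈ M.gr j → f x ∈ N.gr j) : lin (ofLin f hf) = f := rfl

@[simp] theorem lin_id (M : GrMod) : lin (𝟙 M) = LinearMap.id := rfl

@[simp] theorem lin_comp {M N K : GrMod} (f : M ⟶ N) (g : N ⟶ K) :
    lin (f ≫ g) = lin g ∘ₗ lin f := rfl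

section additive

variable {M N : GrMod}

instance : Zero (M ⟶ N) := ⟨ofLin 0 fun j _ _ => (N.gr j).zero_mem⟩
instance : Add (M ⟶ N) := ⟨fun f g => ofLin (lin f + lin g) fun j x h =>
  (N.gr j).add_mem (lin_mem f j x h) (lin_mem g j x h)⟩
instance : Neg (M ⟶ N) := ⟨fun f => ofLin (-lin f) fun j x h =>
  (N.gr j).neg_mem (lin_mem f j x h)⟩
instance : Sub (M ⟶ N) := ⟨fun f g => ofLin (lin f - lin g) fun j x h =>
  (N.gr j).sub_mem (lin_mem f j x h) (lin_mem g j x h)⟩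
instance : SMul ℕ (M ⟶ N) := ⟨fun n f => ofLin (n • lin f) fun j x h =>
  (N.gr j).nsmul_mem (lin_mem f j x h) n⟩
instance : SMul ℤ (M ⟶ N) := ⟨fun n f => ofLin (n • lin f) fun j x h =>
  (N.gr j).zsmul_mem (lin_mem f j x h) n⟩

instance : AddCommGroup (M ⟶ N) :=
  Function.Injective.addCommGroup (fun f : M ⟶ N => lin f) (fun _ _ h => hom_ext' h)
    rfl (fun _ _ => rfl) (fun _ => rfl) (fun _ _ => rfl) (fun _ _ => rfl) (fun _ _ => rfl)

@[simp] theorem lin_zero : lin (0 : M ⟶ N) = 0 := rfl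
@[simp] theorem lin_add (f g : M ⟶ N) : lin (f + g) = lin f + lin g := rfl

end additive

instance : Preadditive GrMod where
  add_comp _ _ _ f f' g := hom_ext' (by simp [LinearMap.comp_add])
  comp_add _ _ _ f g g' := hom_ext' (by simp [LinearMap.add_comp])

theorem lin_sum {M N : GrMod} {ι : Type*} (s : Finset ι) (f : ι → (M ⟶ N)) :
    lin (∑ i ∈ s, f i) = ∑ i ∈ s, lin (f i) :=
  map_sum (AddMonoidHom.mk' (fun f : M ⟶ N => lin f) fun _ _ => rfl) f s

/-- The forgetful functor to (ungraded) `ℚ[X]`-modules. -/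
def forgetGr : GrMod ⥤ ModuleCat.{0} ℚ[X] where
  obj M := ModuleCat.of ℚ[X] M
  map f := ModuleCat.ofHom (lin f)

instance : forgetGr.Additive where
  map_add := rfl

/-! Criteria for a family of subgroups to be a grading. -/

theorem isInternal_of_proj {M : Type*} [AddCommGroup M] (gr : ℤ → AddSubgroup M)
    (hspan : ∀ x, x ∈ ⨆ j, gr j) (π : ℤ → M →+ M) (hsame : ∀ j, ∀ x ∈ gr j, π j x = x)
    (hne : ∀ i j, i ≠ j → ∀ x ∈ gr i, π j x = 0) : DirectSum.IsInternal gr := by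
  constructor
  · rw [injective_iff_map_eq_zero]
    intro x hx
    ext j
    have key : ∀ y : DirectSum ℤ fun i => gr i,
        π j (DirectSum.coeAddMonoidHom gr y) = (y j : M) := by
      intro y
      induction y using DirectSum.induction_on with
      | zero => simp
      | of i a =>
        rw [DirectSum.coeAddMonoidHom_of]
        by_cases h : i = j
        · subst h; simp [hsame i _ a.2]
        · rw [hne i j h _ a.2, DirectSum.of_eq_of_ne _ _ _ (Ne.symm h)]; rfl
      | add a b ha hb => simp [ha, hb]
    rw [← key x, hx]; simp
  · intro x
    have : ∀ x ∈ ⨆ j, gr j, x ∈ (DirectSum.coeAddMonoidHom gr).range := by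
      intro x hx
      have hle : (⨆ j, gr j) ≤ (DirectSum.coeAddMonoidHom gr).range :=
        iSup_le fun j y hy => ⟨DirectSum.of (fun i => gr i) j ⟨y, hy⟩, by simp⟩
      exact hle hx
    exact this x (hspan x)

section proj

variable (M : GrMod)

theorem mem_iSup_gr (x : M) : x ∈ ⨆ j, M.gr j := by
  obtain ⟨y, rfl⟩ := M.isInternal.2 x
  induction y using DirectSum.induction_on with
  | zero => simp
  | of i a =>
    rw [DirectSum.coeAddMonoidHom_of]
    exact (le_iSup M.gr i) a.2
  | add a b ha hb => rw [map_add]; exact add_mem ha hb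

/-- The homogeneous component of degree `j`. -/
def proj (j : ℤ) : M →+ M :=
  ((M.gr j).subtype.comp (DFinsupp.evalAddMonoidHom j)).comp
    (AddEquiv.ofBijective (DirectSum.coeAddMonoidHom M.gr) M.isInternal).symm.toAddMonoidHom

theorem proj_coe (y : DirectSum ℤ fun i => M.gr i) (j : ℤ) :
    M.proj j (DirectSum.coeAddMonoidHom M.gr y) = (y j : M) := by
  have : (AddEquiv.ofBijective (DirectSum.coeAddMonoidHom M.gr) M.isInternal).symm
      (DirectSum.coeAddMonoidHom M.gr y) = y :=
    (AddEquiv.ofBijective (DirectSum.coeAddMonoidHom M.gr) M.isInternal).symm_apply_apply y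
  simp only [proj, AddMonoidHom.comp_apply]
  erw [this]
  rfl

theorem proj_mem (j : ℤ) (x : M) : M.proj j x ∈ M.gr j := by
  obtain ⟨y, rfl⟩ := M.isInternal.2 x
  rw [proj_coe]; exact (y j).2

theorem proj_same (j : ℤ) (x : M) (hx : x ∈ M.gr j) : M.proj j x = x := by
  have := M.proj_coe (DirectSum.of (fun i => M.gr i) j ⟨x, hx⟩) j
  simpa using this

theorem proj_ne (i j : ℤ) (hij : i ≠ j) (x : M) (hx : x ∈ M.gr i) : M.proj j x = 0 := by
  have := M.proj_coe (DirectSum.of (fun i => M.gr i) i ⟨x, hx⟩) j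
  rw [DirectSum.of_eq_of_ne _ _ _ (Ne.symm hij)] at this
  simpa using this

@[elab_as_elim]
theorem gr_induction {p : M → Prop} (x : M) (h0 : p 0) (hh : ∀ j, ∀ x ∈ M.gr j, p x)
    (hadd : ∀ x y, p x → p y → p (x + y)) : p x :=
  AddSubgroup.iSup_induction (C := p) M.gr (mem_iSup_gr M x) hh h0 hadd

end proj

/-- The direct sum of a finite family of graded modules. -/
def pi {ι : Type} [Finite ι] (M : ι → GrMod) : GrMod where
  carrier := ∀ k, M k
  gr j := AddSubgroup.pi Set.univ fun k => (M k).gr j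
  isInternal := by
    classical
    have := Fintype.ofFinite ι
    refine isInternal_of_proj _ (fun x => ?_)
      (fun j => AddMonoidHom.mk' (fun x k => (M k).proj j (x k))
        (fun x y => by funext k; simp)) ?_ ?_
    · rw [← Finset.univ_sum_single x]
      refine sum_mem fun k _ => ?_
      refine (M k).gr_induction (x k) (by simp) (fun j y hy => ?_) (fun a b ha hb => ?_)
      · refine (le_iSup (fun j => AddSubgroup.pi Set.univ fun k => (M k).gr j) j) ?_
        intro k' _
        by_cases h : k' = k
        · subst h; simpa using hy
        · simp [h]
      · rw [Pi.single_add]; exact add_mem ha hb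
    · intro j x hx
      funext k
      exact (M k).proj_same j _ (hx k trivial)
    · intro i j hij x hx
      funext k
      exact (M k).proj_ne i j hij _ (hx k trivial)
  monomial_smul_mem k c j x hx a ha := (M a).monomial_smul_mem k c j _ (hx a ha)

instance : HasFiniteBiproducts GrMod where
  out n := ⟨fun F => by
    classical
    exact hasBiproduct_of_total
      { pt := pi F
        π := fun k => ofLin (LinearMap.proj k) fun j x hx => hx k trivial
        ι := fun k => ofLin (LinearMap.single ℚ[X] (fun k => (F k : Type)) k) fun j x hx k' _ => by
          change Pi.single (M := fun k => (F k : Type)) k x k' ∈ (F k').gr j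
          by_cases h : k' = k
          · subst h; simpa using hx
          · rw [Pi.single_eq_of_ne h]; exact zero_mem _
        ι_π := fun k k' => by
          by_cases h : k = k'
          · subst h
            refine hom_ext' (LinearMap.ext fun x => ?_)
            rw [dif_pos rfl]
            exact Pi.single_eq_same (M := fun k => (F k : Type)) k x
          · rw [dif_neg h]
            refine hom_ext' (LinearMap.ext fun x => ?_)
            exact Pi.single_eq_of_ne (M := fun k => (F k : Type)) (Ne.symm h) x }
      (by
        refine hom_ext' ?_
        rw [lin_sum]
        refine LinearMap.ext fun x => ?_
        simp only [lin_comp, LinearMap.sum_apply]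
        exact Finset.univ_sum_single x)⟩

instance : HasBinaryBiproducts GrMod := hasBinaryBiproducts_of_finite_biproducts _

instance : HasFiniteBiproducts (CochainComplex GrMod ℤ) :=
  have : HasFiniteProducts (CochainComplex GrMod ℤ) := ⟨fun n =>
    inferInstanceAs (HasLimitsOfShape (Discrete (Fin n))
      (HomologicalComplex GrMod (ComplexShape.up ℤ)))⟩
  HasFiniteBiproducts.of_hasFiniteProducts

/-- The quotient of a graded module by a homogeneous submodule, with the quotient grading. -/
def quot (M : GrMod) (N : Submodule ℚ[X] M) (hN : ∀ x ∈ N, ∀ j, M.proj j x ∈ N) : GrMod where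
  carrier := M ⧸ N
  gr j := (M.gr j).map N.mkQ.toAddMonoidHom
  isInternal := by
    refine isInternal_of_proj _ (fun x => ?_)
      (fun j => QuotientAddGroup.map N.toAddSubgroup N.toAddSubgroup (M.proj j)
        (fun x hx => hN x hx j)) ?_ ?_
    · obtain ⟨x, rfl⟩ := N.mkQ_surjective x
      refine M.gr_induction x (by simp) (fun j y hy => ?_) (fun a b ha hb => ?_)
      · exact (le_iSup (fun j => (M.gr j).map N.mkQ.toAddMonoidHom) j) ⟨y, hy, rfl⟩
      · rw [map_add]; exact add_mem ha hb
    · rintro j _ ⟨x, hx, rfl⟩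
      exact congrArg N.mkQ (M.proj_same j x hx)
    · rintro i j hij _ ⟨x, hx, rfl⟩
      exact (congrArg N.mkQ (M.proj_ne i j hij x hx)).trans (map_zero N.mkQ)
  monomial_smul_mem := by
    rintro k c j _ ⟨x, hx, rfl⟩
    exact ⟨_, M.monomial_smul_mem k c j x hx, N.mkQ.map_smul _ x⟩

theorem proj_X_pow_smul (M : GrMod) (k : ℕ) (j : ℤ) (x : M) :
    M.proj j ((X ^ k : ℚ[X]) • x) = (X ^ k : ℚ[X]) • M.proj (j - 2 * k) x := by
  refine M.gr_induction x (by simp) (fun i y hy => ?_) (fun a b ha hb => ?_)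
  · have h1 : (X ^ k : ℚ[X]) • y ∈ M.gr (i + 2 * k) := by
      rw [X_pow_eq_monomial]; exact M.monomial_smul_mem k 1 i y hy
    by_cases h : i + 2 * k = j
    · subst h
      rw [M.proj_same _ _ h1, M.proj_same _ _ (by simpa using hy)]
    · rw [M.proj_ne _ _ h _ h1, M.proj_ne _ _ (by omega) _ hy, smul_zero]
  · simp only [smul_add, map_add, ha, hb]

/-- The submodule `X ^ k M`. -/
def XPowRange (k : ℕ) (M : GrMod) : Submodule ℚ[X] M :=
  LinearMap.range (LinearMap.lsmul ℚ[X] M (X ^ k))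

/-- The functor `M ↦ M / X ^ k M` on graded modules. -/
def modXPow (k : ℕ) : GrMod ⥤ GrMod where
  obj M := M.quot (XPowRange k M) (by
    rintro _ ⟨x, rfl⟩ j
    exact ⟨_, (M.proj_X_pow_smul k j x).symm⟩)
  map {M N} f := ofLin ((XPowRange k M).mapQ (XPowRange k N) (lin f) (by
      rintro _ ⟨x, rfl⟩
      exact ⟨lin f x, ((lin f).map_smul _ x).symm⟩)) (by
    rintro j _ ⟨x, hx, rfl⟩
    exact ⟨lin f x, lin_mem f j x hx, rfl⟩)
  map_id M := hom_ext' (by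
    refine LinearMap.ext fun x => ?_
    obtain ⟨x, rfl⟩ := Submodule.mkQ_surjective _ x
    rfl)
  map_comp f g := hom_ext' (by
    refine LinearMap.ext fun x => ?_
    obtain ⟨x, rfl⟩ := Submodule.mkQ_surjective _ x
    rfl)

instance (k : ℕ) : (modXPow k).Additive where
  map_add := hom_ext' (by
    refine LinearMap.ext fun x => ?_
    obtain ⟨x, rfl⟩ := Submodule.mkQ_surjective _ x
    rfl)

/-- The graded module `ℚ[X]{i}`: the free module of rank one whose generator `1` has degree `i`. -/
def QX (i : ℤ) : GrMod where
  carrier := ℚ[X]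
  gr j :=
    { carrier := {p | ∀ n : ℕ, p.coeff n ≠ 0 → i + 2 * n = j}
      zero_mem' := by simp
      add_mem' := by
        intro p q hp hq n hn
        by_cases h : p.coeff n = 0
        · exact hq n (by simpa [h] using hn)
        · exact hp n h
      neg_mem' := by
        intro p hp n hn
        exact hp n (by simpa using hn) }
  isInternal := by
    classical
    refine isInternal_of_proj _ (fun p => ?_)
      (fun j => AddMonoidHom.mk' (fun p => p.sum fun n c => if i + 2 * n = j then monomial n c else 0)
        (fun p q => Polynomial.sum_add_index p q _ (by simp)
          (by intro n a b; split_ifs <;> simp))) ?_ ?_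
    · induction p using Polynomial.induction_on' with
      | add p q hp hq => exact add_mem hp hq
      | monomial n c =>
        refine AddSubgroup.mem_iSup_of_mem (i + 2 * n) fun k hk => ?_
        rw [coeff_monomial] at hk
        by_cases h : n = k
        · rw [h]
        · simp [h] at hk
    · intro j p hp
      conv_rhs => rw [← p.sum_monomial_eq]
      refine Finset.sum_congr rfl fun n hn => ?_
      exact if_pos (hp n (mem_support_iff.1 hn))
    · intro a b hab p hp
      refine Finset.sum_eq_zero fun n hn => ?_
      refine if_neg ?_
      rw [hp n (mem_support_iff.1 hn)]
      exact hab
  monomial_smul_mem k c j p hp n hn := by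
    rw [smul_eq_mul, ← C_mul_X_pow_eq_monomial, mul_assoc, coeff_C_mul, coeff_X_pow_mul'] at hn
    split_ifs at hn with h
    · have := hp (n - k) (right_ne_zero_of_mul hn)
      omega
    · exact absurd (mul_zero c) hn

/-- Multiplication by `X ^ m`, as a morphism `ℚ[X]{2m + i} ⟶ ℚ[X]{i}`. -/
def mulXPow (m : ℕ) (i : ℤ) : QX (2 * m + i) ⟶ QX i :=
  ofLin (M := QX (2 * m + i)) (N := QX i) (LinearMap.lsmul ℚ[X] ℚ[X] (X ^ m)) (by
    intro j p hp n hn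
    change coeff ((X : ℚ[X]) ^ m * (show ℚ[X] from p)) n ≠ 0 at hn
    rw [coeff_X_pow_mul'] at hn
    split_ifs at hn with h
    · have := hp (n - m) hn
      omega
    · exact absurd rfl hn)

/-- The graded module `A{i}`, where `A = ℚ[X]/(X²)`. -/
def A (i : ℤ) : GrMod := (modXPow 2).obj (QX i)

/-- Multiplication by `X`, as a morphism `A{2 + i} ⟶ A{i}`. -/
def mulXA (i : ℤ) : A (2 + i) ⟶ A i :=
  (modXPow 2).map (ofLin (M := QX (2 + i)) (N := QX i) (LinearMap.lsmul ℚ[X] ℚ[X] X)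
    (by
      intro j p hp n hn
      change coeff ((X : ℚ[X]) * (show ℚ[X] from p)) n ≠ 0 at hn
      rw [← pow_one X, coeff_X_pow_mul'] at hn
      split_ifs at hn with h
      · have := hp (n - 1) hn
        omega
      · exact absurd rfl hn))

end GrMod

/-! ### Knot diagrams -/

/-- The combinatorial data of an oriented based knot diagram with `n` crossings (a signed Gauss
code). Walking along the knot from the base point, which lies on the knot away from the crossings,
one goes through crossings `2 * n` times; `pass (c, true)` and `pass (c, false)` are the times at
which one goes through the crossing `c` along its over-strand and along its under-strand.
`positive c` says whether `c` is a positive crossing.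

The base point and the crossings cut the knot into the arcs `0, …, 2 * n`, in the order in which
they are met: arc `k` ends, and arc `k + 1` begins, with the `k`-th passage. -/
structure GaussCode where
  n : ℕ
  pass : Fin n × Bool ≃ Fin (2 * n)
  positive : Fin n → Bool

namespace GaussCode

variable (D : GaussCode)

abbrev Arc : Type := Fin (2 * D.n + 1)

/-- The arc that enters the crossing `c` along the over-strand (`b = true`) or the under-strand. -/
def inArc (c : Fin D.n) (b : Bool) : D.Arc := (D.pass (c, b)).castSucc

/-- The arc that leaves the crossing `c` along the over-strand (`b = true`) or the under-strand. -/
def outArc (c : Fin D.n) (b : Bool) : D.Arc := (D.pass (c, b)).succ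

/-- The sides of arcs (`true` is the left side, `false` the right side) which meet in a corner at
a crossing or which are adjacent at the base point. If both strands of `c` are drawn upwards, then
`D.positive c` tells which of them (over or under) runs from the lower left to the upper right;
the four corners are listed in the order left, top, right, bottom. -/
inductive Corner : D.Arc × Bool → D.Arc × Bool → Prop
  | base (b : Bool) : Corner (Fin.last _, b) (0, b)
  | left (c : Fin D.n) :
      Corner (D.inArc c (D.positive c), true) (D.outArc c (!D.positive c), true)
  | top (c : Fin D.n) :
      Corner (D.outArc c (!D.positive c), false) (D.outArc c (D.positive c), true)
  | right (c : Fin D.n) :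
      Corner (D.outArc c (D.positive c), false) (D.inArc c (!D.positive c), false)
  | bottom (c : Fin D.n) :
      Corner (D.inArc c (D.positive c), false) (D.inArc c (!D.positive c), true)

/-- The faces (regions) of the diagram: classes of sides of arcs under the relation generated by
the corners. -/
def Face : Type := Quot D.Corner

/-- Planarity, by Euler's formula: the underlying connected graph has `n + 1` vertices (the
crossings and the base point) and `2 * n + 1` edges, so it lies on the sphere if and only if it has
`n + 2` faces. -/
def IsPlanar : Prop := Nat.card D.Face = D.n + 2

end GaussCode

/-- An oriented based knot diagram in the plane. -/
structure KnotDiagram extends GaussCode where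
  planar : toGaussCode.IsPlanar

/-! ### The complex `C_t(D)` -/

namespace GaussCode

variable (D : GaussCode)

/-- The ring `ℚ[X_e : e an arc]`. -/
abbrev ArcRing : Type := MvPolynomial D.Arc ℚ

/-- `X` acts as the variable of the arc `0`, the arc that starts at the base point. -/
instance : Algebra ℚ[X] D.ArcRing :=
  (Polynomial.aeval (MvPolynomial.X (0 : D.Arc))).toAlgebra

/-- A state: a choice of the `0`-smoothing (`false`) or the `1`-smoothing (`true`) at every
crossing, that is, a vertex of the cube of resolutions. -/
abbrev State : Type := Fin D.n → Bool

/-- The number of `1`-smoothings of a state. -/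
def weight {D : GaussCode} (v : D.State) : ℕ := (Finset.univ.filter fun c => v c = true).card

/-- The number of positive crossings. -/
def nPos : ℕ := (Finset.univ.filter fun c => D.positive c = true).card

/-- The number of negative crossings. -/
def nNeg : ℕ := (Finset.univ.filter fun c => D.positive c = false).card

/-- The pairs of arcs that are joined in the smoothing `v`. The oriented smoothing is the
`0`-smoothing of a positive crossing and the `1`-smoothing of a negative crossing. -/
inductive Joined (v : D.State) : D.Arc → D.Arc → Prop
  | base : Joined v (Fin.last _) 0
  | oriented (c : Fin D.n) (b : Bool) (h : v c ≠ D.positive c) :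
      Joined v (D.inArc c b) (D.outArc c (!b))
  | unoriented_in (c : Fin D.n) (h : v c = D.positive c) :
      Joined v (D.inArc c true) (D.inArc c false)
  | unoriented_out (c : Fin D.n) (h : v c = D.positive c) :
      Joined v (D.outArc c true) (D.outArc c false)

/-- The circles of the smoothing `v`. -/
def Circle (v : D.State) : Type := Quot (D.Joined v)

/-- The circle that contains a given arc. -/
def circle (v : D.State) (e : D.Arc) : D.Circle v := Quot.mk _ e

/-- The generators of the ideal of relations of the smoothing `v`. -/
inductive Relator (v : D.State) : D.ArcRing → Prop
  | sq (e f : D.Arc) : Relator v (MvPolynomial.X e ^ 2 - MvPolynomial.X f ^ 2)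
  | joined (e f : D.Arc) (h : D.Joined v e f) :
      Relator v (MvPolynomial.X e - MvPolynomial.X f)

/-- The ideal generated by `X_e ^ 2 - X_f ^ 2` for all arcs `e`, `f`, and `X_e - X_f` for joined
`e`, `f`. -/
def relIdeal (v : D.State) : Ideal D.ArcRing := Ideal.span {p | D.Relator v p}

/-- The polynomial ring `ℚ[X_e]`, `deg X_e = 2`, with degrees shifted up by `s`. -/
def arcModule (s : ℤ) : GrMod where
  carrier := D.ArcRing
  gr j := (MvPolynomial.weightedHomogeneousSubmodule ℚ (fun _ : D.Arc => (2 : ℤ))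
    (j - s)).toAddSubgroup
  isInternal := by
    refine GrMod.isInternal_of_proj _ (fun p => ?_)
      (fun j => (MvPolynomial.weightedHomogeneousComponent (fun _ : D.Arc => (2 : ℤ))
        (j - s)).toAddMonoidHom) ?_ ?_
    · induction p using MvPolynomial.induction_on' with
      | monomial u a =>
        refine AddSubgroup.mem_iSup_of_mem
          (Finsupp.weight (fun _ : D.Arc => (2 : ℤ)) u + s) ?_
        exact MvPolynomial.isWeightedHomogeneous_monomial _ _ _ (by simp)
      | add p q hp hq => exact add_mem hp hq
    · intro j p hp
      exact MvPolynomial.IsWeightedHomogeneous.weightedHomogeneousComponent_same hp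
    · intro i j hij p hp
      exact MvPolynomial.IsWeightedHomogeneous.weightedHomogeneousComponent_ne _ hp (by omega)
  monomial_smul_mem k c j p hp := by
    have h1 : ((monomial k c : ℚ[X]) • p : D.ArcRing)
        = (MvPolynomial.C c * MvPolynomial.X 0 ^ k) * p := by
      rw [Algebra.smul_def]
      congr 1
      exact (Polynomial.aeval_monomial _).trans rfl
    have h2 := ((MvPolynomial.isWeightedHomogeneous_C (fun _ : D.Arc => (2 : ℤ)) c).mul
      ((MvPolynomial.isWeightedHomogeneous_X ℚ (fun _ : D.Arc => (2 : ℤ)) 0).pow k)).mul hp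
    rw [h1]
    have h3 : (0 + k • (2 : ℤ)) + (j - s) = (j + 2 * k) - s := by simp; ring
    exact h3 ▸ h2

theorem proj_arcModule (s j : ℤ) (p : D.ArcRing) :
    (D.arcModule s).proj j p =
      MvPolynomial.weightedHomogeneousComponent (fun _ : D.Arc => (2 : ℤ)) (j - s) p := by
  refine (D.arcModule s).gr_induction p ((map_zero _).trans (map_zero _).symm) (fun i q hq => ?_) (fun a b ha hb => ?_)
  · by_cases h : i = j
    · subst h
      rw [GrMod.proj_same _ _ _ hq]
      exact (MvPolynomial.IsWeightedHomogeneous.weightedHomogeneousComponent_same hq).symm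
    · rw [GrMod.proj_ne _ _ _ h _ hq]
      exact (MvPolynomial.IsWeightedHomogeneous.weightedHomogeneousComponent_ne _ hq
        (by omega)).symm
  · rw [map_add, ha, hb]; exact (map_add _ _ _).symm

theorem proj_mem_relIdeal (v : D.State) (s : ℤ) (p : D.ArcRing) (hp : p ∈ D.relIdeal v) (j : ℤ) :
    ((D.arcModule s).proj j p : D.ArcRing) ∈ D.relIdeal v := by
  let _ := MvPolynomial.weightedGradedAlgebra ℚ (fun _ : D.Arc => (2 : ℤ))
  have hom : (D.relIdeal v).IsHomogeneous
      (MvPolynomial.weightedHomogeneousSubmodule ℚ (fun _ : D.Arc => (2 : ℤ))) := by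
    refine Ideal.homogeneous_span _ _ ?_
    rintro _ (⟨e, f⟩ | ⟨e, f, _⟩)
    · exact ⟨2 • 2, Submodule.sub_mem _ ((MvPolynomial.isWeightedHomogeneous_X ℚ _ e).pow 2)
        ((MvPolynomial.isWeightedHomogeneous_X ℚ _ f).pow 2)⟩
    · exact ⟨2, Submodule.sub_mem _ (MvPolynomial.isWeightedHomogeneous_X ℚ _ e)
        (MvPolynomial.isWeightedHomogeneous_X ℚ _ f)⟩
  have h := hom (j - s) hp
  rw [proj_arcModule]
  have h' := MvPolynomial.weightedDecomposition.decompose'_apply ℚ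
    (fun _ : D.Arc => (2 : ℤ)) p (j - s)
  rw [← h']
  exact h

/-- The grading shift at a vertex `v` of the cube, for which the element `1` of the tensor power at
`v` has degree `- #circles - |v| - n₊ + 2 n₋`. -/
def shift (v : D.State) : ℤ :=
  -(Nat.card (D.Circle v) : ℤ) - weight v - D.nPos + 2 * D.nNeg

/-- The graded module at a vertex `v` of the cube. Let `A = ℚ[X]`, an algebra of rank two over
`ℚ[t]`, `t = X²`. The tensor power of `A` over `ℚ[t]` with one factor for each circle of `v`
is the algebra generated by one element `X_e` for each arc `e` (multiplication by `X` in the factor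
of the circle through `e`), with the relations that all squares `X_e²` agree (their common value is
`t`) and that `X_e = X_f` if `e` and `f` lie on the same circle. -/
def vertex (v : D.State) : GrMod :=
  (D.arcModule (D.shift v)).quot ((D.relIdeal v).restrictScalars ℚ[X])
    (fun p hp j => D.proj_mem_relIdeal v _ p hp j)

theorem X_sub_X_mem (v : D.State) {e f : D.Arc} (h : D.circle v e = D.circle v f) :
    (MvPolynomial.X e - MvPolynomial.X f : D.ArcRing) ∈ D.relIdeal v := by
  have h' := Quot.eqvGen_exact h
  clear h
  induction h' with
  | rel e f h => exact Ideal.subset_span (Relator.joined e f h)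
  | refl e => simp
  | symm e f _ ih => simpa using (D.relIdeal v).neg_mem ih
  | trans e f g _ _ ih₁ ih₂ =>
    simpa using (D.relIdeal v).add_mem ih₁ ih₂

open Classical in
/-- The multiplier of the edge of the cube that ends in `v` and changes the smoothing of `c`.
The arcs by which the over-strand enters and leaves `c` are not joined at `c` in either smoothing.
If they are on the same circle of `v`, then two circles are merged, and the map of tensor powers is
the multiplication `A ⊗ A → A`, that is, the quotient map. Otherwise a circle is split into the
circles through these two arcs, and the map is the comultiplication `A → A ⊗ A`, that is,
`Δ(a) = (1 ⊗ X + X ⊗ 1) ⬝ (a ⊗ 1)`. -/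
def multiplier (v : D.State) (c : Fin D.n) : D.ArcRing :=
  if D.circle v (D.inArc c true) = D.circle v (D.outArc c true) then 1
  else MvPolynomial.X (D.inArc c true) + MvPolynomial.X (D.outArc c true)

theorem multiplier_mul_mem (v : D.State) (c : Fin D.n) (hc : v c = true) (p : D.ArcRing)
    (hp : p ∈ D.relIdeal (Function.update v c false)) : D.multiplier v c * p ∈ D.relIdeal v := by
  classical
  have hsq : ∀ e f : D.Arc,
      (MvPolynomial.X e ^ 2 - MvPolynomial.X f ^ 2 : D.ArcRing) ∈ D.relIdeal v :=
    fun e f => Ideal.subset_span (Relator.sq e f)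
  have hj : ∀ e f : D.Arc, D.Joined v e f →
      (MvPolynomial.X e - MvPolynomial.X f : D.ArcRing) ∈ D.relIdeal v :=
    fun e f h => Ideal.subset_span (Relator.joined e f h)
  -- the product with the multiplier, for two arcs that are joined to opposite ends in `v`
  have opp : ∀ e f : D.Arc,
      (D.circle v e = D.circle v (D.inArc c true) ∧ D.circle v f = D.circle v (D.outArc c true)) ∨
      (D.circle v f = D.circle v (D.inArc c true) ∧ D.circle v e = D.circle v (D.outArc c true)) →
      D.multiplier v c * (MvPolynomial.X e - MvPolynomial.X f) ∈ D.relIdeal v := by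
    intro e f hef
    unfold multiplier
    split_ifs with hm
    · rw [one_mul]
      refine D.X_sub_X_mem v ?_
      rcases hef with ⟨h1, h2⟩ | ⟨h1, h2⟩
      · rw [h1, h2, hm]
      · rw [h1, h2, hm]
    · set a := D.inArc c true
      set b := D.outArc c true
      rcases hef with ⟨h1, h2⟩ | ⟨h1, h2⟩
      · have e1 := D.X_sub_X_mem v h1
        have e2 := D.X_sub_X_mem v h2
        have : ((MvPolynomial.X a + MvPolynomial.X b) * (MvPolynomial.X e - MvPolynomial.X f) :
            D.ArcRing) = (MvPolynomial.X a + MvPolynomial.X b) *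
              (MvPolynomial.X e - MvPolynomial.X a) - (MvPolynomial.X a + MvPolynomial.X b) *
              (MvPolynomial.X f - MvPolynomial.X b) +
              (MvPolynomial.X a ^ 2 - MvPolynomial.X b ^ 2) := by ring
        rw [this]
        exact add_mem (sub_mem (Ideal.mul_mem_left _ _ e1) (Ideal.mul_mem_left _ _ e2)) (hsq a b)
      · have e1 := D.X_sub_X_mem v h1
        have e2 := D.X_sub_X_mem v h2
        have : ((MvPolynomial.X a + MvPolynomial.X b) * (MvPolynomial.X e - MvPolynomial.X f) :
            D.ArcRing) = (MvPolynomial.X a + MvPolynomial.X b) *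
              (MvPolynomial.X e - MvPolynomial.X b) - (MvPolynomial.X a + MvPolynomial.X b) *
              (MvPolynomial.X f - MvPolynomial.X a) -
              (MvPolynomial.X a ^ 2 - MvPolynomial.X b ^ 2) := by ring
        rw [this]
        exact sub_mem (sub_mem (Ideal.mul_mem_left _ _ e2) (Ideal.mul_mem_left _ _ e1)) (hsq a b)
  have hs : ∀ {e f : D.Arc}, D.Joined v e f → D.circle v e = D.circle v f := fun h => Quot.sound h
  induction hp using Submodule.span_induction with
  | zero => simp
  | add x y _ _ hx hy => rw [mul_add]; exact add_mem hx hy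
  | smul a x _ hx =>
    rw [smul_eq_mul, mul_left_comm]; exact Ideal.mul_mem_left _ _ hx
  | mem x hx =>
    rcases hx with ⟨e, f⟩ | ⟨e, f, hef⟩
    · exact Ideal.mul_mem_left _ _ (hsq e f)
    · cases hef with
      | base => exact Ideal.mul_mem_left _ _ (hj _ _ Joined.base)
      | oriented c' b h =>
        by_cases hcc : c' = c
        · subst hcc
          simp only [Function.update_self] at h
          have hp : v c' = D.positive c' := by
            cases h' : D.positive c' <;> simp_all
          refine opp _ _ ?_
          cases b
          · exact Or.inl ⟨(hs (Joined.unoriented_in c' hp)).symm, rfl⟩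
          · exact Or.inl ⟨rfl, (hs (Joined.unoriented_out c' hp)).symm⟩
        · rw [Function.update_of_ne hcc] at h
          exact Ideal.mul_mem_left _ _ (hj _ _ (Joined.oriented c' b h))
      | unoriented_in c' h =>
        by_cases hcc : c' = c
        · subst hcc
          simp only [Function.update_self] at h
          have hp : v c' ≠ D.positive c' := by rw [hc, ← h]; simp
          exact opp _ _ (Or.inl ⟨rfl, hs (Joined.oriented c' false hp)⟩)
        · rw [Function.update_of_ne hcc] at h
          exact Ideal.mul_mem_left _ _ (hj _ _ (Joined.unoriented_in c' h))
      | unoriented_out c' h =>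
        by_cases hcc : c' = c
        · subst hcc
          simp only [Function.update_self] at h
          have hp : v c' ≠ D.positive c' := by rw [hc, ← h]; simp
          exact opp _ _ (Or.inr ⟨(hs (Joined.oriented c' true hp)).symm, rfl⟩)
        · rw [Function.update_of_ne hcc] at h
          exact Ideal.mul_mem_left _ _ (hj _ _ (Joined.unoriented_out c' h))

/-- The map of an edge of the cube, which ends in `v` and changes the smoothing of `c`. -/
def edgeMap (v : D.State) (c : Fin D.n) (hc : v c = true) :
    D.vertex (Function.update v c false) →ₗ[ℚ[X]] D.vertex v :=
  Submodule.mapQ ((D.relIdeal (Function.update v c false)).restrictScalars ℚ[X])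
    ((D.relIdeal v).restrictScalars ℚ[X])
    ((LinearMap.mulLeft D.ArcRing (D.multiplier v c)).restrictScalars ℚ[X])
    (fun p hp => D.multiplier_mul_mem v c hc p hp)

/-- The vertices of the cube in cohomological degree `h`. -/
abbrev StateIn (h : ℤ) : Type := {v : D.State // (weight v : ℤ) - D.nNeg = h}

theorem weight_update {D : GaussCode} (v : D.State) (c : Fin D.n) (hc : v c = true) :
    weight (Function.update v c false) + 1 = weight v := by
  classical
  unfold weight
  have : (Finset.univ.filter fun c' => Function.update v c false c' = true)
      = (Finset.univ.filter fun c' => v c' = true).erase c := by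
    ext c'
    by_cases h : c' = c
    · subst h; simp
    · simp [h]
  rw [this]
  exact Finset.card_erase_add_one (by simp [hc])

/-- The vertex obtained by changing a `1`-smoothing to a `0`-smoothing. -/
def StateIn.pred {D : GaussCode} {h : ℤ} (v : D.StateIn (h + 1)) (c : Fin D.n) (hc : v.1 c = true) :
    D.StateIn h :=
  ⟨Function.update v.1 c false, by have := weight_update v.1 c hc; have := v.2; omega⟩

/-- The sign of an edge of the cube. -/
def sign {D : GaussCode} (v : D.State) (c : Fin D.n) : ℤ :=
  (-1) ^ (Finset.univ.filter fun c' => c' < c ∧ v c' = true).card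

/-- The term of `C_t(D)` in cohomological degree `h`. -/
def chain (h : ℤ) : GrMod := GrMod.pi fun v : D.StateIn h => D.vertex v.1

/-- The differential of `C_t(D)`: the signed sum of the maps of the edges of the cube. -/
def diff (h : ℤ) : D.chain h →ₗ[ℚ[X]] D.chain (h + 1) :=
  LinearMap.pi fun v : D.StateIn (h + 1) => ∑ c : Fin D.n,
    if hc : v.1 c = true then
      sign v.1 c • (D.edgeMap v.1 c hc ∘ₗ LinearMap.proj (R := ℚ[X])
        (φ := fun w : D.StateIn h => (D.vertex w.1 : Type)) (v.pred c hc))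
    else 0

/-- The total complex of the cube is a complex of graded modules. -/
structure IsGradedComplex : Prop where
  diff_mem : ∀ (h j : ℤ) (x : D.chain h), x ∈ (D.chain h).gr j → D.diff h x ∈ (D.chain (h + 1)).gr j
  diff_diff : ∀ (h : ℤ) (x : D.chain h), D.diff (h + 1) (D.diff h x) = 0

/-- The complex `C_t(D)` of graded `ℚ[X]`-modules. -/
def Ct (hD : D.IsGradedComplex) : CochainComplex GrMod ℤ :=
  CochainComplex.of D.chain (fun h => GrMod.ofLin (D.diff h) (hD.diff_mem h))
    (fun h => GrMod.hom_ext' (LinearMap.ext (hD.diff_diff h)))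

end GaussCode

/-! ### Constructions with complexes of graded `ℚ[X]`-modules -/

namespace GrMod

/-- The complex `K / X ^ k K`. -/
def modXPowComplex (k : ℕ) (K : CochainComplex GrMod ℤ) : CochainComplex GrMod ℤ :=
  ((modXPow k).mapHomologicalComplex _).obj K

/-- The underlying complex of (ungraded) modules. -/
def forgetComplex (K : CochainComplex GrMod ℤ) : CochainComplex (ModuleCat.{0} ℚ[X]) ℤ :=
  (forgetGr.mapHomologicalComplex _).obj K

/-- The total cohomology `⨁ₕ Hʰ(K)`, as a vector space over `ℚ`. -/
abbrev TotalHomology (K : CochainComplex GrMod ℤ) : Type :=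
  DirectSum ℤ fun h => RestrictScalars ℚ ℚ[X] ((forgetComplex K).homology h)

/-- A complex is contractible if its identity is homotopic to zero (through morphisms of graded
modules). -/
def IsContractible (K : CochainComplex GrMod ℤ) : Prop := Nonempty (Homotopy (𝟙 K) 0)

/-- The complex `0 → M → N → 0` with `M` in cohomological degree `h`. -/
def twoTerm (h : ℤ) {M N : GrMod} (f : M ⟶ N) : CochainComplex GrMod ℤ :=
  HomologicalComplex.double (c := ComplexShape.up ℤ) (i₀ := h) (i₁ := h + 1) f rfl

/-- The complex `0 → M → 0` with `M` in cohomological degree `0`. -/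
def oneTerm (M : GrMod) : CochainComplex GrMod ℤ :=
  (HomologicalComplex.single GrMod (ComplexShape.up ℤ) 0).obj M

/-- The complex `A → A → ⋯ → A` of ungraded modules over `A = ℚ[X]/(X²)`, with `l` arrows, all
of them multiplication by `X`, and with the first `A` in cohomological degree `h`. Its term
in degree `k` is a product of copies of `A` over the set of the `i ≤ l` such that `h + i = k`; this
set has at most one element. -/
def xChain (l : ℕ) (h : ℤ) : CochainComplex (ModuleCat.{0} ℚ[X]) ℤ :=
  CochainComplex.of
    (fun k => ModuleCat.of ℚ[X]
      ({i : Fin (l + 1) // h + (i : ℕ) = k} → ℚ[X] ⧸ Ideal.span {(X ^ 2 : ℚ[X])}))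
    (fun k => ModuleCat.ofHom (LinearMap.pi fun _ =>
      ∑ i : {i : Fin (l + 1) // h + (i : ℕ) = k}, (X : ℚ[X]) • LinearMap.proj (R := ℚ[X]) (φ := fun _ => ℚ[X] ⧸ Ideal.span {(X ^ 2 : ℚ[X])}) i))
    (fun k => by
      refine ModuleCat.hom_ext (LinearMap.ext fun f => funext fun j => ?_)
      simp only [ModuleCat.hom_comp, ModuleCat.hom_ofHom, LinearMap.comp_apply,
        LinearMap.pi_apply, LinearMap.sum_apply, LinearMap.smul_apply, LinearMap.proj_apply,
        ModuleCat.hom_zero, LinearMap.zero_apply, Finset.smul_sum, smul_smul]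
      refine Finset.sum_eq_zero fun _ _ => Finset.sum_eq_zero fun i _ => ?_
      obtain ⟨a, ha⟩ := Ideal.Quotient.mk_surjective (f i)
      rw [← ha, ← pow_two]
      exact Ideal.Quotient.eq_zero_iff_mem.2
        (Ideal.mul_mem_right _ _ (Ideal.subset_span rfl)))

/-- For a complex `K`, consider the complex `K / (X² - 1) K`, filtered by the degree in `K`: its
`j`-th term is spanned by the classes of homogeneous elements of degree at most `j`. This says
that some nonzero cohomology class of it is represented by a cycle in the `j`-th term. -/
def HasLeeClass (K : CochainComplex GrMod ℤ) (j : ℤ) : Prop :=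
  ∃ (h : ℤ) (z : K.X h), z ∈ ⨆ i : Set.Iic j, (K.X h).gr i ∧
    (∃ w : K.X (h + 1), lin (K.d h (h + 1)) z = (X ^ 2 - 1 : ℚ[X]) • w) ∧
    ¬ ∃ (h' : ℤ) (y : K.X h') (w : K.X h), z = lin (K.d h' h) y + (X ^ 2 - 1 : ℚ[X]) • w

end GrMod

namespace GaussCode

variable (D : GaussCode) (hD : D.IsGradedComplex)

/-- The complex `C(D) = C_t(D) / t C_t(D)`, `t = X²`, of graded modules over `A = ℚ[X]/(X²)`. -/
def C : CochainComplex GrMod ℤ := GrMod.modXPowComplex 2 (D.Ct hD)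

/-- The reduced complex `C(D) / X C(D)`. -/
def reducedC : CochainComplex GrMod ℤ := GrMod.modXPowComplex 1 (D.C hD)

/-- The Rasmussen invariant `s`, defined by Lee's cohomology, that is, the cohomology of
`C_t(D) / (t - 1) C_t(D)`. In terms of the quantum degree `q = - deg`, for which the filtration is
decreasing and `1`, `X` in `A` have degrees `1`, `-1`, it is `s_max - 1`, where `s_max` is the
largest filtration degree of a nonzero class. -/
def rasmussen : ℤ := -sInf {j : ℤ | GrMod.HasLeeClass (D.Ct hD) j} - 1

end GaussCode

/-- An isomorphism of complexes of graded modules between `K` and the direct sum of the complexes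
`0 → ℚ[X]{2 m_k + i_k} → ℚ[X]{i_k} → 0`, `k < r`, with differential `X ^ m_k`, `m_k > 0`, the
source being in cohomological degree `h_k`, the contractible complex `E`, and `0 → ℚ[X]{a} → 0` with
`ℚ[X]{a}` in cohomological degree `0`. -/
structure GrMod.IsStarDecomposition (K : CochainComplex GrMod ℤ) (a : ℤ) (r : ℕ)
    (h : Fin r → ℤ) (m : Fin r → ℕ) (i : Fin r → ℤ) (E : CochainComplex GrMod ℤ) : Prop where
  pos : ∀ k, 0 < m k
  contractible : GrMod.IsContractible E
  iso : Nonempty (K ≅ (⨁ fun k : Fin r => GrMod.twoTerm (h k) (GrMod.mulXPow (m k) (i k))) ⊞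
    (E ⊞ GrMod.oneTerm (GrMod.QX a)))

end

noncomputable section

namespace GaussCode

variable (D : GaussCode)

/-! ### Planarity and the parity of the passages -/

/-! Planarity enters only through a parity. Over `ZMod 2`, Euler's formula forces the boundary map
on faces to have the largest possible rank, so the diagram has a checkerboard colouring, and the two
passages through a crossing have opposite parities (`IsPlanar.odd_pass_add_pass`). After reversal of
the odd arcs, one strand at each crossing has two heads and the other two tails. Every smoothing
then joins heads to tails, its circles are the cycles of a permutation of the arcs, and a change of
smoothing composes this permutation with a transposition. So every edge of the cube merges two
circles or splits one (`IsAlternating.sim_flip_iff`); this makes the cube a complex and its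
differential homogeneous.

The modules at the vertices are finitely generated and torsion-free over `ℚ[X]`, so `C_t(D)` has a
graded Smith normal form (`exists_isSum`). Among all equations `d x = X ^ m y` with `x` homogeneous
and `y` not divisible by `X`, one with least `m` splits off a summand `X ^ m`; induction on the
total rank does the rest. Summands with `m = 0` are contractible. Once the differential is zero,
one-term summands `ℚ[X]{a}` remain, and their number is the rank of the cohomology.

This rank comes from Lee's argument. At each crossing the reversed edges form a homotopy showing
that `X_in + X_out` is zero on cohomology, so the variable of arc `k` acts as `(-1) ^ k X`. Hence
`altProd` acts as a power of `2 X`; but it vanishes at every vertex other than the oriented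
resolution. The cohomology is therefore torsion outside degree `0` and of rank one in degree `0`.
Modulo `X ^ 2 - 1` each `X ^ m` is invertible, so only the summand `ℚ[X]{a}` carries Lee cohomology,
and its filtration gives `a = -s - 1`.

Modulo `X ^ 2`, the map `X ^ m` becomes `0` for `m > 1` and remains `X` for `m = 1`; modulo `X` all
of them vanish. Counting dimensions gives (4). Part (3) needs no decomposition: if `d x = X y` in `K
/ X ^ 2 K` with `K` torsion-free, then lifting to `K` and applying `d` shows that `d y` is `X` times
a boundary, which fails in a chain of two or more maps `X`. -/

theorem arc_induction {p : D.Arc → Prop} (h0 : p 0)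
    (hs : ∀ c b, p (D.inArc c b) → p (D.outArc c b)) (e : D.Arc) : p e := by
  induction e using Fin.induction with
  | zero => exact h0
  | succ i ih =>
    have := hs (D.pass.symm i).1 (D.pass.symm i).2
    simp only [inArc, outArc, Prod.mk.eta, Equiv.apply_symm_apply] at this
    exact this ih

instance : Finite D.Face := inferInstanceAs (Finite (Quot D.Corner))

/-- The value of a function on the faces at a side of an arc. -/
def sideValue (f : D.Face → ZMod 2) (e : D.Arc) (b : Bool) : ZMod 2 := f (Quot.mk _ (e, b))

section sideValue

variable (f : D.Face → ZMod 2) (c : Fin D.n)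

theorem sideValue_left : D.sideValue f (D.inArc c (D.positive c)) true =
    D.sideValue f (D.outArc c (!D.positive c)) true :=
  congrArg f (Quot.sound (Corner.left c))

theorem sideValue_top : D.sideValue f (D.outArc c (!D.positive c)) false =
    D.sideValue f (D.outArc c (D.positive c)) true :=
  congrArg f (Quot.sound (Corner.top c))

theorem sideValue_right : D.sideValue f (D.outArc c (D.positive c)) false =
    D.sideValue f (D.inArc c (!D.positive c)) false :=
  congrArg f (Quot.sound (Corner.right c))

theorem sideValue_bottom : D.sideValue f (D.inArc c (D.positive c)) false =
    D.sideValue f (D.inArc c (!D.positive c)) true :=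
  congrArg f (Quot.sound (Corner.bottom c))

end sideValue

/-- The boundary map from functions on the faces to functions on the arcs, modulo `2`. -/
def faceBoundary : (D.Face → ZMod 2) →ₗ[ZMod 2] D.Arc → ZMod 2 :=
  LinearMap.pi fun e =>
    (LinearMap.proj (R := ZMod 2) (φ := fun _ : D.Face => ZMod 2) (Quot.mk _ (e, true))) +
      LinearMap.proj (R := ZMod 2) (φ := fun _ : D.Face => ZMod 2) (Quot.mk _ (e, false))

theorem faceBoundary_apply (f : D.Face → ZMod 2) (e : D.Arc) :
    D.faceBoundary f e = D.sideValue f e true + D.sideValue f e false := rfl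

/-- Coordinates on the cycles modulo `2` of the diagram. -/
def cycleCoord : (D.Arc → ZMod 2) →ₗ[ZMod 2] Option (Fin D.n) → ZMod 2 :=
  LinearMap.pi fun o =>
    o.elim (LinearMap.proj (R := ZMod 2) (φ := fun _ : D.Arc => ZMod 2) 0) fun c =>
      LinearMap.proj (R := ZMod 2) (φ := fun _ : D.Arc => ZMod 2) (D.inArc c true) +
        LinearMap.proj (R := ZMod 2) (φ := fun _ : D.Arc => ZMod 2) (D.outArc c true)

/-- Each corner at a crossing borders two of the four arcs, so the boundary sums to zero over these
arcs. The jump across the crossing is thus the same along both strands, and one coordinate per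
crossing suffices. -/
theorem faceBoundary_crossing (f : D.Face → ZMod 2) (c : Fin D.n) (b : Bool) :
    D.faceBoundary f (D.inArc c b) + D.faceBoundary f (D.outArc c b) =
      D.cycleCoord (D.faceBoundary f) (some c) := by
  change _ = D.faceBoundary f (D.inArc c true) + D.faceBoundary f (D.outArc c true)
  have h1 := D.sideValue_left f c
  have h2 := D.sideValue_top f c
  have h3 := D.sideValue_right f c
  have h4 := D.sideValue_bottom f c
  simp only [faceBoundary_apply]
  generalize D.positive c = s at *
  cases s <;> cases b <;> simp only [Bool.not_false, Bool.not_true] at h1 h2 h3 h4 <;>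
    first | rfl | (rw [h1, h2, h3, h4]; ring)

theorem faceBoundary_eq_const {f : D.Face → ZMod 2} {a : ZMod 2}
    (h0 : D.faceBoundary f 0 = a) (hc : ∀ c, D.cycleCoord (D.faceBoundary f) (some c) = 0)
    (e : D.Arc) : D.faceBoundary f e = a := by
  refine D.arc_induction (p := fun e => D.faceBoundary f e = a) h0 (fun c b h => ?_) e
  have := D.faceBoundary_crossing f c b
  rw [hc, h] at this
  rw [← sub_eq_zero, ← this, CharTwo.sub_eq_add, add_comm]

/-- Zero boundary at arc `0` and no jump at any crossing mean that the two sides of every arc agree;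
the corners then carry the value along the whole knot. This bounds the kernel by the constants. -/
theorem eq_const_of_cycleCoord_eq_zero {f : D.Face → ZMod 2}
    (h : D.cycleCoord (D.faceBoundary f) = 0) :
    f = fun _ => D.sideValue f 0 true := by
  have h0 : ∀ e, D.sideValue f e true = D.sideValue f e false := fun e => by
    have := D.faceBoundary_eq_const (f := f) (a := 0) (congrFun h none)
      (fun c => congrFun h (some c)) e
    rw [faceBoundary_apply] at this
    exact (CharTwo.add_eq_zero).1 this
  have h1 : ∀ e, D.sideValue f e true = D.sideValue f 0 true := by
    refine D.arc_induction rfl fun c b ih => ?_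
    rw [← ih]
    have h1 := D.sideValue_left f c
    have h2 := D.sideValue_top f c
    have h3 := D.sideValue_right f c
    have h4 := D.sideValue_bottom f c
    have h5 := h0 (D.outArc c (D.positive c))
    have h6 := h0 (D.outArc c (!D.positive c))
    have h7 := h0 (D.inArc c (D.positive c))
    have h8 := h0 (D.inArc c (!D.positive c))
    generalize D.positive c = s at *
    cases s <;> cases b <;> simp only [Bool.not_false, Bool.not_true] at * <;> simp_all
  funext F
  obtain ⟨⟨e, b⟩, rfl⟩ := Quot.exists_rep F
  cases b
  · exact (h0 e).symm.trans (h1 e)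
  · exact h1 e

/-- In a planar diagram, an even number of passages lies between the two passages through a
crossing. -/
theorem IsPlanar.odd_pass_add_pass (hD : D.IsPlanar) (c : Fin D.n) (b : Bool) :
    Odd ((D.pass (c, b) : ℕ) + D.pass (c, !b)) := by
  classical
  have := Fintype.ofFinite D.Face
  set T := D.cycleCoord ∘ₗ D.faceBoundary with hT
  have hker : Module.finrank (ZMod 2) (LinearMap.ker T) ≤ 1 := by
    refine (Submodule.finrank_mono (t := Submodule.span (ZMod 2) {fun _ => 1}) ?_).trans
      (finrank_span_le_card _ |>.trans (by simp))
    intro f hf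
    rw [D.eq_const_of_cycleCoord_eq_zero hf]
    exact Submodule.mem_span_singleton.2 ⟨D.sideValue f 0 true, by ext; simp⟩
  have hrank := T.finrank_range_add_finrank_ker
  have hcard : Fintype.card D.Face = D.n + 2 := by rw [← Nat.card_eq_fintype_card]; exact hD
  rw [Module.finrank_fintype_fun_eq_card, hcard] at hrank
  -- There are `n + 2` faces and the kernel has dimension at most one, so the rank reaches the
  -- number `n + 1` of coordinates.
  have hsurj : LinearMap.range T = ⊤ := by
    refine Submodule.eq_top_of_finrank_eq (le_antisymm (Submodule.finrank_le _) ?_)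
    rw [Module.finrank_fintype_fun_eq_card, Fintype.card_option, Fintype.card_fin]
    omega
  -- A checkerboard colouring: the boundary is `1` at arc `0` and does not jump, so the two sides of
  -- every arc have different colours.
  obtain ⟨f, hf⟩ := LinearMap.range_eq_top.1 hsurj (fun o => o.elim 1 fun _ => 0)
  have hone := D.faceBoundary_eq_const (f := f) (a := 1) (congrFun hf none)
    (fun c => congrFun hf (some c))
  simp only [faceBoundary_apply] at hone
  have hne : ∀ e, D.sideValue f e false = D.sideValue f e true + 1 := fun e => by
    rw [← hone e, ← add_assoc, CharTwo.add_self_eq_zero, zero_add]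
  -- The colour to the left of the knot changes at every passage, so it records the parity of the
  -- number of the arc.
  have hval : ∀ e : D.Arc, D.sideValue f e true = D.sideValue f 0 true + (e : ℕ) := by
    refine D.arc_induction (by simp) fun c b ih => ?_
    have : ((D.outArc c b : ℕ) : ZMod 2) = (D.inArc c b : ℕ) + 1 := by
      simp [inArc, outArc]
    rw [this, ← add_assoc, ← ih]
    have h1 := D.sideValue_left f c
    have h2 := D.sideValue_top f c
    have h3 := D.sideValue_right f c
    have h4 := D.sideValue_bottom f c
    have hP : D.sideValue f (D.outArc c (D.positive c)) true =
        D.sideValue f (D.inArc c (D.positive c)) true + 1 := by rw [← h2, hne, h1]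
    have hN : D.sideValue f (D.outArc c (!D.positive c)) true =
        D.sideValue f (D.inArc c (!D.positive c)) true + 1 := by
      rw [← h1, ← h4, hne, add_assoc, CharTwo.add_self_eq_zero, add_zero]
    generalize D.positive c = s at *
    cases s <;> cases b <;> assumption
  -- The left corner lies between an incoming arc, numbered like its passage, and an outgoing arc,
  -- numbered one higher; their left sides have the same colour.
  have h1 := D.sideValue_left f c
  rw [hval, hval (D.outArc _ _), add_right_inj] at h1
  have key : ((D.pass (c, D.positive c) : ℕ) : ZMod 2) =
      ((D.pass (c, !D.positive c) : ℕ) : ZMod 2) + 1 := by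
    simpa [inArc, outArc] using h1
  have key' : Odd ((D.pass (c, D.positive c) : ℕ) + D.pass (c, !D.positive c)) := by
    rw [← ZMod.natCast_eq_one_iff_odd]
    push_cast
    rw [key, add_right_comm, CharTwo.add_self_eq_zero, zero_add]
  generalize D.positive c = s at *
  cases s <;> cases b <;> first | exact key' | (rw [add_comm]; exact key')

end GaussCode

/-! ### Cycles of a permutation and transpositions -/

/-- A transposition of two points of one cycle cuts it. With `k` least such that `(σ ^ k) a = b`,
the new permutation takes `b` through `σ a, …, (σ ^ k) a = b` and back, without meeting `a`. -/
theorem Equiv.Perm.not_sameCycle_mul_swap {α : Type*} [DecidableEq α] [Finite α]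
    (σ : Equiv.Perm α) {a b : α} (hab : a ≠ b) (h : σ.SameCycle a b) :
    ¬ (σ * Equiv.swap a b).SameCycle a b := by
  classical
  intro hτ
  have hex : ∃ k : ℕ, (σ ^ k) a = b := by
    obtain ⟨i, -, -, hi⟩ := h.exists_pow_eq''
    exact ⟨i, hi⟩
  set k := Nat.find hex with hk
  have hkb : (σ ^ k) a = b := Nat.find_spec hex
  have hne : ∀ i, i < k → (σ ^ i) a ≠ b := fun i hi => Nat.find_min hex hi
  have hne' : ∀ i, 0 < i → i ≤ k → (σ ^ i) a ≠ a := by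
    intro i hi0 hik hia
    refine hne (k - i) (by omega) ?_
    rw [← hkb]
    conv_rhs => rw [← Nat.sub_add_cancel hik, pow_add, Equiv.Perm.mul_apply, hia]
  have hclosed : ∀ n : ℕ, ∃ i, 0 < i ∧ i ≤ k ∧ ((σ * Equiv.swap a b) ^ n) b = (σ ^ i) a := by
    intro n
    induction n with
    | zero =>
      refine ⟨k, Nat.pos_of_ne_zero fun h0 => hab ?_, le_rfl, by simp [hkb]⟩
      simpa [h0] using hkb
    | succ n ih =>
      obtain ⟨i, hi0, hik, hi⟩ := ih
      rw [pow_succ', Equiv.Perm.mul_apply, hi, Equiv.Perm.mul_apply]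
      rcases hik.lt_or_eq with hlt | rfl
      · rw [Equiv.swap_apply_of_ne_of_ne (hne' i hi0 hik) (hne i hlt)]
        exact ⟨i + 1, by omega, hlt, by rw [pow_succ', Equiv.Perm.mul_apply]⟩
      · rw [hkb, Equiv.swap_apply_right]
        exact ⟨1, one_pos, hi0, by simp⟩
  obtain ⟨n, -, -, hn⟩ := hτ.symm.exists_pow_eq''
  obtain ⟨i, hi0, hik, hi⟩ := hclosed n
  exact hne' i hi0 hik (hi.symm.trans hn)

/-- With `k` the length of the cycle of `a`, the new permutation sends `b` to `σ a` and then follows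
`σ` until it reaches `(σ ^ k) a = a`, since that cycle does not contain `b`. -/
theorem Equiv.Perm.sameCycle_mul_swap {α : Type*} [DecidableEq α] [Finite α]
    (σ : Equiv.Perm α) {a b : α} (h : ¬ σ.SameCycle a b) :
    (σ * Equiv.swap a b).SameCycle a b := by
  classical
  have hex : ∃ k : ℕ, 0 < k ∧ (σ ^ k) a = a :=
    ⟨orderOf σ, orderOf_pos σ, by rw [pow_orderOf_eq_one]; rfl⟩
  set k := Nat.find hex with hk
  obtain ⟨hk0, hka⟩ : 0 < k ∧ (σ ^ k) a = a := Nat.find_spec hex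
  have key : ∀ i, i < k → ((σ * Equiv.swap a b) ^ (i + 1)) b = (σ ^ (i + 1)) a := by
    intro i
    induction i with
    | zero => intro _; simp
    | succ i ih =>
      intro hi
      have h1 : (σ ^ (i + 1)) a ≠ a := fun h' => Nat.find_min hex hi ⟨by omega, h'⟩
      have h2 : (σ ^ (i + 1)) a ≠ b := fun h' => h ⟨((i + 1 : ℕ) : ℤ), by rwa [zpow_natCast]⟩
      rw [pow_succ', Equiv.Perm.mul_apply, ih (by omega), Equiv.Perm.mul_apply,
        Equiv.swap_apply_of_ne_of_ne h1 h2, pow_succ' σ (i + 1), Equiv.Perm.mul_apply]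
  refine Equiv.Perm.SameCycle.symm ⟨(k : ℕ), ?_⟩
  have := key (k - 1) (by omega)
  rw [Nat.sub_add_cancel hk0, hka] at this
  simpa using this

namespace GaussCode

variable (D : GaussCode)

/-! ### The circles of the smoothings -/

/-- The two passages through each crossing have opposite parities. -/
def IsAlternating : Prop := ∀ c b, Odd ((D.pass (c, b) : ℕ) + D.pass (c, !b))

instance (v : D.State) : Finite (D.Circle v) := inferInstanceAs (Finite (Quot (D.Joined v)))

variable {D}

/-- Two arcs lie on the same circle of the smoothing `v`. -/
def Sim (v : D.State) (x y : D.Arc) : Prop := D.circle v x = D.circle v y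

theorem Sim.refl (v : D.State) (x : D.Arc) : Sim v x x := rfl
theorem Sim.symm {v : D.State} {x y : D.Arc} (h : Sim v x y) : Sim v y x := Eq.symm h
theorem Sim.trans {v : D.State} {x y z : D.Arc} (h : Sim v x y) (h' : Sim v y z) : Sim v x z :=
  Eq.trans h h'

theorem Joined.sim {v : D.State} {x y : D.Arc} (h : D.Joined v x y) : Sim v x y := Quot.sound h

/-- The smoothing that differs from `v` exactly at the crossing `c`. -/
def flip (c : Fin D.n) (v : D.State) : D.State := Function.update v c (!v c)

@[simp] theorem flip_same (c : Fin D.n) (v : D.State) : flip c v c = !v c := by simp [flip]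

theorem flip_ne {c c' : Fin D.n} (h : c' ≠ c) (v : D.State) : flip c v c' = v c' := by
  simp [flip, h]

@[simp] theorem flip_flip (c : Fin D.n) (v : D.State) : flip c (flip c v) = v := by
  funext c'
  by_cases h : c' = c
  · subst h; simp
  · rw [flip_ne h, flip_ne h]

theorem flip_comm (c c' : Fin D.n) (v : D.State) : flip c (flip c' v) = flip c' (flip c v) := by
  funext d
  by_cases h : d = c <;> by_cases h' : d = c'
  · subst h; subst h'; rfl
  · subst h; simp [flip_ne h']
  · subst h'; simp [flip_ne h]
  · simp [flip_ne h, flip_ne h']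

theorem sim_inArc_iff (v : D.State) (c : Fin D.n) (b : Bool) :
    Sim v (D.inArc c b) (D.outArc c b) ↔ Sim v (D.inArc c true) (D.outArc c true) := by
  cases b
  · by_cases h : v c = D.positive c
    · have h1 := (Joined.unoriented_in c h).sim
      have h2 := (Joined.unoriented_out c h).sim
      exact ⟨fun h => h1.trans (h.trans h2.symm), fun h => h1.symm.trans (h.trans h2)⟩
    · have h1 := (Joined.oriented c true h).sim
      have h2 := (Joined.oriented c false h).sim
      exact ⟨fun h => h1.trans (h.symm.trans h2), fun h => h2.trans (h.symm.trans h1)⟩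
  · rfl

/-- The two arcs of the over-strand are not joined at `c` in either smoothing, so they represent the
two local pieces at `c`. A joint that the flip removes leads from one piece of the new smoothing to
the other. -/
theorem Joined.sim_flip {v : D.State} {x y : D.Arc} (h : D.Joined v x y) (c : Fin D.n) :
    Sim (flip c v) x y ∨
      (Sim (flip c v) x (D.inArc c true) ∧ Sim (flip c v) (D.outArc c true) y) ∨
      (Sim (flip c v) x (D.outArc c true) ∧ Sim (flip c v) (D.inArc c true) y) := by
  cases h with
  | base => exact Or.inl Joined.base.sim
  | oriented c' b h =>
    by_cases hc : c' = c
    · subst hc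
      have h' : flip c' v c' = D.positive c' := by
        rw [flip_same]; cases h1 : v c' <;> cases h2 : D.positive c' <;> simp_all
      have h1 := (Joined.unoriented_in c' h').sim
      have h2 := (Joined.unoriented_out c' h').sim
      cases b
      · exact Or.inr (Or.inl ⟨h1.symm, Sim.refl _ _⟩)
      · exact Or.inr (Or.inl ⟨Sim.refl _ _, h2⟩)
    · exact Or.inl (Joined.oriented c' b (by rwa [flip_ne hc])).sim
  | unoriented_in c' h =>
    by_cases hc : c' = c
    · subst hc
      have h' : flip c' v c' ≠ D.positive c' := by rw [flip_same, h]; simp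
      exact Or.inr (Or.inl ⟨Sim.refl _ _, (Joined.oriented c' false h').sim.symm⟩)
    · exact Or.inl (Joined.unoriented_in c' (by rwa [flip_ne hc])).sim
  | unoriented_out c' h =>
    by_cases hc : c' = c
    · subst hc
      have h' : flip c' v c' ≠ D.positive c' := by rw [flip_same, h]; simp
      exact Or.inr (Or.inr ⟨Sim.refl _ _, (Joined.oriented c' true h').sim⟩)
    · exact Or.inl (Joined.unoriented_out c' (by rwa [flip_ne hc])).sim

/-- Changing the smoothing of `c` affects only the circles through `c`. -/
theorem Sim.flip {v : D.State} {x y : D.Arc} (h : Sim v x y) (c : Fin D.n) :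
    Sim (flip c v) x y ∨
      (Sim (flip c v) x (D.inArc c true) ∧ Sim (flip c v) (D.outArc c true) y) ∨
      (Sim (flip c v) x (D.outArc c true) ∧ Sim (flip c v) (D.inArc c true) y) := by
  have h' := Quot.eqvGen_exact h
  clear h
  induction h' with
  | rel x y h => exact h.sim_flip c
  | refl x => exact Or.inl (Sim.refl _ _)
  | symm x y _ ih =>
    rcases ih with h | ⟨h1, h2⟩ | ⟨h1, h2⟩
    · exact Or.inl h.symm
    · exact Or.inr (Or.inr ⟨h2.symm, h1.symm⟩)
    · exact Or.inr (Or.inl ⟨h2.symm, h1.symm⟩)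
  | trans x y z _ _ ih₁ ih₂ =>
    rcases ih₁ with h | ⟨h1, h2⟩ | ⟨h1, h2⟩ <;> rcases ih₂ with k | ⟨k1, k2⟩ | ⟨k1, k2⟩
    · exact Or.inl (h.trans k)
    · exact Or.inr (Or.inl ⟨h.trans k1, k2⟩)
    · exact Or.inr (Or.inr ⟨h.trans k1, k2⟩)
    · exact Or.inr (Or.inl ⟨h1, h2.trans k⟩)
    · exact Or.inr (Or.inl ⟨h1, k2⟩)
    · exact Or.inl (h1.trans k2)
    · exact Or.inr (Or.inr ⟨h1, h2.trans k⟩)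
    · exact Or.inl (h1.trans k2)
    · exact Or.inr (Or.inr ⟨h1, k2⟩)

theorem Sim.of_flip {v : D.State} {x y : D.Arc} {c : Fin D.n}
    (hc : Sim v (D.inArc c true) (D.outArc c true)) (h : Sim (GaussCode.flip c v) x y) :
    Sim v x y := by
  have := h.flip c
  rw [flip_flip] at this
  rcases this with h | ⟨h1, h2⟩ | ⟨h1, h2⟩
  · exact h
  · exact h1.trans (hc.trans h2)
  · exact h1.trans (hc.symm.trans h2)

/-- If the circle through `c` is split, one circle is added. -/
theorem card_circle_flip_of_sim {v : D.State} {c : Fin D.n}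
    (h : Sim v (D.inArc c true) (D.outArc c true))
    (h' : ¬ Sim (flip c v) (D.inArc c true) (D.outArc c true)) :
    Nat.card (D.Circle (flip c v)) = Nat.card (D.Circle v) + 1 := by
  classical
  -- The circles of the flipped smoothing map onto those of `v`, and only the circles through the
  -- two over-strand arcs at `c` are identified. Omitting one of these two gives a bijection.
  let q : D.Circle (flip c v) → D.Circle v :=
    Quot.lift (D.circle v) fun x y hxy => Sim.of_flip h hxy.sim
  let b := D.circle (flip c v) (D.outArc c true)
  have hbij : Function.Bijective fun x : {x // x ≠ b} => q x.1 := by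
    constructor
    · rintro ⟨x, hx⟩ ⟨y, hy⟩ hxy
      obtain ⟨x, rfl⟩ := Quot.exists_rep x
      obtain ⟨y, rfl⟩ := Quot.exists_rep y
      refine Subtype.ext ?_
      rcases Sim.flip (show Sim v x y from hxy) c with h | ⟨h1, h2⟩ | ⟨h1, h2⟩
      · exact h
      · exact absurd h2.symm hy
      · exact absurd h1 hx
    · intro y
      obtain ⟨y, rfl⟩ := Quot.exists_rep y
      by_cases hy : Sim (flip c v) y (D.outArc c true)
      · exact ⟨⟨D.circle _ (D.inArc c true), h'⟩, h.trans (Sim.of_flip h hy).symm⟩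
      · exact ⟨⟨D.circle _ y, hy⟩, rfl⟩
  have := Fintype.ofFinite (D.Circle (flip c v))
  rw [← Nat.card_congr (Equiv.ofBijective _ hbij), Nat.card_eq_fintype_card,
    Nat.card_eq_fintype_card, Fintype.card_subtype_compl, Fintype.card_subtype_eq]
  have : 0 < Fintype.card (D.Circle (flip c v)) := Fintype.card_pos_iff.2 ⟨b⟩
  omega

/-! ### Circles as the cycles of a permutation of the arcs -/

section orientation

variable (D)

/-- The strand along which one goes through `c` at an even time. -/
def evenStrand (c : Fin D.n) : Bool := decide (Even (D.pass (c, true) : ℕ))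

variable {D}

theorem IsAlternating.even_evenStrand (hD : D.IsAlternating) (c : Fin D.n) :
    Even (D.pass (c, D.evenStrand c) : ℕ) := by
  unfold evenStrand
  by_cases h : Even (D.pass (c, true) : ℕ)
  · simp [h]
  · have := hD c true
    rw [Nat.odd_add'] at this
    simpa [h] using this

theorem IsAlternating.odd_evenStrand (hD : D.IsAlternating) (c : Fin D.n) :
    Odd (D.pass (c, !D.evenStrand c) : ℕ) := by
  have h := hD c (D.evenStrand c)
  rw [Nat.odd_add'] at h
  exact h.2 (hD.even_evenStrand c)

variable (D)

/-- The arcs, indexed by their heads, where the arcs with odd number are reversed. -/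
def headArc : Option (Fin D.n × Bool) → D.Arc
  | none => Fin.last _
  | some (c, false) => D.inArc c (D.evenStrand c)
  | some (c, true) => D.outArc c (D.evenStrand c)

/-- The arcs, indexed by their tails, where the arcs with odd number are reversed. -/
def tailArc : Option (Fin D.n × Bool) → D.Arc
  | none => 0
  | some (c, false) => D.inArc c (!D.evenStrand c)
  | some (c, true) => D.outArc c (!D.evenStrand c)

variable {D}

theorem bijective_of_injective_arc {f : Option (Fin D.n × Bool) → D.Arc}
    (hf : Function.Injective f) : Function.Bijective f :=
  (Fintype.bijective_iff_injective_and_card f).2 ⟨hf, by simp [mul_comm]⟩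

theorem pass_val_injective {c c' : Fin D.n} {b b' : Bool}
    (h : (D.pass (c, b) : ℕ) = D.pass (c', b')) : c = c' := by
  have := D.pass.injective (Fin.ext h)
  simp_all

/-- An even arc `k < 2 n` enters passage `k`, and an odd arc `k`, once reversed, ends at passage `k
- 1`. Both passages are even, so heads sit on the even strands; only the head of the last arc is at
the base point. -/
theorem IsAlternating.headArc_bijective (hD : D.IsAlternating) :
    Function.Bijective D.headArc := by
  refine bijective_of_injective_arc ?_
  rintro (_ | ⟨c, b⟩) (_ | ⟨c', b'⟩) h
  · rfl
  · have h1 := hD.even_evenStrand c'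
    have h2 := (D.pass (c', D.evenStrand c')).2
    rw [Nat.even_iff] at h1
    cases b' <;> simp only [headArc, inArc, outArc, Fin.ext_iff, Fin.val_last, Fin.val_castSucc,
      Fin.val_succ] at h <;> omega
  · have h1 := hD.even_evenStrand c
    have h2 := (D.pass (c, D.evenStrand c)).2
    rw [Nat.even_iff] at h1
    cases b <;> simp only [headArc, inArc, outArc, Fin.ext_iff, Fin.val_last, Fin.val_castSucc,
      Fin.val_succ] at h <;> omega
  · have h1 := hD.even_evenStrand c
    have h2 := hD.even_evenStrand c'
    rw [Nat.even_iff] at h1 h2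
    (cases b <;> cases b') <;> simp only [headArc, inArc, outArc, Fin.ext_iff,
      Fin.val_castSucc, Fin.val_succ] at h
    · rw [pass_val_injective h]
    · omega
    · omega
    · rw [pass_val_injective (Nat.succ_injective h)]

/-- Dually, tails sit at odd passages: passage `k - 1` for an even arc `k > 0`, passage `k` for an
odd one, and the base point for arc `0`. -/
theorem IsAlternating.tailArc_bijective (hD : D.IsAlternating) :
    Function.Bijective D.tailArc := by
  refine bijective_of_injective_arc ?_
  rintro (_ | ⟨c, b⟩) (_ | ⟨c', b'⟩) h
  · rfl
  · have h1 := hD.odd_evenStrand c'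
    rw [Nat.odd_iff] at h1
    cases b' <;> simp [tailArc, inArc, outArc, Fin.ext_iff] at h <;> omega
  · have h1 := hD.odd_evenStrand c
    rw [Nat.odd_iff] at h1
    cases b <;> simp [tailArc, inArc, outArc, Fin.ext_iff] at h <;> omega
  · have h1 := hD.odd_evenStrand c
    have h2 := hD.odd_evenStrand c'
    rw [Nat.odd_iff] at h1 h2
    cases b <;> cases b' <;> simp only [tailArc, inArc, outArc, Fin.ext_iff, Fin.val_castSucc,
      Fin.val_succ] at h
    · rw [pass_val_injective h]
    · omega
    · omega
    · rw [pass_val_injective (Nat.succ_injective h)]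

/-- The permutation of the ends at the crossings by which the smoothing `v` joins heads to tails. -/
def twist (v : D.State) : Equiv.Perm (Option (Fin D.n × Bool)) :=
  Function.Involutive.toPerm
    (fun o => o.map fun x => (x.1, xor x.2 (v x.1 != D.positive x.1)))
    (by rintro (_ | ⟨c, b⟩) <;> simp)

theorem twist_some (v : D.State) (c : Fin D.n) (b : Bool) :
    twist v (some (c, b)) = some (c, xor b (v c != D.positive c)) := rfl

theorem twist_of_eq {v : D.State} {c : Fin D.n} (h : v c = D.positive c) (b : Bool) :
    twist v (some (c, b)) = some (c, b) := by simp [twist_some, h]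

theorem twist_of_ne {v : D.State} {c : Fin D.n} (h : v c ≠ D.positive c) (b : Bool) :
    twist v (some (c, b)) = some (c, !b) := by
  rw [twist_some, bne_iff_ne.2 h, Bool.xor_true]

/-- The permutation of the arcs that maps each arc to the next one on its circle. -/
def next (hD : D.IsAlternating) (v : D.State) : Equiv.Perm D.Arc :=
  (Equiv.ofBijective _ hD.headArc_bijective).symm.trans
    ((twist v).trans (Equiv.ofBijective _ hD.tailArc_bijective))

theorem next_headArc (hD : D.IsAlternating) (v : D.State) (o : Option (Fin D.n × Bool)) :
    next hD v (D.headArc o) = D.tailArc (twist v o) := by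
  have : (Equiv.ofBijective _ hD.headArc_bijective).symm (D.headArc o) = o :=
    Equiv.ofBijective_symm_apply_apply _ hD.headArc_bijective o
  simp [next, this]

theorem joined_next (hD : D.IsAlternating) (v : D.State) (x : D.Arc) : Sim v x (next hD v x) := by
  obtain ⟨o, rfl⟩ := hD.headArc_bijective.2 x
  rw [next_headArc]
  rcases o with _ | ⟨c, b⟩
  · exact Joined.base.sim
  · by_cases h : v c = D.positive c
    · have h1 := (Joined.unoriented_in c h).sim
      have h2 := (Joined.unoriented_out c h).sim
      rw [twist_of_eq h]
      cases b <;> simp only [headArc, tailArc, Bool.not_false, Bool.not_true] <;>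
        generalize D.evenStrand c = s <;> cases s <;>
          first | exact h1 | exact h1.symm | exact h2 | exact h2.symm
    · have h1 := (Joined.oriented c true h).sim
      have h2 := (Joined.oriented c false h).sim
      rw [twist_of_ne h]
      cases b <;> simp only [headArc, tailArc, Bool.not_false, Bool.not_true] <;>
        generalize D.evenStrand c = s <;> cases s <;>
          first | exact h1 | exact h1.symm | exact h2 | exact h2.symm

theorem sameCycle_of_next_eq (hD : D.IsAlternating) (v : D.State) {o o' : Option (Fin D.n × Bool)}
    (h : twist v o = o') : (next hD v).SameCycle (D.headArc o) (D.tailArc o') :=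
  ⟨1, by rw [zpow_one, next_headArc, h]⟩

theorem Joined.sameCycle_next (hD : D.IsAlternating) {v : D.State} {x y : D.Arc}
    (h : D.Joined v x y) : (next hD v).SameCycle x y := by
  cases h with
  | base => exact sameCycle_of_next_eq hD v (o := none) (o' := none) rfl
  | oriented c b h =>
    have h1 := sameCycle_of_next_eq hD v (o := some (c, false)) (o' := some (c, true))
      (twist_of_ne h _)
    have h2 := sameCycle_of_next_eq hD v (o := some (c, true)) (o' := some (c, false))
      (twist_of_ne h _)
    simp only [headArc, tailArc] at h1 h2
    generalize D.evenStrand c = s at h1 h2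
    cases b <;> cases s <;>
          first | exact h1 | exact h1.symm | exact h2 | exact h2.symm
  | unoriented_in c h =>
    have h1 := sameCycle_of_next_eq hD v (o := some (c, false)) (o' := some (c, false))
      (twist_of_eq h _)
    simp only [headArc, tailArc] at h1
    generalize D.evenStrand c = s at h1
    cases s <;> first | exact h1 | exact h1.symm
  | unoriented_out c h =>
    have h1 := sameCycle_of_next_eq hD v (o := some (c, true)) (o' := some (c, true))
      (twist_of_eq h _)
    simp only [headArc, tailArc] at h1
    generalize D.evenStrand c = s at h1
    cases s <;> first | exact h1 | exact h1.symm

/-- Every joint pairs a head with a tail, so it is one step of `next` in one direction or the other.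
-/
theorem sim_iff_sameCycle (hD : D.IsAlternating) (v : D.State) (x y : D.Arc) :
    Sim v x y ↔ (next hD v).SameCycle x y := by
  constructor
  · intro h
    have h' := Quot.eqvGen_exact h
    clear h
    induction h' with
    | rel x y h => exact h.sameCycle_next hD
    | refl x => exact Equiv.Perm.SameCycle.refl _ _
    | symm x y _ ih => exact ih.symm
    | trans x y z _ _ ih₁ ih₂ => exact ih₁.trans ih₂
  · intro h
    obtain ⟨n, -, -, rfl⟩ := h.exists_pow_eq''
    clear h
    induction n with
    | zero => exact Sim.refl _ _
    | succ n ih =>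
      rw [pow_succ', Equiv.Perm.mul_apply]
      exact ih.trans (joined_next hD v _)

/-- The flip toggles whether `twist` exchanges the two ends at `c`. This is the same as exchanging
the two arcs with heads at `c` beforehand. -/
theorem next_flip (hD : D.IsAlternating) (v : D.State) (c : Fin D.n) :
    next hD (flip c v) = next hD v *
      Equiv.swap (D.inArc c (D.evenStrand c)) (D.outArc c (D.evenStrand c)) := by
  ext1 x
  obtain ⟨o, rfl⟩ := hD.headArc_bijective.2 x
  rw [Equiv.Perm.mul_apply]
  change _ = next hD v (Equiv.swap (D.headArc (some (c, false))) (D.headArc (some (c, true)))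
    (D.headArc o))
  rw [hD.headArc_bijective.1.swap_apply, next_headArc, next_headArc]
  congr 1
  rcases o with _ | ⟨c', b⟩
  · rw [Equiv.swap_apply_of_ne_of_ne (by simp) (by simp)]; rfl
  · by_cases h : c' = c
    · subst h
      cases b
      · rw [Equiv.swap_apply_left]
        cases h1 : v c' <;> cases h2 : D.positive c' <;> simp [twist_some, h1, h2]
      · rw [Equiv.swap_apply_right]
        cases h1 : v c' <;> cases h2 : D.positive c' <;> simp [twist_some, h1, h2]
    · rw [Equiv.swap_apply_of_ne_of_ne (by simp [h]) (by simp [h])]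
      simp [twist_some, flip_ne h]

/-- Changing the smoothing of a crossing of a planar diagram merges two circles or splits one. -/
theorem IsAlternating.sim_flip_iff (hD : D.IsAlternating) (v : D.State) (c : Fin D.n) :
    Sim (flip c v) (D.inArc c true) (D.outArc c true) ↔
      ¬ Sim v (D.inArc c true) (D.outArc c true) := by
  rw [← sim_inArc_iff v c (D.evenStrand c), ← sim_inArc_iff (flip c v) c (D.evenStrand c),
    sim_iff_sameCycle hD, sim_iff_sameCycle hD, next_flip]
  have hne : D.inArc c (D.evenStrand c) ≠ D.outArc c (D.evenStrand c) := by
    simp [inArc, outArc, Fin.ext_iff]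
  exact ⟨fun h h' => Equiv.Perm.not_sameCycle_mul_swap _ hne h' h,
    fun h => Equiv.Perm.sameCycle_mul_swap _ h⟩

open Classical in
theorem IsAlternating.card_circle_flip (hD : D.IsAlternating) (v : D.State) (c : Fin D.n) :
    (Nat.card (D.Circle (flip c v)) : ℤ) = Nat.card (D.Circle v) +
      if Sim v (D.inArc c true) (D.outArc c true) then 1 else -1 := by
  split_ifs with h
  · rw [card_circle_flip_of_sim h (fun h' => (hD.sim_flip_iff v c).1 h' h)]
    push_cast; ring
  · have := card_circle_flip_of_sim (v := flip c v) ((hD.sim_flip_iff v c).2 h)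
      (by rwa [flip_flip])
    rw [flip_flip] at this
    omega

end orientation

end GaussCode

namespace GaussCode

variable {D : GaussCode}

/-! ### The cube of resolutions, on lifts to the polynomial ring -/

theorem sq_sub_sq_mem_relIdeal (v : D.State) (e f : D.Arc) :
    (MvPolynomial.X e ^ 2 - MvPolynomial.X f ^ 2 : D.ArcRing) ∈ D.relIdeal v :=
  Ideal.subset_span (Relator.sq e f)

theorem Sim.sub_mem {v : D.State} {e f : D.Arc} (h : Sim v e f) :
    (MvPolynomial.X e - MvPolynomial.X f : D.ArcRing) ∈ D.relIdeal v := D.X_sub_X_mem v h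

theorem multiplier_of_sim {v : D.State} {c : Fin D.n}
    (h : Sim v (D.inArc c true) (D.outArc c true)) : D.multiplier v c = 1 := if_pos h

theorem multiplier_of_not_sim {v : D.State} {c : Fin D.n}
    (h : ¬ Sim v (D.inArc c true) (D.outArc c true)) :
    D.multiplier v c = MvPolynomial.X (D.inArc c true) + MvPolynomial.X (D.outArc c true) :=
  if_neg h

theorem Sim.sub_mem_of_flip {v : D.State} {c : Fin D.n} {I : Ideal D.ArcRing}
    (hI : D.relIdeal v ≤ I)
    (hc : (MvPolynomial.X (D.inArc c true) - MvPolynomial.X (D.outArc c true) : D.ArcRing) ∈ I)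
    {e f : D.Arc} (h : Sim (GaussCode.flip c v) e f) :
    (MvPolynomial.X e - MvPolynomial.X f : D.ArcRing) ∈ I := by
  have := h.flip c
  rw [flip_flip] at this
  rcases this with h | ⟨h1, h2⟩ | ⟨h1, h2⟩
  · exact hI h.sub_mem
  · have := I.add_mem (I.add_mem (hI h1.sub_mem) hc) (hI h2.sub_mem)
    convert! this using 1; ring
  · have := I.add_mem (I.sub_mem (hI h1.sub_mem) hc) (hI h2.sub_mem)
    convert! this using 1; ring

/-- Unlike in `multiplier_mul_mem`, the edge may be run through in either direction. Let `a`, `b` be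
the over-strand arcs at `c`. The relations of the flipped smoothing follow from those of `v` and
`X_a - X_b`, and the multiplier turns `X_a - X_b` into a relation: either it is one already, or the
product is `X_a ^ 2 - X_b ^ 2`. -/
theorem multiplier_mul_mem_of_flip (v : D.State) (c : Fin D.n) {p : D.ArcRing}
    (hp : p ∈ D.relIdeal (flip c v)) : D.multiplier v c * p ∈ D.relIdeal v := by
  set I := D.relIdeal v ⊔ Ideal.span
    {(MvPolynomial.X (D.inArc c true) - MvPolynomial.X (D.outArc c true) : D.ArcRing)}
  have hle : D.relIdeal (flip c v) ≤ I := by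
    refine Ideal.span_le.2 ?_
    rintro _ (⟨e, f⟩ | ⟨e, f, h⟩)
    · exact (le_sup_left : D.relIdeal v ≤ I) (sq_sub_sq_mem_relIdeal v e f)
    · exact h.sim.sub_mem_of_flip le_sup_left
        ((le_sup_right : _ ≤ I) (Ideal.mem_span_singleton_self _))
  obtain ⟨q, hq, r, hr, rfl⟩ := Submodule.mem_sup.1 (hle hp)
  obtain ⟨r, rfl⟩ := Ideal.mem_span_singleton'.1 hr
  rw [mul_add]
  refine add_mem (Ideal.mul_mem_left _ _ hq) ?_
  by_cases h : Sim v (D.inArc c true) (D.outArc c true)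
  · exact Ideal.mul_mem_left _ _ (Ideal.mul_mem_left _ _ h.sub_mem)
  · rw [multiplier_of_not_sim h]
    convert! Ideal.mul_mem_left _ r (sq_sub_sq_mem_relIdeal v (D.inArc c true) (D.outArc c true))
      using 1
    ring

/-- An edge is a split in exactly one of its two directions. -/
theorem multiplier_mul_multiplier_flip (hD : D.IsAlternating) (v : D.State) (c : Fin D.n) :
    D.multiplier v c * D.multiplier (flip c v) c =
      MvPolynomial.X (D.inArc c true) + MvPolynomial.X (D.outArc c true) := by
  have h := hD.sim_flip_iff v c
  by_cases hs : Sim v (D.inArc c true) (D.outArc c true)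
  · rw [multiplier_of_sim hs, multiplier_of_not_sim (by tauto), one_mul]
  · rw [multiplier_of_not_sim hs, multiplier_of_sim (by tauto), mul_one]

/-- The squares of the cube commute. -/
theorem multiplier_comm (hD : D.IsAlternating) (v : D.State) (c c' : Fin D.n) :
    D.multiplier v c * D.multiplier (flip c v) c' - D.multiplier v c' * D.multiplier (flip c' v) c
      ∈ D.relIdeal v := by
  -- Counting circles along both paths around the square leaves six of the sixteen patterns of
  -- merges and splits; in three of these the two products agree by simplification.
  have k1 := hD.card_circle_flip v c
  have k2 := hD.card_circle_flip (flip c v) c'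
  have k3 := hD.card_circle_flip v c'
  have k4 := hD.card_circle_flip (flip c' v) c
  rw [flip_comm c' c] at k2
  by_cases h1 : Sim v (D.inArc c true) (D.outArc c true) <;>
  by_cases h2 : Sim (flip c v) (D.inArc c' true) (D.outArc c' true) <;>
  by_cases h3 : Sim v (D.inArc c' true) (D.outArc c' true) <;>
  by_cases h4 : Sim (flip c' v) (D.inArc c true) (D.outArc c true) <;>
  simp only [h1, h2, h3, h4, if_true, if_false] at k1 k2 k3 k4 <;>
  (try omega) <;>
  simp only [multiplier_of_sim, multiplier_of_not_sim, h1, h2, h3, h4, one_mul, mul_one,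
    not_false_eq_true, sub_self, zero_mem]
  -- All four over-strand arcs lie on one circle of `v`, so both sums are twice the same variable
  -- modulo the relations.
  · have key : Sim v (D.inArc c' true) (D.inArc c true) := by
      rcases h3.flip c with h | ⟨h, -⟩ | ⟨h, -⟩
      · exact absurd h h2
      · exact Sim.of_flip h1 h
      · exact (Sim.of_flip h1 h).trans h1.symm
    have := add_mem key.sub_mem (h3.symm.trans (key.trans h1)).sub_mem
    convert! this using 1; ring
  -- The over-strand arcs of `c` and of `c'` lie on the same two circles of `v`, so the two sums
  -- agree modulo the relations.
  · have : Sim v (D.inArc c' true) (D.inArc c true) ∧ Sim v (D.outArc c true) (D.outArc c' true) ∨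
        Sim v (D.inArc c' true) (D.outArc c true) ∧ Sim v (D.inArc c true) (D.outArc c' true) := by
      have := h2.flip c
      rw [flip_flip] at this
      tauto
    rcases this with ⟨h, h'⟩ | ⟨h, h'⟩
    · convert! sub_mem h'.sub_mem h.sub_mem using 1; ring
    · convert! sub_mem h'.sub_mem h.sub_mem using 1; ring
  · rw [mul_comm, sub_self]; exact zero_mem _

theorem sign_flip (v : D.State) (c c' : Fin D.n) :
    sign (flip c v) c' = if c < c' then -sign v c' else sign v c' := by
  classical
  unfold sign
  have hs : ∀ w : D.State, (Finset.univ.filter fun d => d < c' ∧ w d = true).card =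
      ((Finset.univ.filter fun d => d < c' ∧ w d = true).erase c).card +
        if c < c' ∧ w c = true then 1 else 0 := fun w => by
    split_ifs with h
    · rw [Finset.card_erase_add_one (by simp [h])]
    · rw [Finset.erase_eq_of_notMem (by simpa using h), add_zero]
  have he : (Finset.univ.filter fun d => d < c' ∧ flip c v d = true).erase c =
      (Finset.univ.filter fun d => d < c' ∧ v d = true).erase c := by
    ext d
    by_cases h : d = c
    · simp [h]
    · simp [h, flip_ne h]
  rw [hs (flip c v), hs v, he, flip_same, pow_add, pow_add]
  by_cases h : c < c' <;> cases hv : v c <;> simp [h]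

theorem sign_mul_self (v : D.State) (c : Fin D.n) : sign v c * sign v c = 1 := by
  unfold sign
  rw [← mul_pow]
  simp

theorem sign_mul_sign_flip {c c' : Fin D.n} (h : c ≠ c') (v : D.State) :
    sign v c * sign (flip c v) c' = -(sign v c' * sign (flip c' v) c) := by
  rw [sign_flip, sign_flip]
  rcases lt_or_gt_of_ne h with h | h
  · rw [if_pos h, if_neg (not_lt.2 h.le)]; ring
  · rw [if_neg (not_lt.2 h.le), if_pos h]; ring

/-- The signed maps of the edges in the direction of the crossing `c`, in both directions, on lifts
to the polynomial ring. -/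
def edgeOp (c : Fin D.n) : (D.State → D.ArcRing) →ₗ[D.ArcRing] D.State → D.ArcRing :=
  LinearMap.pi fun v => ((sign v c : D.ArcRing) * D.multiplier v c) •
    LinearMap.proj (R := D.ArcRing) (φ := fun _ : D.State => D.ArcRing) (flip c v)

theorem edgeOp_apply (c : Fin D.n) (x : D.State → D.ArcRing) (v : D.State) :
    edgeOp c x v = (sign v c : D.ArcRing) * D.multiplier v c * x (flip c v) := rfl

theorem edgeOp_edgeOp (c c' : Fin D.n) (x : D.State → D.ArcRing) (v : D.State) :
    edgeOp c (edgeOp c' x) v = ((sign v c * sign (flip c v) c' : ℤ) : D.ArcRing) *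
      (D.multiplier v c * D.multiplier (flip c v) c') * x (flip c' (flip c v)) := by
  rw [edgeOp_apply, edgeOp_apply]; push_cast; ring

theorem edgeOp_anticomm (hD : D.IsAlternating) {c c' : Fin D.n} (h : c ≠ c')
    (x : D.State → D.ArcRing) (v : D.State) :
    edgeOp c (edgeOp c' x) v + edgeOp c' (edgeOp c x) v ∈ D.relIdeal v := by
  rw [edgeOp_edgeOp, edgeOp_edgeOp, sign_mul_sign_flip h, flip_comm c c']
  convert! Ideal.mul_mem_left _ (-((sign v c' * sign (flip c' v) c : ℤ) : D.ArcRing) *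
    x (flip c' (flip c v))) (multiplier_comm hD v c c') using 1
  push_cast; ring

theorem edgeOp_edgeOp_self (hD : D.IsAlternating) (c : Fin D.n)
    (x : D.State → D.ArcRing) (v : D.State) :
    edgeOp c (edgeOp c x) v =
      (MvPolynomial.X (D.inArc c true) + MvPolynomial.X (D.outArc c true)) * x v := by
  rw [edgeOp_edgeOp, multiplier_mul_multiplier_flip hD, flip_flip, sign_flip,
    if_neg (lt_irrefl c), sign_mul_self, Int.cast_one, one_mul]

/-- The differential of the cube, on lifts to the polynomial ring. -/
def cubeDiff : (D.State → D.ArcRing) →ₗ[D.ArcRing] D.State → D.ArcRing :=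
  LinearMap.pi fun v => ∑ c : Fin D.n, if v c = true then
    LinearMap.proj (R := D.ArcRing) (φ := fun _ : D.State => D.ArcRing) v ∘ₗ edgeOp c else 0

theorem cubeDiff_apply (x : D.State → D.ArcRing) (v : D.State) :
    cubeDiff x v = ∑ c : Fin D.n, if v c = true then edgeOp c x v else 0 := by
  simp only [cubeDiff, LinearMap.pi_apply, LinearMap.sum_apply]
  refine Finset.sum_congr rfl fun c _ => ?_
  split_ifs <;> rfl

/-- The homotopy given by the reversed edges in the direction of `c`. -/
def cubeHomotopy (c : Fin D.n) : (D.State → D.ArcRing) →ₗ[D.ArcRing] D.State → D.ArcRing :=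
  LinearMap.pi fun v => if v c = true then 0 else
    LinearMap.proj (R := D.ArcRing) (φ := fun _ : D.State => D.ArcRing) v ∘ₗ edgeOp c

theorem cubeHomotopy_apply (c : Fin D.n) (x : D.State → D.ArcRing) (v : D.State) :
    cubeHomotopy c x v = if v c = true then 0 else edgeOp c x v := by
  simp only [cubeHomotopy, LinearMap.pi_apply]
  split_ifs <;> rfl

theorem edgeOp_cubeDiff (c : Fin D.n) (x : D.State → D.ArcRing) (v : D.State) :
    edgeOp c (cubeDiff x) v = ∑ c' : Fin D.n, if flip c v c' = true then
      edgeOp c (edgeOp c' x) v else 0 := by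
  rw [edgeOp_apply, cubeDiff_apply, Finset.mul_sum]
  refine Finset.sum_congr rfl fun c' _ => ?_
  rw [mul_ite, mul_zero, ← edgeOp_apply]

theorem cubeDiff_cubeDiff (hD : D.IsAlternating) (x : D.State → D.ArcRing) (v : D.State) :
    cubeDiff (cubeDiff x) v ∈ D.relIdeal v := by
  classical
  have h1 : cubeDiff (cubeDiff x) v = ∑ c : Fin D.n, ∑ c' : Fin D.n,
      if v c = true ∧ v c' = true ∧ c ≠ c' then edgeOp c (edgeOp c' x) v else 0 := by
    rw [cubeDiff_apply]
    refine Finset.sum_congr rfl fun c _ => ?_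
    split_ifs with hc
    · rw [edgeOp_cubeDiff]
      refine Finset.sum_congr rfl fun c' _ => ?_
      by_cases h : c' = c
      · subst h; simp [hc]
      · simp [flip_ne h, hc, Ne.symm h]
    · simp [hc]
  -- Exchanging `c` and `c'` in the double sum shows that twice the sum vanishes modulo the
  -- relations, and `2` is invertible in `ℚ`.
  have h2 : cubeDiff (cubeDiff x) v + cubeDiff (cubeDiff x) v ∈ D.relIdeal v := by
    nth_rewrite 2 [h1]
    rw [Finset.sum_comm, h1, ← Finset.sum_add_distrib]
    refine sum_mem fun c _ => ?_
    rw [← Finset.sum_add_distrib]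
    refine sum_mem fun c' _ => ?_
    by_cases h : v c = true ∧ v c' = true ∧ c ≠ c'
    · rw [if_pos h, if_pos ⟨h.2.1, h.1, h.2.2.symm⟩]
      exact edgeOp_anticomm hD h.2.2 x v
    · rw [if_neg h, if_neg (fun h' => h ⟨h'.2.1, h'.1, h'.2.2.symm⟩), add_zero]
      exact zero_mem _
  have h3 := Ideal.mul_mem_left _ (MvPolynomial.C (1 / 2 : ℚ)) h2
  rwa [← two_mul, ← mul_assoc, ← map_ofNat MvPolynomial.C 2, ← MvPolynomial.C_mul,
    show (1 / 2 : ℚ) * OfNat.ofNat 2 = 1 by norm_num, MvPolynomial.C_1, one_mul] at h3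

/-- The terms with `c' ≠ c` cancel by anticommutation. Of the two terms with `c' = c`, exactly one
is present at each vertex, and it is the square of the edge operator. So `X_in + X_out` is
null-homotopic, which is why `X` changes its sign from each arc to the next on cohomology. -/
theorem cubeDiff_cubeHomotopy (hD : D.IsAlternating) (c : Fin D.n) (x : D.State → D.ArcRing)
    (v : D.State) :
    cubeDiff (cubeHomotopy c x) v + cubeHomotopy c (cubeDiff x) v -
      (MvPolynomial.X (D.inArc c true) + MvPolynomial.X (D.outArc c true)) * x v
        ∈ D.relIdeal v := by
  classical
  have h1 : cubeDiff (cubeHomotopy c x) v = ∑ c' : Fin D.n,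
      if v c' = true ∧ flip c' v c = false then edgeOp c' (edgeOp c x) v else 0 := by
    rw [cubeDiff_apply]
    refine Finset.sum_congr rfl fun c' _ => ?_
    rw [edgeOp_apply c', cubeHomotopy_apply, edgeOp_apply c' (edgeOp c x)]
    cases v c' <;> cases flip c' v c <;> simp
  have h2 : cubeHomotopy c (cubeDiff x) v = ∑ c' : Fin D.n,
      if v c = false ∧ flip c v c' = true then edgeOp c (edgeOp c' x) v else 0 := by
    rw [cubeHomotopy_apply, edgeOp_cubeDiff]
    cases v c <;> simp
  rw [h1, h2, ← Finset.sum_add_distrib, ← Finset.sum_erase_add _ _ (Finset.mem_univ c),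
    add_sub_assoc]
  refine add_mem (sum_mem fun c' hc' => ?_) ?_
  · have hne : c' ≠ c := Finset.ne_of_mem_erase hc'
    rw [flip_ne hne, flip_ne hne.symm]
    by_cases h : v c' = true ∧ v c = false
    · rw [if_pos h, if_pos h.symm]
      exact edgeOp_anticomm hD hne x v
    · rw [if_neg h, if_neg fun h' => h h'.symm, add_zero]
      exact zero_mem _
  · rw [flip_same, edgeOp_edgeOp_self hD]
    cases v c <;> simp

/-! ### The complex in terms of lifts -/

/-- The class of a polynomial in the module at a vertex. -/
def vertexMk (v : D.State) : D.ArcRing →ₗ[ℚ[X]] D.vertex v :=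
  ((D.relIdeal v).restrictScalars ℚ[X]).mkQ

theorem vertexMk_surjective (v : D.State) : Function.Surjective (vertexMk v) :=
  Submodule.mkQ_surjective _

theorem vertexMk_eq_zero {v : D.State} {p : D.ArcRing} : vertexMk v p = 0 ↔ p ∈ D.relIdeal v :=
  Submodule.Quotient.mk_eq_zero _

theorem mem_gr_vertex {v : D.State} {j : ℤ} {y : D.vertex v} : y ∈ (D.vertex v).gr j ↔
    ∃ p : D.ArcRing, MvPolynomial.IsWeightedHomogeneous (fun _ : D.Arc => (2 : ℤ)) p
      (j - D.shift v) ∧ vertexMk v p = y := Iff.rfl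

theorem edgeMap_vertexMk (v : D.State) (c : Fin D.n) (hc : v c = true) (p : D.ArcRing) :
    D.edgeMap v c hc (vertexMk _ p) = vertexMk v (D.multiplier v c * p) := rfl

/-- The element of the complex in degree `h` that is represented by a family of polynomials. -/
def toChain (h : ℤ) : (D.State → D.ArcRing) →ₗ[ℚ[X]] D.chain h :=
  LinearMap.pi fun v : D.StateIn h => vertexMk v.1 ∘ₗ
    LinearMap.proj (R := ℚ[X]) (φ := fun _ : D.State => D.ArcRing) v.1

theorem toChain_apply (h : ℤ) (x : D.State → D.ArcRing) (v : D.StateIn h) :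
    toChain h x v = vertexMk v.1 (x v.1) := rfl

theorem toChain_eq_zero {h : ℤ} {x : D.State → D.ArcRing} :
    toChain h x = 0 ↔ ∀ v : D.StateIn h, x v.1 ∈ D.relIdeal v.1 := by
  exact funext_iff.trans (forall_congr' fun v => vertexMk_eq_zero)

theorem toChain_eq_iff {h : ℤ} {x y : D.State → D.ArcRing} :
    toChain h x = toChain h y ↔ ∀ v : D.StateIn h, x v.1 - y v.1 ∈ D.relIdeal v.1 := by
  rw [← sub_eq_zero, ← map_sub, toChain_eq_zero]; rfl

/-- The condition `P` lets homogeneous elements be lifted to homogeneous polynomials. Vertices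
outside degree `h` receive the lift `0`, hence the hypothesis `h0`. -/
theorem exists_toChain_eq {h : ℤ} {P : D.State → D.ArcRing → Prop} (h0 : ∀ v, P v 0)
    (y : D.chain h) (hy : ∀ v : D.StateIn h, ∃ p, P v.1 p ∧ vertexMk v.1 p = y v) :
    ∃ x, (∀ v, P v (x v)) ∧ toChain h x = y := by
  classical
  choose p hp hpy using hy
  refine ⟨fun v => if hv : (weight v : ℤ) - D.nNeg = h then p ⟨v, hv⟩ else 0, fun v => ?_, ?_⟩
  · dsimp only
    split_ifs with hv
    · exact hp ⟨v, hv⟩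
    · exact h0 v
  · funext v
    rw [toChain_apply]
    dsimp only
    rw [dif_pos v.2, hpy]

theorem toChain_surjective (h : ℤ) : Function.Surjective (toChain (D := D) h) := fun y => by
  obtain ⟨x, -, hx⟩ := exists_toChain_eq (P := fun _ _ => True) (fun _ => trivial) y
    fun v => (vertexMk_surjective v.1 (y v)).imp fun _ h => ⟨trivial, h⟩
  exact ⟨x, hx⟩

theorem update_eq_flip {v : D.State} {c : Fin D.n} (hc : v c = true) :
    Function.update v c false = flip c v := by simp [flip, hc]

theorem diff_apply (h : ℤ) (y : D.chain h) (v : D.StateIn (h + 1)) :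
    D.diff h y v = ∑ c : Fin D.n, if hc : v.1 c = true then
      sign v.1 c • D.edgeMap v.1 c hc (y (v.pred c hc)) else 0 := by
  refine (LinearMap.sum_apply (M := D.chain h) (M₂ := D.vertex v.1) Finset.univ _ y).trans
    (Finset.sum_congr rfl fun c _ => ?_)
  by_cases hc : v.1 c = true
  · refine (congrArg (fun f : D.chain h →ₗ[ℚ[X]] D.vertex v.1 => f y) (dif_pos hc)).trans
      (Eq.trans ?_ (dif_pos hc).symm)
    rfl
  · refine (congrArg (fun f : D.chain h →ₗ[ℚ[X]] D.vertex v.1 => f y) (dif_neg hc)).trans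
      (Eq.trans ?_ (dif_neg hc).symm)
    rfl

theorem diff_toChain (h : ℤ) (x : D.State → D.ArcRing) :
    D.diff h (toChain h x) = toChain (h + 1) (cubeDiff x) := by
  funext v
  rw [toChain_apply, cubeDiff_apply, map_sum, diff_apply]
  refine Finset.sum_congr rfl fun c _ => ?_
  split_ifs with hc
  · have : D.edgeMap v.1 c hc (vertexMk (Function.update v.1 c false)
        (x (Function.update v.1 c false))) =
      vertexMk v.1 (D.multiplier v.1 c * x (flip c v.1)) := by
      rw [edgeMap_vertexMk, update_eq_flip hc]
    refine (congrArg (sign v.1 c • ·) this).trans ?_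
    rw [edgeOp_apply, mul_assoc, ← zsmul_eq_mul, map_zsmul]
  · simp

theorem weight_flip {v : D.State} {c : Fin D.n} (hc : v c = true) :
    weight (flip c v) + 1 = weight v := by
  rw [← update_eq_flip hc, weight_update v c hc]

/-- The weight rises by one along the edge. A merge loses a circle, so the shift does not change. A
split gains one, so the shift drops by two, which the multiplier of degree `2` makes up for. -/
theorem isWeightedHomogeneous_edgeOp (hD : D.IsAlternating) {j : ℤ} {x : D.State → D.ArcRing}
    (hx : ∀ v, MvPolynomial.IsWeightedHomogeneous (fun _ : D.Arc => (2 : ℤ)) (x v) (j - D.shift v))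
    {v : D.State} {c : Fin D.n} (hc : v c = true) :
    MvPolynomial.IsWeightedHomogeneous (fun _ : D.Arc => (2 : ℤ)) (edgeOp c x v)
      (j - D.shift v) := by
  have hw := weight_flip hc
  have hcirc := hD.card_circle_flip v c
  have hxv := hx (flip c v)
  rw [edgeOp_apply, mul_assoc]
  have hsign : MvPolynomial.IsWeightedHomogeneous (fun _ : D.Arc => (2 : ℤ))
      ((sign v c : ℤ) : D.ArcRing) 0 := by
    rw [← map_intCast (MvPolynomial.C (σ := D.Arc) (R := ℚ))]
    exact MvPolynomial.isWeightedHomogeneous_C _ _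
  by_cases h : Sim v (D.inArc c true) (D.outArc c true)
  · rw [if_pos h] at hcirc
    rw [multiplier_of_sim h, one_mul]
    convert! hsign.mul hxv using 1
    unfold shift; omega
  · rw [if_neg h] at hcirc
    rw [multiplier_of_not_sim h]
    convert! hsign.mul (((MvPolynomial.isWeightedHomogeneous_X ℚ (fun _ : D.Arc => (2 : ℤ))
      (D.inArc c true)).add (MvPolynomial.isWeightedHomogeneous_X ℚ (fun _ : D.Arc => (2 : ℤ))
      (D.outArc c true))).mul hxv) using 1
    unfold shift; omega

theorem IsAlternating.isGradedComplex (hD : D.IsAlternating) : D.IsGradedComplex where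
  diff_mem h j y hy := by
    obtain ⟨x, hx, rfl⟩ := exists_toChain_eq
      (P := fun v p => MvPolynomial.IsWeightedHomogeneous (fun _ : D.Arc => (2 : ℤ)) p
        (j - D.shift v)) (fun v => MvPolynomial.isWeightedHomogeneous_zero _ _ _) y
      fun v => mem_gr_vertex.1 (hy v trivial)
    rw [diff_toChain]
    intro v _
    refine mem_gr_vertex.2 ⟨_, ?_, rfl⟩
    change MvPolynomial.IsWeightedHomogeneous _ (cubeDiff x v.1) _
    rw [cubeDiff_apply]
    refine MvPolynomial.IsWeightedHomogeneous.sum _ _ _ fun c _ => ?_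
    split_ifs with hc
    · exact isWeightedHomogeneous_edgeOp hD hx hc
    · exact MvPolynomial.isWeightedHomogeneous_zero _ _ _
  diff_diff h y := by
    obtain ⟨x, rfl⟩ := toChain_surjective h y
    rw [diff_toChain, diff_toChain]
    exact toChain_eq_zero.2 fun v => cubeDiff_cubeDiff hD x v.1

end GaussCode

namespace GaussCode

variable {D : GaussCode}

/-! ### The module at a vertex is finitely generated and torsion-free -/

theorem smul_arcRing (q : ℚ[X]) (p : D.ArcRing) :
    q • p = Polynomial.aeval (MvPolynomial.X (0 : D.Arc) : D.ArcRing) q * p := Algebra.smul_def q p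

theorem X_smul_arcRing (p : D.ArcRing) :
    (X : ℚ[X]) • p = (MvPolynomial.X (0 : D.Arc) : D.ArcRing) * p := by
  rw [smul_arcRing, aeval_X]

instance : IsScalarTower ℚ ℚ[X] D.ArcRing := IsScalarTower.of_algebraMap_eq fun q => by
  rw [Polynomial.algebraMap_apply]
  exact (Polynomial.aeval_C (MvPolynomial.X (0 : D.Arc) : D.ArcRing) q).symm

/-- The product of the variables of the circles in `S`. -/
def circleProd (v : D.State) (S : Finset (D.Circle v)) : D.ArcRing :=
  ∏ C ∈ S, MvPolynomial.X (Quot.out C)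

theorem sim_out (v : D.State) (e : D.Arc) : Sim v e (Quot.out (D.circle v e)) :=
  (Quot.out_eq (D.circle v e)).symm

/-- The sets of circles that do not pass through the base point. -/
abbrev FreeCircles (v : D.State) : Type := {S : Finset (D.Circle v) // D.circle v 0 ∉ S}

instance (v : D.State) : Finite (FreeCircles v) := by
  classical
  have := Fintype.ofFinite (D.Circle v)
  infer_instance

/-- The relations together with the span of the products of distinct circles. -/
def circleSpan (v : D.State) : Submodule ℚ[X] D.ArcRing :=
  Submodule.span ℚ[X] (Set.range fun S : FreeCircles v => circleProd v S.1) ⊔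
    (D.relIdeal v).restrictScalars ℚ[X]

/-- Modulo the relations, `X_e` acts as the scalar `X` if `e` is on the base circle. Otherwise the
circle of `e` either is new and joins the product, or is already a factor and then leaves it with
the scalar `X ^ 2`. -/
theorem mul_X_mem_circleSpan (v : D.State) (e : D.Arc) {p : D.ArcRing} (hp : p ∈ circleSpan v) :
    p * MvPolynomial.X e ∈ circleSpan v := by
  classical
  have hI : ∀ p ∈ D.relIdeal v, p ∈ circleSpan v := fun p hp =>
    (le_sup_right : _ ≤ circleSpan v) hp
  have hS : ∀ S : FreeCircles v, circleProd v S.1 ∈ circleSpan v := fun S =>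
    (le_sup_left : _ ≤ circleSpan v) (Submodule.subset_span ⟨S, rfl⟩)
  obtain ⟨q, hq, r, hr, rfl⟩ := Submodule.mem_sup.1 hp
  rw [add_mul]
  refine add_mem ?_ (hI _ (Ideal.mul_mem_right _ _ hr))
  clear hp
  induction hq using Submodule.span_induction with
  | zero => rw [zero_mul]; exact zero_mem _
  | add x y _ _ hx hy => rw [add_mul]; exact add_mem hx hy
  | smul a x _ hx => rw [smul_mul_assoc]; exact Submodule.smul_mem _ a hx
  | mem x hx =>
    obtain ⟨⟨S, hS0⟩, rfl⟩ := hx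
    dsimp only
    set C := D.circle v e with hC
    by_cases h0 : C = D.circle v 0
    · have h1 : circleProd v S * MvPolynomial.X e =
          (X : ℚ[X]) • circleProd v S +
            circleProd v S * (MvPolynomial.X e - MvPolynomial.X 0) := by
        rw [X_smul_arcRing]; ring
      rw [h1]
      exact add_mem (Submodule.smul_mem _ _ (hS ⟨S, hS0⟩))
        (hI _ (Ideal.mul_mem_left _ _ (Sim.sub_mem h0)))
    have h1 : circleProd v S * MvPolynomial.X e = circleProd v S * MvPolynomial.X (Quot.out C) +
        circleProd v S * (MvPolynomial.X e - MvPolynomial.X (Quot.out C)) := by ring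
    rw [h1]
    refine add_mem ?_ (hI _ (Ideal.mul_mem_left _ _ (sim_out v e).sub_mem))
    by_cases hCS : C ∈ S
    · have h2 : circleProd v S = circleProd v (S.erase C) * MvPolynomial.X (Quot.out C) :=
        (Finset.prod_erase_mul S _ hCS).symm
      have h3 : circleProd v S * MvPolynomial.X (Quot.out C) =
          (X : ℚ[X]) • (X : ℚ[X]) • circleProd v (S.erase C) + circleProd v (S.erase C) *
            (MvPolynomial.X (Quot.out C) ^ 2 - MvPolynomial.X 0 ^ 2) := by
        rw [h2, X_smul_arcRing, X_smul_arcRing]; ring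
      rw [h3]
      exact add_mem (Submodule.smul_mem _ _ (Submodule.smul_mem _ _
        (hS ⟨S.erase C, fun h => hS0 (Finset.mem_of_mem_erase h)⟩)))
        (hI _ (Ideal.mul_mem_left _ _ (sq_sub_sq_mem_relIdeal v _ _)))
    · have h2 : circleProd v S * MvPolynomial.X (Quot.out C) = circleProd v (insert C S) := by
        rw [circleProd, circleProd, Finset.prod_insert hCS, mul_comm]
      rw [h2]
      refine hS ⟨insert C S, fun h => ?_⟩
      rcases Finset.mem_insert.1 h with h | h
      · exact h0 h.symm
      · exact hS0 h

theorem mem_circleSpan (v : D.State) (p : D.ArcRing) : p ∈ circleSpan v := by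
  induction p using MvPolynomial.induction_on with
  | C a =>
    have h1 : (1 : D.ArcRing) ∈ circleSpan v :=
      (le_sup_left : _ ≤ circleSpan v)
        (Submodule.subset_span ⟨⟨∅, Finset.notMem_empty _⟩, by simp [circleProd]⟩)
    have h2 : (MvPolynomial.C a : D.ArcRing) = (Polynomial.C a : ℚ[X]) • (1 : D.ArcRing) := by
      rw [smul_arcRing, aeval_C, mul_one]; rfl
    rw [h2]
    exact Submodule.smul_mem _ _ h1
  | add p q hp hq => exact add_mem hp hq
  | mul_X p e hp => exact mul_X_mem_circleSpan v e hp

instance (v : D.State) : Module.Finite ℚ[X] (D.vertex v) := by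
  have h : Submodule.map (vertexMk v)
      (Submodule.span ℚ[X] (Set.range fun S : FreeCircles v => circleProd v S.1)) = ⊤ := by
    refine eq_top_iff.2 fun y _ => ?_
    obtain ⟨p, rfl⟩ := vertexMk_surjective v y
    obtain ⟨q, hq, r, hr, rfl⟩ := Submodule.mem_sup.1 (mem_circleSpan v p)
    exact ⟨q, hq, by rw [map_add, vertexMk_eq_zero.2 hr, add_zero]⟩
  refine ⟨h ▸ ?_⟩
  exact (Submodule.fg_span (Set.finite_range _)).map _

open Classical in
/-- An element of the group algebra, over `ℚ[X]`, of the vector space generated by the circles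
modulo `2`: the square of each circle is the identity. -/
def circleElt (v : D.State) (C : D.Circle v) : D.Circle v → ZMod 2 :=
  Pi.single C 1 + Pi.single (D.circle v 0) 1

/-- The representation of polynomials in the arcs in the group algebra generated by the circles. -/
def toGroupAlgebra (v : D.State) : D.ArcRing →ₐ[ℚ] AddMonoidAlgebra ℚ[X] (D.Circle v → ZMod 2) :=
  MvPolynomial.aeval fun e => AddMonoidAlgebra.single (circleElt v (D.circle v e)) X

theorem toGroupAlgebra_X (v : D.State) (e : D.Arc) :
    toGroupAlgebra v (MvPolynomial.X e) =
      AddMonoidAlgebra.single (circleElt v (D.circle v e)) X :=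
  MvPolynomial.aeval_X _ e

theorem two_nsmul_zmod_two {ι : Type*} (g : ι → ZMod 2) : 2 • g = 0 := by
  rw [two_nsmul]; funext i; exact CharTwo.add_self_eq_zero _

theorem toGroupAlgebra_smul (v : D.State) (q : ℚ[X]) (p : D.ArcRing) :
    toGroupAlgebra v (q • p) = q • toGroupAlgebra v p := by
  rw [smul_arcRing, map_mul, ← Polynomial.aeval_algHom_apply, toGroupAlgebra_X, Algebra.smul_def]
  congr 1
  -- The base circle is added to itself modulo `2`, so arc `0` goes to the scalar `X`; this makes
  -- the representation `ℚ[X]`-linear.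
  have : (AddMonoidAlgebra.single (circleElt v (D.circle v 0)) X :
      AddMonoidAlgebra ℚ[X] (D.Circle v → ZMod 2)) = algebraMap ℚ[X] _ X := by
    rw [circleElt, ← two_nsmul, two_nsmul_zmod_two]; rfl
  rw [this, Polynomial.aeval_algebraMap_apply]
  simp

theorem toGroupAlgebra_relIdeal {v : D.State} {p : D.ArcRing} (hp : p ∈ D.relIdeal v) :
    toGroupAlgebra v p = 0 := by
  have : D.relIdeal v ≤ RingHom.ker (toGroupAlgebra v) := by
    refine Ideal.span_le.2 ?_
    rintro _ (⟨e, f⟩ | ⟨e, f, h⟩)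
    · change toGroupAlgebra v _ = 0
      rw [map_sub, map_pow, map_pow, toGroupAlgebra_X, toGroupAlgebra_X,
        AddMonoidAlgebra.single_pow, AddMonoidAlgebra.single_pow, two_nsmul_zmod_two,
        two_nsmul_zmod_two, sub_self]
    · change toGroupAlgebra v _ = 0
      rw [map_sub, toGroupAlgebra_X, toGroupAlgebra_X,
        show D.circle v e = D.circle v f from h.sim, sub_self]
  exact this hp

theorem toGroupAlgebra_circleProd (v : D.State) (S : Finset (D.Circle v)) :
    toGroupAlgebra v (circleProd v S) =
      AddMonoidAlgebra.single (∑ C ∈ S, circleElt v C) (X ^ S.card) := by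
  classical
  induction S using Finset.induction_on with
  | empty => simp [circleProd]; rfl
  | insert C S h ih =>
    rw [circleProd, Finset.prod_insert h, map_mul, ← circleProd, ih, toGroupAlgebra_X,
      AddMonoidAlgebra.single_mul_single, Finset.sum_insert h, Finset.card_insert_of_notMem h,
      pow_succ', show D.circle v (Quot.out C) = C from Quot.out_eq C]

theorem sum_circleElt_injective (v : D.State) :
    Function.Injective fun S : FreeCircles v => ∑ C ∈ S.1, circleElt v C := by
  classical
  have key : ∀ (S : FreeCircles v) (C : D.Circle v), C ≠ D.circle v 0 →
      (∑ C ∈ S.1, circleElt v C) C = if C ∈ S.1 then 1 else 0 := by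
    intro S C hC
    rw [Finset.sum_apply, ← Finset.sum_ite_eq' S.1 C (fun _ => (1 : ZMod 2))]
    refine Finset.sum_congr rfl fun B _ => ?_
    simp [circleElt, Pi.single_apply, hC, eq_comm]
  intro S T hST
  refine Subtype.ext (Finset.ext fun C => ?_)
  by_cases hC : C = D.circle v 0
  · subst hC; exact iff_of_false S.2 T.2
  · have h := (key S C hC).symm.trans ((congrFun hST C).trans (key T C hC))
    by_cases h1 : C ∈ S.1 <;> by_cases h2 : C ∈ T.1 <;> simp_all

/-- The spanning products go to nonzero multiples of distinct group elements, so a combination of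
them that is mapped to zero has zero coefficients. Hence the module at a vertex embeds in a free
module and is torsion-free. -/
theorem toGroupAlgebra_eq_zero {v : D.State} {p : D.ArcRing} :
    toGroupAlgebra v p = 0 ↔ p ∈ D.relIdeal v := by
  classical
  refine ⟨fun h => ?_, toGroupAlgebra_relIdeal⟩
  have := Fintype.ofFinite (FreeCircles v)
  obtain ⟨q, hq, r, hr, rfl⟩ := Submodule.mem_sup.1 (mem_circleSpan v p)
  obtain ⟨a, rfl⟩ := (Submodule.mem_span_range_iff_exists_fun _).1 hq
  rw [map_add, toGroupAlgebra_relIdeal hr, add_zero, map_sum] at h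
  have ha : ∀ S, a S = 0 := by
    intro S
    have h1 := congrArg (fun f => f.coeff (∑ C ∈ S.1, circleElt v C)) h
    simp only [toGroupAlgebra_smul, toGroupAlgebra_circleProd, AddMonoidAlgebra.coeff_sum,
      AddMonoidAlgebra.smul_single, AddMonoidAlgebra.coeff_single, Finsupp.coe_finsetSum,
      Finset.sum_apply, AddMonoidAlgebra.coeff_zero, Finsupp.coe_zero, Pi.zero_apply] at h1
    rw [Finset.sum_eq_single S] at h1
    · rw [Finsupp.single_eq_same, smul_eq_mul] at h1
      exact (mul_eq_zero.1 h1).resolve_right (pow_ne_zero _ X_ne_zero)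
    · intro T _ hT
      exact Finsupp.single_eq_of_ne fun h' => hT (sum_circleElt_injective v h'.symm)
    · intro h'; exact absurd (Finset.mem_univ _) h'
  simpa [ha] using hr

instance (v : D.State) : Module.IsTorsionFree ℚ[X] (D.vertex v) := by
  let f : D.vertex v → AddMonoidAlgebra ℚ[X] (D.Circle v → ZMod 2) :=
    fun y => toGroupAlgebra v (vertexMk_surjective v y).choose
  have hf : ∀ p, f (vertexMk v p) = toGroupAlgebra v p := fun p => by
    rw [← sub_eq_zero, ← map_sub, toGroupAlgebra_eq_zero, ← vertexMk_eq_zero, map_sub,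
      (vertexMk_surjective v (vertexMk v p)).choose_spec, sub_self]
  refine Function.Injective.moduleIsTorsionFree f ?_ ?_
  · intro y z h
    obtain ⟨p, rfl⟩ := vertexMk_surjective v y
    obtain ⟨q, rfl⟩ := vertexMk_surjective v z
    rwa [hf, hf, ← sub_eq_zero, ← map_sub, toGroupAlgebra_eq_zero, ← vertexMk_eq_zero, map_sub,
      sub_eq_zero] at h
  · intro r y
    obtain ⟨p, rfl⟩ := vertexMk_surjective v y
    rw [← map_smul, hf, hf, toGroupAlgebra_smul]

instance (h : ℤ) : Module.Finite ℚ[X] (D.chain h) :=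
  inferInstanceAs (Module.Finite ℚ[X] (∀ v : D.StateIn h, (D.vertex v.1 : Type)))

instance (h : ℤ) : Module.IsTorsionFree ℚ[X] (D.chain h) :=
  inferInstanceAs (Module.IsTorsionFree ℚ[X] (∀ v : D.StateIn h, (D.vertex v.1 : Type)))

theorem exists_finset_subsingleton_chain (D : GaussCode) :
    ∃ S : Finset ℤ, ∀ h ∉ S, Subsingleton (D.chain h) := by
  classical
  refine ⟨Finset.univ.image fun v : D.State => (weight v : ℤ) - D.nNeg, fun h hh => ?_⟩
  have : IsEmpty (D.StateIn h) :=
    ⟨fun v => hh (Finset.mem_image.2 ⟨v.1, Finset.mem_univ _, v.2⟩)⟩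
  exact inferInstanceAs (Subsingleton (∀ v : D.StateIn h, (D.vertex v.1 : Type)))

end GaussCode

namespace GaussCode

variable {D : GaussCode}

/-! ### Lee's computation: the free part of the cohomology -/

/-- The lifts of boundaries in cohomological degree `h`. -/
def boundaryLifts (D : GaussCode) (h : ℤ) : Submodule D.ArcRing (D.State → D.ArcRing) where
  carrier := {x | ∃ w, ∀ v : D.StateIn h, x v.1 - cubeDiff w v.1 ∈ D.relIdeal v.1}
  zero_mem' := ⟨0, fun v => by simp⟩
  add_mem' := by
    rintro x y ⟨w, hw⟩ ⟨w', hw'⟩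
    refine ⟨w + w', fun v => ?_⟩
    rw [map_add, Pi.add_apply, Pi.add_apply, add_sub_add_comm]
    exact add_mem (hw v) (hw' v)
  smul_mem' := by
    rintro r x ⟨w, hw⟩
    refine ⟨r • w, fun v => ?_⟩
    rw [map_smul, Pi.smul_apply, Pi.smul_apply, ← smul_sub]
    exact Ideal.mul_mem_left _ _ (hw v)

/-- The lifts of cycles in cohomological degree `h`. -/
def cycleLifts (D : GaussCode) (h : ℤ) : Submodule D.ArcRing (D.State → D.ArcRing) where
  carrier := {x | ∀ v : D.StateIn (h + 1), cubeDiff x v.1 ∈ D.relIdeal v.1}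
  zero_mem' := fun v => by simp
  add_mem' := fun {x y} hx hy v => by
    rw [map_add, Pi.add_apply]; exact add_mem (hx v) (hy v)
  smul_mem' := fun r x hx v => by
    rw [map_smul, Pi.smul_apply]; exact Ideal.mul_mem_left _ _ (hx v)

theorem mem_boundaryLifts_of_relIdeal {h : ℤ} {x : D.State → D.ArcRing}
    (hx : ∀ v : D.StateIn h, x v.1 ∈ D.relIdeal v.1) : x ∈ D.boundaryLifts h :=
  ⟨0, fun v => by simpa using hx v⟩

/-- On a cycle, the homotopy identity writes `(X_in + X_out) x` as a boundary for the over-strand.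
In either smoothing the joints at `c` make the sum for the under-strand equal to it. -/
theorem add_smul_mem_boundaryLifts (hD : D.IsAlternating) {h : ℤ} {x : D.State → D.ArcRing}
    (hx : x ∈ D.cycleLifts h) (c : Fin D.n) (b : Bool) :
    (MvPolynomial.X (D.inArc c b) + MvPolynomial.X (D.outArc c b) : D.ArcRing) • x ∈
      D.boundaryLifts h := by
  have htrue : (MvPolynomial.X (D.inArc c true) + MvPolynomial.X (D.outArc c true) : D.ArcRing) • x
      ∈ D.boundaryLifts h := by
    refine ⟨cubeHomotopy c x, fun v => ?_⟩
    have h1 := cubeDiff_cubeHomotopy hD c x v.1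
    have h2 : cubeHomotopy c (cubeDiff x) v.1 ∈ D.relIdeal v.1 := by
      rw [cubeHomotopy_apply]
      split_ifs with hv
      · exact zero_mem _
      · rw [edgeOp_apply, mul_assoc]
        refine Ideal.mul_mem_left _ _ (multiplier_mul_mem_of_flip _ _ (hx ⟨flip c v.1, ?_⟩))
        have := weight_flip (v := flip c v.1) (c := c) (by simpa using hv)
        rw [flip_flip] at this
        have := v.2
        omega
    rw [Pi.smul_apply, smul_eq_mul, ← neg_mem_iff]
    convert! sub_mem h1 h2 using 1
    ring
  cases b
  · have h2 : (MvPolynomial.X (D.inArc c true) + MvPolynomial.X (D.outArc c true) : D.ArcRing) • x -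
        (MvPolynomial.X (D.inArc c false) + MvPolynomial.X (D.outArc c false) : D.ArcRing) • x ∈
          D.boundaryLifts h := by
      refine mem_boundaryLifts_of_relIdeal fun v => ?_
      rw [← sub_smul, Pi.smul_apply, smul_eq_mul]
      refine Ideal.mul_mem_right _ _ ?_
      by_cases hv : v.1 c = D.positive c
      · convert! add_mem (Joined.unoriented_in c hv).sim.sub_mem
          (Joined.unoriented_out c hv).sim.sub_mem using 1
        ring
      · convert! sub_mem (Joined.oriented c true hv).sim.sub_mem
          (Joined.oriented c false hv).sim.sub_mem using 1
        simp only [Bool.not_true, Bool.not_false]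
        ring
    simpa using sub_mem htrue h2
  · exact htrue

/-- Each passage through a crossing changes the sign with which the variable acts on classes. -/
theorem sub_smul_mem_boundaryLifts (hD : D.IsAlternating) {h : ℤ} {x : D.State → D.ArcRing}
    (hx : x ∈ D.cycleLifts h) (k : D.Arc) :
    (MvPolynomial.X k - (-1) ^ (k : ℕ) * MvPolynomial.X 0 : D.ArcRing) • x ∈
      D.boundaryLifts h := by
  refine D.arc_induction (p := fun k => (MvPolynomial.X k - (-1) ^ (k : ℕ) * MvPolynomial.X 0 :
    D.ArcRing) • x ∈ D.boundaryLifts h) (by simp) (fun c b ih => ?_) k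
  have h1 := sub_mem (add_smul_mem_boundaryLifts hD hx c b) ih
  have : ((D.outArc c b : D.Arc) : ℕ) = (D.inArc c b : D.Arc) + 1 := by simp [inArc, outArc]
  rw [this, pow_succ]
  convert! h1 using 1
  rw [← sub_smul]
  congr 1
  ring

/-- The element that projects to the part where the variables of consecutive arcs have opposite
signs. -/
def altProd (D : GaussCode) : D.ArcRing :=
  ∏ k : D.Arc, (MvPolynomial.X 0 + (-1) ^ (k : ℕ) * MvPolynomial.X k)

theorem neg_one_pow_mul_self {R : Type*} [CommRing R] (k : ℕ) :
    ((-1) ^ k * (-1) ^ k : R) = 1 := by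
  rw [← mul_pow]; simp

theorem altProd_sub_smul_mem (hD : D.IsAlternating) {h : ℤ} {x : D.State → D.ArcRing}
    (hx : x ∈ D.cycleLifts h) :
    (D.altProd - (2 * MvPolynomial.X 0) ^ (2 * D.n + 1)) • x ∈ D.boundaryLifts h := by
  -- The annihilator of the class of `x`. Modulo it, every factor of `altProd` equals `2 X_0`.
  let J : Ideal D.ArcRing := (D.boundaryLifts h).comap (LinearMap.toSpanSingleton D.ArcRing _ x)
  have hJ : ∀ r : D.ArcRing, r ∈ J ↔ r • x ∈ D.boundaryLifts h := fun r => Iff.rfl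
  rw [← hJ, ← Ideal.Quotient.mk_eq_mk_iff_sub_mem, altProd, map_prod, map_pow]
  have : ∀ k : D.Arc, Ideal.Quotient.mk J (MvPolynomial.X 0 + (-1) ^ (k : ℕ) * MvPolynomial.X k) =
      Ideal.Quotient.mk J (2 * MvPolynomial.X 0) := fun k => by
    rw [Ideal.Quotient.mk_eq_mk_iff_sub_mem]
    have h1 := J.mul_mem_left ((-1) ^ (k : ℕ)) ((hJ _).2 (sub_smul_mem_boundaryLifts hD hx k))
    convert! h1 using 1
    linear_combination (MvPolynomial.X 0) * neg_one_pow_mul_self (R := D.ArcRing) (k : ℕ)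
  simp only [this, Finset.prod_const, Finset.card_univ, Fintype.card_fin]

/-- The oriented resolution. -/
def orientedState (D : GaussCode) : D.State := fun c => !D.positive c

theorem weight_orientedState : (weight D.orientedState : ℤ) - D.nNeg = 0 := by
  simp [weight, nNeg, orientedState]

theorem neg_one_pow_pass (hD : D.IsAlternating) (c : Fin D.n) (b : Bool) {R : Type*} [CommRing R] :
    ((-1) ^ (D.pass (c, !b) : ℕ) : R) = -(-1) ^ (D.pass (c, b) : ℕ) := by
  have h := (hD c b).neg_one_pow (α := R)
  rw [pow_add] at h
  linear_combination ((-1) ^ (D.pass (c, b) : ℕ)) * h -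
    ((-1) ^ (D.pass (c, !b) : ℕ)) * neg_one_pow_mul_self (R := R) (D.pass (c, b) : ℕ)

/-- At a crossing with the unoriented smoothing the two incoming arcs are joined, but their numbers
have opposite parities. Modulo the relations, the product of their two factors is `X_0 ^ 2 - X_a ^
2`, which is zero. -/
theorem altProd_mem_relIdeal (hD : D.IsAlternating) {v : D.State} (hv : v ≠ D.orientedState) :
    D.altProd ∈ D.relIdeal v := by
  classical
  obtain ⟨c, hc⟩ := Function.ne_iff.1 hv
  have hc' : v c = D.positive c := by
    simp only [orientedState] at hc
    cases h1 : v c <;> cases h2 : D.positive c <;> simp_all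
  have hs := (Joined.unoriented_in c hc').sim.sub_mem
  have hne : D.inArc c true ≠ D.inArc c false := fun h => by
    have := D.pass.injective (Fin.castSucc_injective _ h)
    simp at this
  have hdvd : (∏ k ∈ {D.inArc c true, D.inArc c false},
      (MvPolynomial.X 0 + (-1) ^ (k : ℕ) * MvPolynomial.X k) : D.ArcRing) ∣ D.altProd :=
    Finset.prod_dvd_prod_of_subset _ _ _ (Finset.subset_univ _)
  refine Ideal.mem_of_dvd _ hdvd ?_
  rw [Finset.prod_pair hne]
  have hp : ((-1) ^ ((D.inArc c false : D.Arc) : ℕ) : D.ArcRing) =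
      -(-1) ^ ((D.inArc c true : D.Arc) : ℕ) := neg_one_pow_pass hD c true
  rw [hp]
  have h1 := (D.relIdeal v).mul_mem_left ((-1) ^ ((D.inArc c true : D.Arc) : ℕ) *
    MvPolynomial.X 0 + MvPolynomial.X (D.inArc c true)) hs
  have h2 := sq_sub_sq_mem_relIdeal v 0 (D.inArc c true)
  convert! add_mem h1 h2 using 1
  linear_combination (-MvPolynomial.X (D.inArc c true) * MvPolynomial.X (D.inArc c false)) *
    neg_one_pow_mul_self (R := D.ArcRing) ((D.inArc c true : D.Arc) : ℕ)

/-- The evaluation at the alternating signs. -/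
def altEval (D : GaussCode) : D.ArcRing →ₐ[ℚ] ℚ[X] :=
  MvPolynomial.aeval fun k => (-1) ^ (k : ℕ) * X

theorem altEval_X (k : D.Arc) : D.altEval (MvPolynomial.X k) = (-1) ^ (k : ℕ) * X :=
  MvPolynomial.aeval_X _ k

theorem altEval_smul (q : ℚ[X]) (p : D.ArcRing) : D.altEval (q • p) = q * D.altEval p := by
  rw [smul_arcRing, map_mul, ← Polynomial.aeval_algHom_apply, altEval_X]
  simp

theorem altEval_altProd : D.altEval D.altProd = (2 * X) ^ (2 * D.n + 1) := by
  rw [altProd, map_prod]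
  have : ∀ k : D.Arc, D.altEval (MvPolynomial.X 0 + (-1) ^ (k : ℕ) * MvPolynomial.X k) = 2 * X := by
    intro k
    rw [map_add, map_mul, map_pow, map_neg, map_one, altEval_X, altEval_X]
    simp only [Fin.val_zero, pow_zero]
    linear_combination X * neg_one_pow_mul_self (R := ℚ[X]) (k : ℕ)
  simp only [this, Finset.prod_const, Finset.card_univ, Fintype.card_fin]

/-- The oriented smoothing joins only arcs of equal parity, so the alternating signs are constant on
its circles. -/
theorem altEval_relIdeal (hD : D.IsAlternating) {p : D.ArcRing}
    (hp : p ∈ D.relIdeal D.orientedState) : D.altEval p = 0 := by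
  have : D.relIdeal D.orientedState ≤ RingHom.ker D.altEval := by
    refine Ideal.span_le.2 ?_
    rintro _ (⟨e, f⟩ | ⟨e, f, h⟩) <;> change D.altEval _ = 0
    · rw [map_sub, map_pow, map_pow, altEval_X, altEval_X]
      linear_combination X ^ 2 * neg_one_pow_mul_self (R := ℚ[X]) (e : ℕ) -
        X ^ 2 * neg_one_pow_mul_self (R := ℚ[X]) (f : ℕ)
    · rw [map_sub, altEval_X, altEval_X, sub_eq_zero]
      congr 1
      cases h with
      | base => simp
      | oriented c b h =>
        have h1 : ((-1) ^ ((D.outArc c (!b) : D.Arc) : ℕ) : ℚ[X]) =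
            (-1) ^ (D.pass (c, !b) : ℕ) * (-1) := pow_succ _ _
        rw [h1, neg_one_pow_pass hD, mul_neg_one, neg_neg]; rfl
      | unoriented_in c h => exact absurd h (by simp [orientedState])
      | unoriented_out c h => exact absurd h (by simp [orientedState])
  exact this hp

/-- `altProd` is a common eigenvector: multiplied by its own factor with index `k`, the variable
`X_k` becomes `(-1) ^ k X_0`, because the squares of the variables agree. -/
theorem mul_altProd_sub_mem (v : D.State) (p : D.ArcRing) :
    p * D.altProd - D.altEval p • D.altProd ∈ D.relIdeal v := by
  classical
  induction p using MvPolynomial.induction_on with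
  | C a =>
    rw [smul_arcRing]
    have : D.altEval (MvPolynomial.C a) = Polynomial.C a := MvPolynomial.aeval_C _ a
    rw [this, aeval_C]
    change MvPolynomial.C a * D.altProd - MvPolynomial.C a * D.altProd ∈ _
    rw [sub_self]; exact zero_mem _
  | add p q hp hq =>
    rw [map_add, add_mul, add_smul, add_sub_add_comm]; exact add_mem hp hq
  | mul_X p k hp =>
    have h1 : (MvPolynomial.X k - (-1) ^ (k : ℕ) * MvPolynomial.X 0) * D.altProd ∈
        D.relIdeal v := by
      rw [altProd, ← Finset.mul_prod_erase _ _ (Finset.mem_univ k), ← mul_assoc]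
      refine Ideal.mul_mem_right _ _ ?_
      have h2 := (D.relIdeal v).mul_mem_left ((-1) ^ (k : ℕ)) (sq_sub_sq_mem_relIdeal v k 0)
      convert! h2 using 1
      linear_combination (-MvPolynomial.X 0 * MvPolynomial.X k) *
        neg_one_pow_mul_self (R := D.ArcRing) (k : ℕ)
    have h2 := (D.relIdeal v).mul_mem_left p h1
    have h3 := (D.relIdeal v).mul_mem_left ((-1) ^ (k : ℕ) * MvPolynomial.X 0) hp
    have h4 : ((D.altEval p * ((-1) ^ (k : ℕ) * X)) • D.altProd : D.ArcRing) =
        (-1) ^ (k : ℕ) * MvPolynomial.X 0 * D.altEval p • D.altProd := by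
      rw [smul_arcRing, smul_arcRing, map_mul, map_mul, map_pow, map_neg, map_one, aeval_X]
      ring
    rw [map_mul, altEval_X, h4]
    convert! add_mem h2 h3 using 1
    ring

open Classical in
/-- The lift of the cycle that generates the free part of the cohomology. -/
def leeLift (D : GaussCode) : D.State → D.ArcRing := Pi.single D.orientedState D.altProd

theorem leeLift_mem_cycleLifts (hD : D.IsAlternating) : D.leeLift ∈ D.cycleLifts 0 := by
  classical
  intro v
  have h1 : D.leeLift = D.altProd • Pi.single D.orientedState 1 := by
    rw [leeLift, ← Pi.single_smul, smul_eq_mul, mul_one]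
  rw [h1, map_smul, Pi.smul_apply]
  refine Ideal.mul_mem_right _ _ (altProd_mem_relIdeal hD fun h => ?_)
  have h2 := v.2
  rw [h, weight_orientedState] at h2
  omega

/-- Suppose that the multiple is the boundary of `w`, and multiply by `altProd`. Since `altProd` is
zero at the neighbours of the oriented state, the boundary of `altProd • w` is zero there. What
remains is `p • altProd ^ 2` among the relations, and `altEval` sends it to `p (2 X) ^ (4 n + 2)`,
so `p = 0`. -/
theorem smul_leeLift_notMem (hD : D.IsAlternating) {p : ℚ[X]} (hp : p ≠ 0) :
    p • D.leeLift ∉ D.boundaryLifts 0 := by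
  classical
  rintro ⟨w, hw⟩
  have h1 := hw ⟨D.orientedState, weight_orientedState⟩
  have h2 : D.altProd * cubeDiff w D.orientedState ∈ D.relIdeal D.orientedState := by
    have : D.altProd * cubeDiff w D.orientedState = cubeDiff (D.altProd • w) D.orientedState := by
      rw [map_smul]; rfl
    rw [this, cubeDiff_apply]
    refine sum_mem fun c _ => ?_
    split_ifs with hc
    · rw [edgeOp_apply, mul_assoc]
      refine Ideal.mul_mem_left _ _ (multiplier_mul_mem_of_flip _ _ ?_)
      refine Ideal.mul_mem_right _ _ (altProd_mem_relIdeal hD fun h => ?_)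
      have := congrFun h c
      simp at this
    · exact zero_mem _
  have h3 := add_mem ((D.relIdeal D.orientedState).mul_mem_left D.altProd h1) h2
  rw [← mul_add, sub_add_cancel] at h3
  have h4 := altEval_relIdeal hD h3
  rw [leeLift, Pi.smul_apply, Pi.single_eq_same, map_mul, altEval_smul, altEval_altProd] at h4
  have : (2 * X : ℚ[X]) ≠ 0 := mul_ne_zero two_ne_zero X_ne_zero
  simp_all

/-- On classes `altProd` acts as `(2 X) ^ (2 n + 1)`, and it is zero at every vertex of degree other
than `0`, as the oriented state lies in degree `0`. -/
theorem exists_smul_mem_boundaryLifts (hD : D.IsAlternating) {h : ℤ} (hh : h ≠ 0)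
    {x : D.State → D.ArcRing} (hx : x ∈ D.cycleLifts h) :
    ∃ p : ℚ[X], p ≠ 0 ∧ p • x ∈ D.boundaryLifts h := by
  refine ⟨(2 * X) ^ (2 * D.n + 1), pow_ne_zero _ (mul_ne_zero two_ne_zero X_ne_zero), ?_⟩
  have h1 := altProd_sub_smul_mem hD hx
  have h2 : D.altProd • x ∈ D.boundaryLifts h := by
    refine mem_boundaryLifts_of_relIdeal fun v =>
      Ideal.mul_mem_right _ _ (altProd_mem_relIdeal hD fun h' => hh ?_)
    rw [← v.2, h', weight_orientedState]
  have h3 := sub_mem h2 h1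
  rw [← sub_smul, sub_sub_cancel] at h3
  convert! h3 using 1
  funext v
  rw [Pi.smul_apply, smul_arcRing, Pi.smul_apply, smul_eq_mul]
  simp only [map_pow, map_mul, map_ofNat, aeval_X]

/-- In degree `0`, `altProd • x` lives at the oriented state alone. There it is a multiple of
`altProd`, because `altProd` is a common eigenvector; this gives the coefficient `q`. -/
theorem exists_smul_sub_mem_boundaryLifts (hD : D.IsAlternating)
    {x : D.State → D.ArcRing} (hx : x ∈ D.cycleLifts 0) :
    ∃ p q : ℚ[X], p ≠ 0 ∧ p • x - q • D.leeLift ∈ D.boundaryLifts 0 := by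
  classical
  refine ⟨(2 * X) ^ (2 * D.n + 1), D.altEval (x D.orientedState),
    pow_ne_zero _ (mul_ne_zero two_ne_zero X_ne_zero), ?_⟩
  have h1 := altProd_sub_smul_mem hD hx
  have h2 : D.altProd • x - D.altEval (x D.orientedState) • D.leeLift ∈ D.boundaryLifts 0 := by
    refine mem_boundaryLifts_of_relIdeal fun v => ?_
    rw [Pi.sub_apply, Pi.smul_apply, Pi.smul_apply, leeLift]
    by_cases hv : v.1 = D.orientedState
    · rw [hv, Pi.single_eq_same, smul_eq_mul, mul_comm]
      exact mul_altProd_sub_mem _ _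
    · rw [Pi.single_eq_of_ne hv, smul_zero, sub_zero]
      exact Ideal.mul_mem_right _ _ (altProd_mem_relIdeal hD hv)
  have h3 := sub_mem h2 h1
  convert! h3 using 1
  funext v
  simp only [Pi.sub_apply, Pi.smul_apply, smul_arcRing, smul_eq_mul]
  simp only [map_pow, map_mul, map_ofNat, aeval_X]
  ring

/-! The same statements for the complex of graded modules. -/

theorem lin_d_Ct (hG : D.IsGradedComplex) (h : ℤ) (x : D.State → D.ArcRing) :
    GrMod.lin ((D.Ct hG).d h (h + 1)) (toChain h x) = toChain (D := D) (h + 1) (cubeDiff x) := by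
  have : (D.Ct hG).d h (h + 1) = GrMod.ofLin (D.diff h) (hG.diff_mem h) :=
    CochainComplex.of_d D.chain (fun h => GrMod.ofLin (D.diff h) (hG.diff_mem h)) h
  rw [this]
  exact diff_toChain h x

theorem mem_cycleLifts_iff (hG : D.IsGradedComplex) {h : ℤ} {x : D.State → D.ArcRing} :
    x ∈ D.cycleLifts h ↔ GrMod.lin ((D.Ct hG).d h (h + 1)) (toChain h x) = 0 := by
  rw [lin_d_Ct]
  exact toChain_eq_zero.symm

theorem mem_boundaryLifts_iff (hG : D.IsGradedComplex) {h h' : ℤ} (hh : h' + 1 = h)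
    {x : D.State → D.ArcRing} : x ∈ D.boundaryLifts h ↔
      ∃ y : (D.Ct hG).X h', toChain h x = GrMod.lin ((D.Ct hG).d h' h) y := by
  subst hh
  constructor
  · rintro ⟨w, hw⟩
    exact ⟨toChain h' w, (toChain_eq_iff.2 hw).trans (lin_d_Ct hG h' w).symm⟩
  · rintro ⟨y, hy⟩
    obtain ⟨w, rfl⟩ := toChain_surjective h' y
    rw [lin_d_Ct] at hy
    exact ⟨w, toChain_eq_iff.1 hy⟩

/-- Outside of degree `0`, the cohomology is torsion. -/
theorem Ct_torsion (hD : D.IsAlternating) (hG : D.IsGradedComplex) {h h' : ℤ} (hh : h' + 1 = h)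
    (h0 : h ≠ 0) (z : (D.Ct hG).X h) (hz : GrMod.lin ((D.Ct hG).d h (h + 1)) z = 0) :
    ∃ p : ℚ[X], p ≠ 0 ∧ ∃ y : (D.Ct hG).X h', p • z = GrMod.lin ((D.Ct hG).d h' h) y := by
  obtain ⟨x, rfl⟩ := toChain_surjective h z
  obtain ⟨p, hp, hpx⟩ := exists_smul_mem_boundaryLifts hD h0 ((mem_cycleLifts_iff hG).2 hz)
  obtain ⟨y, hy⟩ := (mem_boundaryLifts_iff hG hh).1 hpx
  exact ⟨p, hp, y, ((toChain h).map_smul p x).symm.trans hy⟩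

/-- In degree `0`, the cohomology has rank one. -/
theorem Ct_rank_one (hD : D.IsAlternating) (hG : D.IsGradedComplex) :
    ∃ e : (D.Ct hG).X 0, GrMod.lin ((D.Ct hG).d 0 (0 + 1)) e = 0 ∧
      (∀ p : ℚ[X], p ≠ 0 → ∀ y : (D.Ct hG).X (-1), p • e ≠ GrMod.lin ((D.Ct hG).d (-1) 0) y) ∧
      ∀ z : (D.Ct hG).X 0, GrMod.lin ((D.Ct hG).d 0 (0 + 1)) z = 0 →
        ∃ p q : ℚ[X], p ≠ 0 ∧ ∃ y : (D.Ct hG).X (-1),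
          p • z - q • e = GrMod.lin ((D.Ct hG).d (-1) 0) y := by
  refine ⟨toChain 0 D.leeLift, (mem_cycleLifts_iff hG).1 (leeLift_mem_cycleLifts hD),
    fun p hp y hy => ?_, fun z hz => ?_⟩
  · exact smul_leeLift_notMem hD hp ((mem_boundaryLifts_iff hG (by norm_num)).2
      ⟨y, ((toChain 0).map_smul p D.leeLift).trans hy⟩)
  · obtain ⟨x, rfl⟩ := toChain_surjective 0 z
    obtain ⟨p, q, hp, hpq⟩ := exists_smul_sub_mem_boundaryLifts hD ((mem_cycleLifts_iff hG).2 hz)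
    obtain ⟨y, hy⟩ := (mem_boundaryLifts_iff hG (h' := -1) (by norm_num)).1 hpq
    refine ⟨p, q, hp, y, Eq.trans ?_ hy⟩
    rw [map_sub, map_smul, map_smul]
    rfl

end GaussCode

namespace CategoryTheory

/-! ### Finite direct sums, as a property -/

variable {C : Type*} [Category C] [Preadditive C]

/-- `K` is a direct sum of the finite family `f`. -/
def IsSum (K : C) {ι : Type*} [Fintype ι] (f : ι → C) : Prop :=
  ∃ (i : ∀ k, f k ⟶ K) (p : ∀ k, K ⟶ f k), (∀ k, i k ≫ p k = 𝟙 (f k)) ∧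
    (∀ k l, k ≠ l → i k ≫ p l = 0) ∧ ∑ k, p k ≫ i k = 𝟙 K

namespace IsSum

variable {K L : C} {ι κ : Type*} [Fintype ι] [Fintype κ] {f : ι → C} {g : κ → C}

theorem iso (hK : IsSum K f) (hL : IsSum L f) : Nonempty (K ≅ L) := by
  classical
  obtain ⟨i, p, h1, h2, h3⟩ := hK
  obtain ⟨j, q, k1, k2, k3⟩ := hL
  refine ⟨⟨∑ k, p k ≫ j k, ∑ k, q k ≫ i k, ?_, ?_⟩⟩
  · rw [Preadditive.sum_comp, ← h3]
    refine Finset.sum_congr rfl fun k _ => ?_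
    rw [Preadditive.comp_sum, Finset.sum_eq_single k]
    · rw [Category.assoc, reassoc_of% (k1 k)]
    · intro l _ hl
      rw [Category.assoc, reassoc_of% (k2 k l hl.symm), Limits.zero_comp, Limits.comp_zero]
    · intro h; exact absurd (Finset.mem_univ k) h
  · rw [Preadditive.sum_comp, ← k3]
    refine Finset.sum_congr rfl fun k _ => ?_
    rw [Preadditive.comp_sum, Finset.sum_eq_single k]
    · rw [Category.assoc, reassoc_of% (h1 k)]
    · intro l _ hl
      rw [Category.assoc, reassoc_of% (h2 k l hl.symm), Limits.zero_comp, Limits.comp_zero]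
    · intro h; exact absurd (Finset.mem_univ k) h

theorem of_iso (hK : IsSum K f) (e : K ≅ L) : IsSum L f := by
  obtain ⟨i, p, h1, h2, h3⟩ := hK
  refine ⟨fun k => i k ≫ e.hom, fun k => e.inv ≫ p k, fun k => by simp [h1],
    fun k l h => by simp [h2 k l h], ?_⟩
  have : ∀ k, (e.inv ≫ p k) ≫ i k ≫ e.hom = e.inv ≫ (p k ≫ i k) ≫ e.hom := fun k => by simp
  simp only [this]
  rw [← Preadditive.comp_sum, ← Preadditive.sum_comp, h3, Category.id_comp, e.inv_hom_id]

theorem reindex (hK : IsSum K f) (e : κ ≃ ι) (he : ∀ k, Nonempty (g k ≅ f (e k))) :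
    IsSum K g := by
  classical
  obtain ⟨i, p, h1, h2, h3⟩ := hK
  have a := fun k => (he k).some
  refine ⟨fun k => (a k).hom ≫ i (e k), fun k => p (e k) ≫ (a k).inv, fun k => ?_,
    fun k l h => ?_, ?_⟩
  · rw [Category.assoc, reassoc_of% (h1 (e k)), Iso.hom_inv_id]
  · rw [Category.assoc, reassoc_of% (h2 (e k) (e l) (e.injective.ne h)), Limits.zero_comp,
      Limits.comp_zero]
  · rw [← h3, ← e.sum_comp]
    refine Finset.sum_congr rfl fun k _ => ?_
    simp

theorem map {D : Type*} [Category D] [Preadditive D] (F : C ⥤ D) [F.Additive]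
    (hK : IsSum K f) : IsSum (F.obj K) fun k => F.obj (f k) := by
  obtain ⟨i, p, h1, h2, h3⟩ := hK
  refine ⟨fun k => F.map (i k), fun k => F.map (p k), fun k => ?_, fun k l h => ?_, ?_⟩
  · rw [← F.map_comp, h1, F.map_id]
  · rw [← F.map_comp, h2 k l h, F.map_zero]
  · rw [← F.map_id, ← h3, F.map_sum]
    exact Finset.sum_congr rfl fun k _ => (F.map_comp _ _).symm

theorem unit (K : C) : IsSum K fun _ : Unit => K :=
  ⟨fun _ => 𝟙 K, fun _ => 𝟙 K, fun _ => by simp, fun _ _ h => absurd rfl h, by simp⟩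

theorem biproduct {ι : Type} [Fintype ι] (f : ι → C) [HasBiproduct f] : IsSum (⨁ f) f := by
  classical
  exact ⟨fun k => biproduct.ι f k, fun k => biproduct.π f k, fun k => biproduct.ι_π_self f k,
    fun k l h => biproduct.ι_π_ne f h, biproduct.total⟩

theorem biprod [HasBinaryBiproducts C] (hK : IsSum K f) (hL : IsSum L g) :
    IsSum (K ⊞ L) (Sum.elim f g) := by
  obtain ⟨i, p, h1, h2, h3⟩ := hK
  obtain ⟨j, q, k1, k2, k3⟩ := hL
  refine ⟨fun x => match x with
      | Sum.inl k => i k ≫ biprod.inl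
      | Sum.inr k => j k ≫ biprod.inr, fun x => match x with
      | Sum.inl k => biprod.fst ≫ p k
      | Sum.inr k => biprod.snd ≫ q k, ?_, ?_, ?_⟩
  · rintro (k | k) <;> simp [h1, k1]
  · rintro (k | k) (l | l) h
    · have : (i k ≫ biprod.inl) ≫ (biprod.fst : K ⊞ L ⟶ K) ≫ p l = 0 := by
        simp [h2 k l (by simpa using h)]
      exact this
    · have : (i k ≫ biprod.inl) ≫ (biprod.snd : K ⊞ L ⟶ L) ≫ q l = 0 := by simp
      exact this
    · have : (j k ≫ biprod.inr) ≫ (biprod.fst : K ⊞ L ⟶ K) ≫ p l = 0 := by simp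
      exact this
    · have : (j k ≫ biprod.inr) ≫ (biprod.snd : K ⊞ L ⟶ L) ≫ q l = 0 := by
        simp [k2 k l (by simpa using h)]
      exact this
  · rw [Fintype.sum_sum_type]
    have e1 : ∀ k, (biprod.fst ≫ p k) ≫ i k ≫ (biprod.inl : K ⟶ K ⊞ L) =
        (biprod.fst : K ⊞ L ⟶ K) ≫ (p k ≫ i k) ≫ biprod.inl := fun k => by simp
    have e2 : ∀ k, (biprod.snd ≫ q k) ≫ j k ≫ (biprod.inr : L ⟶ K ⊞ L) =
        (biprod.snd : K ⊞ L ⟶ L) ≫ (q k ≫ j k) ≫ biprod.inr := fun k => by simp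
    refine (congrArg₂ (· + ·) (Finset.sum_congr rfl fun k _ => e1 k)
      (Finset.sum_congr rfl fun k _ => e2 k)).trans ?_
    rw [← Preadditive.comp_sum, ← Preadditive.sum_comp, h3, ← Preadditive.comp_sum,
      ← Preadditive.sum_comp, k3, Category.id_comp, Category.id_comp, biprod.total]

/-- The complement of a retract is the kernel of the retraction: `𝟙 K - r ≫ s` is the projection
onto it. -/
theorem _root_.CategoryTheory.iso_biprod_kernel {P K : C} [HasKernels C] [HasBinaryBiproducts C]
    (s : P ⟶ K) (r : K ⟶ P) (h : s ≫ r = 𝟙 P) : Nonempty (K ≅ P ⊞ kernel r) := by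
  have hz : (𝟙 K - r ≫ s) ≫ r = 0 := by simp [h]
  refine ⟨⟨biprod.lift r (kernel.lift r (𝟙 K - r ≫ s) hz), biprod.desc s (kernel.ι r), ?_, ?_⟩⟩
  · simp
  · refine biprod.hom_ext' _ _ ?_ ?_
    · refine biprod.hom_ext _ _ (by simp [h]) ?_
      rw [← cancel_mono (kernel.ι r)]
      simp [reassoc_of% h]
    · refine biprod.hom_ext _ _ (by simp) ?_
      rw [← cancel_mono (kernel.ι r)]
      simp

theorem of_retract {P K : C} [HasKernels C] [HasBinaryBiproducts C] (s : P ⟶ K)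
    (r : K ⟶ P) (h : s ≫ r = 𝟙 P) (hf : IsSum (kernel r) f) :
    IsSum K (Sum.elim (fun _ : Unit => P) f) := by
  obtain ⟨e⟩ := iso_biprod_kernel s r h
  exact ((unit P).biprod hf).of_iso e.symm

end IsSum

end CategoryTheory

namespace GrMod

/-! ### Kernels of graded modules -/

/-- A homogeneous submodule of a graded module. -/
def sub (M : GrMod) (N : Submodule ℚ[X] M) (hN : ∀ x ∈ N, ∀ j, M.proj j x ∈ N) : GrMod where
  carrier := N
  gr j := (M.gr j).comap N.subtype.toAddMonoidHom
  isInternal := by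
    let π : ℤ → N →+ N := fun j => AddMonoidHom.mk' (fun x => ⟨M.proj j x, hN x x.2 j⟩)
      (fun x y => Subtype.ext (map_add _ _ _))
    refine isInternal_of_proj _ (fun x => ?_) π (fun j x hx => Subtype.ext (M.proj_same j _ hx))
      (fun i j hij x hx => Subtype.ext (M.proj_ne i j hij _ hx))
    obtain ⟨x, hx⟩ := x
    have key : ∀ y : M, ∃ s : Finset ℤ, ∑ j ∈ s, M.proj j y = y := by
      intro y
      obtain ⟨z, rfl⟩ := M.isInternal.2 y
      classical
      refine ⟨z.support, ?_⟩
      simp only [proj_coe]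
      exact (DirectSum.coeAddMonoidHom_eq_dfinsuppSum _ z).symm
    obtain ⟨s, hs⟩ := key x
    have : (⟨x, hx⟩ : N) = ∑ j ∈ s, π j ⟨x, hx⟩ := by
      refine Subtype.ext ?_
      rw [AddSubmonoidClass.coe_finsetSum]
      exact hs.symm
    rw [this]
    exact sum_mem fun j _ => AddSubgroup.mem_iSup_of_mem j (M.proj_mem j x)
  monomial_smul_mem k c j x hx := M.monomial_smul_mem k c j _ hx

theorem lin_proj {M N : GrMod} (f : M ⟶ N) (j : ℤ) (x : M) :
    lin f (M.proj j x) = N.proj j (lin f x) := by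
  refine M.gr_induction x (by simp) (fun i y hy => ?_) (fun a b ha hb => by simp [ha, hb])
  by_cases h : i = j
  · subst h
    rw [M.proj_same _ _ hy, N.proj_same _ _ (lin_mem f _ _ hy)]
  · rw [M.proj_ne _ _ h _ hy, N.proj_ne _ _ h _ (lin_mem f _ _ hy), map_zero]

/-- The kernel of a morphism of graded modules. -/
def ker {M N : GrMod} (f : M ⟶ N) : GrMod :=
  M.sub (LinearMap.ker (lin f)) fun x hx j => by
    rw [LinearMap.mem_ker] at hx ⊢
    rw [lin_proj, hx, map_zero]

instance : HasKernels GrMod where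
  has_limit {M N} f := by
    let ι : ker f ⟶ M := ofLin (LinearMap.ker (lin f)).subtype fun j x hx => hx
    have hι : ι ≫ f = 0 := hom_ext' (LinearMap.ext fun x => x.2)
    have : Mono ι := ⟨fun a b hab => hom_ext' (LinearMap.ext fun x =>
      Subtype.ext (congrArg (fun g => lin g x) hab))⟩
    refine HasLimit.mk ⟨KernelFork.ofι ι hι, KernelFork.IsLimit.ofι' ι hι fun {W} k hk => ?_⟩
    refine ⟨ofLin ((lin k).codRestrict (LinearMap.ker (lin f)) fun x => ?_)
      (fun j x hx => lin_mem k j x hx), ?_⟩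
    · exact congrArg (fun g => lin g x) hk
    · exact hom_ext' (LinearMap.ext fun x => rfl)

instance : HasKernels (CochainComplex GrMod ℤ) :=
  have : HasEqualizers GrMod := Preadditive.hasEqualizers_of_hasKernels
  have : HasEqualizers (CochainComplex GrMod ℤ) :=
    inferInstanceAs (HasLimitsOfShape WalkingParallelPair
      (HomologicalComplex GrMod (ComplexShape.up ℤ)))
  inferInstance

instance : HasBinaryBiproducts (CochainComplex GrMod ℤ) :=
  hasBinaryBiproducts_of_finite_biproducts _

end GrMod

/-! ### Morphisms to two-term complexes and their recognition -/

namespace HomologicalComplex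

variable {C : Type*} [Category C] [HasZeroMorphisms C] [HasZeroObject C]
  {X₀ X₁ : C} {f : X₀ ⟶ X₁} {ι : Type*} {c : ComplexShape ι} {i₀ i₁ : ι} (hi₀₁ : c.Rel i₀ i₁)
  (h : i₀ ≠ i₁) {K : HomologicalComplex C c} (φ₀ : K.X i₀ ⟶ X₀) (φ₁ : K.X i₁ ⟶ X₁)
  (comm : φ₀ ≫ f = K.d i₀ i₁ ≫ φ₁) (hφ : ∀ k, c.Rel k i₀ → K.d k i₀ ≫ φ₀ = 0)

open scoped Classical in
/-- Constructor for morphisms to a homological complex `double f hi₀₁`. -/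
def mkHomToDouble : K ⟶ double f hi₀₁ where
  f k :=
    if hk₀ : k = i₀ then
      eqToHom (by rw [hk₀]) ≫ φ₀ ≫ (doubleXIso₀ f hi₀₁).inv ≫ eqToHom (by rw [hk₀])
    else if hk₁ : k = i₁ then
      eqToHom (by rw [hk₁]) ≫ φ₁ ≫ (doubleXIso₁ f hi₀₁ h).inv ≫ eqToHom (by rw [hk₁])
    else 0
  comm' k₀ k₁ hk := by
    by_cases h₁ : k₁ = i₁
    · subst h₁
      obtain rfl := c.prev_eq hk hi₀₁
      simp [dif_neg h.symm, double_d f hi₀₁ h, reassoc_of% comm]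
    · by_cases h₀ : k₁ = i₀
      · subst h₀
        rw [double_d_eq_zero₁ _ _ _ _ h, Limits.comp_zero, dif_pos rfl]
        simp [reassoc_of% (hφ k₀ hk)]
      · exact (isZero_double_X f hi₀₁ k₁ h₀ h₁).eq_of_tgt _ _

@[simp]
theorem mkHomToDouble_f₀ :
    (mkHomToDouble hi₀₁ h φ₀ φ₁ comm hφ).f i₀ = φ₀ ≫ (doubleXIso₀ f hi₀₁).inv := by
  simp [mkHomToDouble]

@[simp]
theorem mkHomToDouble_f₁ :
    (mkHomToDouble hi₀₁ h φ₀ φ₁ comm hφ).f i₁ = φ₁ ≫ (doubleXIso₁ f hi₀₁ h).inv := by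
  simp [mkHomToDouble, dif_neg h.symm]

theorem exists_retract_double (a : X₀ ⟶ K.X i₀) (b : X₁ ⟶ K.X i₁)
    (hab : a ≫ K.d i₀ i₁ = f ≫ b) (hb : ∀ k, c.Rel i₁ k → b ≫ K.d i₁ k = 0)
    (h₀ : a ≫ φ₀ = 𝟙 X₀) (h₁ : b ≫ φ₁ = 𝟙 X₁) :
    mkHomFromDouble hi₀₁ h a b hab hb ≫ mkHomToDouble hi₀₁ h φ₀ φ₁ comm hφ = 𝟙 _ := by
  refine from_double_hom_ext ?_ ?_
  · simp [reassoc_of% h₀]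
  · simp [reassoc_of% h₁]

theorem nonempty_iso_double (h : i₀ ≠ i₁) (a : X₀ ≅ K.X i₀) (b : X₁ ≅ K.X i₁)
    (hab : a.hom ≫ K.d i₀ i₁ = f ≫ b.hom) (hK : ∀ k, k ≠ i₀ → k ≠ i₁ → IsZero (K.X k))
    (hr : ∀ k, ¬ c.Rel i₁ k ∨ (k ≠ i₀ ∧ k ≠ i₁)) (hl : ∀ k, ¬ c.Rel k i₀ ∨ (k ≠ i₀ ∧ k ≠ i₁)) :
    Nonempty (double f hi₀₁ ≅ K) := by
  have h1 : ∀ k, c.Rel i₁ k → b.hom ≫ K.d i₁ k = 0 := fun k hk =>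
    have hk := (hr k).resolve_left (not_not.2 hk)
    (hK k hk.1 hk.2).eq_of_tgt _ _
  have h2 : ∀ k, c.Rel k i₀ → K.d k i₀ ≫ a.inv = 0 := fun k hk =>
    have hk := (hl k).resolve_left (not_not.2 hk)
    (hK k hk.1 hk.2).eq_of_src _ _
  have h3 : a.inv ≫ f = K.d i₀ i₁ ≫ b.inv := by
    rw [Iso.inv_comp_eq, ← Category.assoc, hab, Category.assoc, Iso.hom_inv_id, Category.comp_id]
  refine ⟨⟨mkHomFromDouble hi₀₁ h a.hom b.hom hab h1, mkHomToDouble hi₀₁ h a.inv b.inv h3 h2,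
    exists_retract_double hi₀₁ h _ _ h3 h2 _ _ hab h1 a.hom_inv_id b.hom_inv_id, ?_⟩⟩
  ext k : 1
  by_cases h0 : k = i₀
  · subst h0; simp
  · by_cases h1 : k = i₁
    · subst h1; simp
    · exact (hK k h0 h1).eq_of_src _ _

end HomologicalComplex

namespace GrMod

/-! ### Two-term complexes -/

variable {M N : GrMod}

theorem exists_retract_twoTerm {K : CochainComplex GrMod ℤ} {h : ℤ} {f : M ⟶ N}
    (a : M ⟶ K.X h) (b : N ⟶ K.X (h + 1)) (ψ : K.X h ⟶ M) (φ : K.X (h + 1) ⟶ N)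
    (hab : a ≫ K.d h (h + 1) = f ≫ b) (hφψ : ψ ≫ f = K.d h (h + 1) ≫ φ)
    (hb : b ≫ K.d (h + 1) (h + 1 + 1) = 0) (hψ : ∀ k, k + 1 = h → K.d k h ≫ ψ = 0)
    (ha1 : a ≫ ψ = 𝟙 M) (hb1 : b ≫ φ = 𝟙 N) :
    ∃ (s : twoTerm h f ⟶ K) (r : K ⟶ twoTerm h f), s ≫ r = 𝟙 _ :=
  have hne : h ≠ h + 1 := by omega
  ⟨_, _, HomologicalComplex.exists_retract_double _ hne ψ φ hφψ hψ a b hab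
    (by rintro k (rfl : h + 1 + 1 = k); exact hb) ha1 hb1⟩

/-- Recognition of two-term complexes. -/
theorem iso_twoTerm {K : CochainComplex GrMod ℤ} {h : ℤ} {f : M ⟶ N}
    (a : M ≅ K.X h) (b : N ≅ K.X (h + 1)) (hab : a.hom ≫ K.d h (h + 1) = f ≫ b.hom)
    (hK : ∀ k, k ≠ h → k ≠ h + 1 → IsZero (K.X k)) : Nonempty (twoTerm h f ≅ K) := by
  refine HomologicalComplex.nonempty_iso_double _ (by omega) a b hab hK ?_ ?_
  · intro k
    rw [ComplexShape.up_Rel]; omega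
  · intro k
    rw [ComplexShape.up_Rel]; omega

theorem exists_retract_single {K : CochainComplex GrMod ℤ} {h : ℤ}
    (a : M ⟶ K.X h) (ψ : K.X h ⟶ M) (ha : ∀ k, a ≫ K.d h k = 0)
    (hψ : ∀ k, K.d k h ≫ ψ = 0) (ha1 : a ≫ ψ = 𝟙 M) :
    ∃ (s : (HomologicalComplex.single GrMod (ComplexShape.up ℤ) h).obj M ⟶ K)
      (r : K ⟶ (HomologicalComplex.single GrMod (ComplexShape.up ℤ) h).obj M), s ≫ r = 𝟙 _ := by
  refine ⟨HomologicalComplex.mkHomFromSingle a fun k _ => ha k,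
    HomologicalComplex.mkHomToSingle ψ fun k _ => hψ k, ?_⟩
  refine HomologicalComplex.from_single_hom_ext ?_
  simp [reassoc_of% ha1]

/-! ### Graded modules over `ℚ[X]` without torsion -/

theorem proj_C_smul (M : GrMod) (c : ℚ) (j : ℤ) (x : M) :
    M.proj j ((C c : ℚ[X]) • x) = (C c : ℚ[X]) • M.proj j x := by
  refine M.gr_induction x (by simp) (fun i y hy => ?_) (fun a b ha hb => ?_)
  · have h1 : (C c : ℚ[X]) • y ∈ M.gr i := by
      simpa using M.monomial_smul_mem 0 c i y hy
    by_cases h : i = j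
    · subst h
      rw [M.proj_same _ _ h1, M.proj_same _ _ hy]
    · rw [M.proj_ne _ _ h _ h1, M.proj_ne _ _ h _ hy, smul_zero]
  · simp only [smul_add, map_add, ha, hb]

theorem exists_proj_eq_zero (M : GrMod) (x : M) : ∃ s : Finset ℤ, ∀ j ∉ s, M.proj j x = 0 := by
  classical
  obtain ⟨z, rfl⟩ := M.isInternal.2 x
  refine ⟨z.support, fun j hj => ?_⟩
  rw [proj_coe, DFinsupp.notMem_support_iff.1 hj]
  rfl

/-- The additive map that is given by `g j` on the homogeneous elements of degree `j`. -/
def extendGr (M : GrMod) {A : Type*} [AddCommGroup A] (g : ℤ → M →+ A) : M →+ A := by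
  classical
  exact (DirectSum.toAddMonoid fun j => (g j).comp (M.gr j).subtype).comp
    (AddEquiv.ofBijective (DirectSum.coeAddMonoidHom M.gr) M.isInternal).symm.toAddMonoidHom

theorem extendGr_apply (M : GrMod) {A : Type*} [AddCommGroup A] (g : ℤ → M →+ A) {j : ℤ} {x : M}
    (hx : x ∈ M.gr j) : M.extendGr g x = g j x := by
  classical
  have : (AddEquiv.ofBijective (DirectSum.coeAddMonoidHom M.gr) M.isInternal).symm x =
      DirectSum.of (fun i => M.gr i) j ⟨x, hx⟩ := by
    rw [AddEquiv.symm_apply_eq]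
    exact (DirectSum.coeAddMonoidHom_of M.gr j ⟨x, hx⟩).symm
  simp only [extendGr, AddMonoidHom.comp_apply]
  erw [this]
  rw [DirectSum.toAddMonoid_of]
  rfl

/-- A homogeneous element that is not divisible by `X` is mapped to the generator by some morphism
to a free module of rank one. -/
theorem exists_hom_QX (M : GrMod) [Module.IsTorsionFree ℚ[X] M] {j : ℤ} {y : M} (hy : y ∈ M.gr j)
    (hX : ∀ z : M, y ≠ (X : ℚ[X]) • z) : ∃ φ : M ⟶ QX j, lin φ y = (1 : ℚ[X]) := by
  let _ : Module ℚ M := Module.compHom M (C : ℚ →+* ℚ[X])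
  have hsm : ∀ (c : ℚ) (x : M), c • x = (C c : ℚ[X]) • x := fun _ _ => rfl
  -- `S` consists of the elements whose components in the degrees `j + 2 n` are those of `(X - 1) z`
  -- for some `z`. A functional `f` that kills `S` satisfies `f (X x) = f x` and vanishes in all
  -- other degrees.
  let S : Submodule ℚ M :=
    { carrier := {s | ∃ z : M, ∀ n : ℕ, M.proj (j + 2 * n) s =
        (X : ℚ[X]) • M.proj (j + 2 * n - 2) z - M.proj (j + 2 * n) z}
      zero_mem' := ⟨0, fun n => by simp⟩
      add_mem' := by
        rintro a b ⟨z, hz⟩ ⟨w, hw⟩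
        refine ⟨z + w, fun n => ?_⟩
        rw [map_add, hz, hw, map_add, map_add, smul_add]
        abel
      smul_mem' := by
        rintro c a ⟨z, hz⟩
        refine ⟨c • z, fun n => ?_⟩
        rw [hsm, hsm, proj_C_smul, proj_C_smul, proj_C_smul, hz, smul_sub, smul_comm] }
  have hyS : y ∉ S := by
    rintro ⟨z, hz⟩
    have h0 := hz 0
    simp only [Nat.cast_zero, mul_zero, add_zero] at h0
    -- Above degree `j` the components of `y` vanish, which makes those of `z` equal to `X ^ n`
    -- times the one in degree `j`. Only finitely many are nonzero, so torsion-freeness makes the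
    -- latter zero, and `y` is `X` times the component of `z` in degree `j - 2`.
    have hs : ∀ n : ℕ, M.proj (j + 2 * (n : ℤ)) z = (X ^ n : ℚ[X]) • M.proj j z := by
      intro n
      induction n with
      | zero => simp
      | succ n ih =>
        have := hz (n + 1)
        rw [M.proj_ne j _ (by omega) y hy, eq_comm, sub_eq_zero] at this
        rw [← this, pow_succ', mul_smul, ← ih]
        congr 3
        push_cast; ring
    obtain ⟨s, hs'⟩ := M.exists_proj_eq_zero z
    obtain ⟨n, hn⟩ : ∃ n : ℕ, j + 2 * (n : ℤ) ∉ s := by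
      by_contra! hcon
      refine (Set.infinite_of_injective_forall_mem (f := fun n : ℕ => j + 2 * (n : ℤ))
        (fun a b hab => ?_) hcon) s.finite_toSet
      simpa using hab
    have h1 := hs n
    rw [hs' _ hn, eq_comm, smul_eq_zero_iff_right (pow_ne_zero _ X_ne_zero)] at h1
    rw [h1, sub_zero, M.proj_same _ _ hy] at h0
    exact hX _ h0
  obtain ⟨f, hfy, hfS⟩ := Submodule.exists_le_ker_of_notMem hyS
  have hX' : ∀ x, f ((X : ℚ[X]) • x) = f x := fun x => by
    rw [← sub_eq_zero, ← map_sub]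
    refine hfS ⟨x, fun n => ?_⟩
    rw [map_sub]
    congr 1
    simpa using M.proj_X_pow_smul 1 (j + 2 * n) x
  have hne : ∀ k x, x ∈ M.gr k → (¬ ∃ n : ℕ, k = j + 2 * n) → f x = 0 := fun k x hx hk => by
    refine hfS ⟨0, fun n => ?_⟩
    rw [M.proj_ne k _ (fun h => hk ⟨n, h⟩) x hx]
    simp
  have hXn : ∀ (n : ℕ) x, f ((X ^ n : ℚ[X]) • x) = f x := fun n => by
    induction n with
    | zero => simp
    | succ n ih => intro x; rw [pow_succ', mul_smul, hX', ih]
  have hmon : ∀ (n : ℕ) (c : ℚ) x, f ((monomial n c : ℚ[X]) • x) = c * f x := fun n c x => by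
    rw [← C_mul_X_pow_eq_monomial, mul_smul, ← hsm, map_smul, hXn, smul_eq_mul]
  -- The morphism is `f / f y` times the power of `X` that accounts for the degree. Where `toNat`
  -- truncates or the division rounds, `f` is zero.
  let g : ℤ → M →+ ℚ[X] := fun k =>
    (monomial ((k - j) / 2).toNat : ℚ →ₗ[ℚ] ℚ[X]).toAddMonoidHom.comp
      (((f y)⁻¹ • f : M →ₗ[ℚ] ℚ).toAddMonoidHom)
  have hg : ∀ k x, g k x = monomial ((k - j) / 2).toNat ((f y)⁻¹ * f x) := fun _ _ => rfl
  have hlin : ∀ (p : ℚ[X]) (x : M), M.extendGr g (p • x) = p * M.extendGr g x := by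
    intro p x
    induction p using Polynomial.induction_on' with
    | add p q hp hq => rw [add_smul, map_add, hp, hq, add_mul]
    | monomial n c =>
      refine M.gr_induction x (by simp) (fun k u hu => ?_) (fun a b ha hb => ?_)
      · rw [extendGr_apply M g (M.monomial_smul_mem n c k u hu), extendGr_apply M g hu, hg, hg,
          monomial_mul_monomial, hmon]
        by_cases hk : ∃ m : ℕ, k = j + 2 * m
        · obtain ⟨m, rfl⟩ := hk
          have e1 : ((j + 2 * (m : ℤ) + 2 * n - j) / 2).toNat = n + m := by omega
          have e2 : ((j + 2 * (m : ℤ) - j) / 2).toNat = m := by omega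
          rw [e1, e2, mul_left_comm]
        · rw [hne k u hu hk]; simp
      · rw [smul_add, map_add, ha, hb, map_add, mul_add]
  refine ⟨ofLin (N := QX j) { toFun := M.extendGr g, map_add' := map_add _, map_smul' := hlin } ?_,
    ?_⟩
  · intro k x hx n hn
    change (M.extendGr g x).coeff n ≠ 0 at hn
    rw [extendGr_apply M g hx, hg, coeff_monomial] at hn
    by_cases hk : ∃ m : ℕ, k = j + 2 * m
    · obtain ⟨m, rfl⟩ := hk
      have e2 : ((j + 2 * (m : ℤ) - j) / 2).toNat = m := by omega
      rw [e2] at hn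
      have : m = n := by by_contra h; simp [h] at hn
      rw [this]
    · rw [hne k x hx hk] at hn
      simp at hn
  · change M.extendGr g y = 1
    rw [extendGr_apply M g hy, hg, inv_mul_cancel₀ hfy]
    simp

/-- The morphism from the free module of rank one that maps the generator to `y`. -/
def ofElement {M : GrMod} {j : ℤ} {y : M} (hy : y ∈ M.gr j) : QX j ⟶ M :=
  ofLin (M := QX j) (LinearMap.toSpanSingleton ℚ[X] M y) (by
    intro k p hp
    change (show ℚ[X] from p) • y ∈ M.gr k
    rw [← Polynomial.sum_monomial_eq (show ℚ[X] from p), Polynomial.sum, Finset.sum_smul]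
    refine sum_mem fun n hn => ?_
    have := hp n (mem_support_iff.1 hn)
    rw [← this]
    exact M.monomial_smul_mem n _ j y hy)

theorem QX_hom_ext {M : GrMod} {j : ℤ} {f g : QX j ⟶ M}
    (h : lin f (1 : ℚ[X]) = lin g (1 : ℚ[X])) : f = g :=
  hom_ext' (LinearMap.ext_ring h)

/-- By Krull's intersection theorem a nonzero element is not divisible by all powers of `X`. -/
theorem exists_not_X_dvd (M : GrMod) [Module.IsTorsionFree ℚ[X] M] [Module.Finite ℚ[X] M] {x : M}
    (hx : x ≠ 0) : ∃ (m : ℕ) (y : M), x = (X ^ m : ℚ[X]) • y ∧ ∀ z : M, y ≠ (X : ℚ[X]) • z := by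
  classical
  have hI : Ideal.span {(X : ℚ[X])} ≠ ⊤ := by
    rw [Ne, Ideal.span_singleton_eq_top]; exact not_isUnit_X
  have h1 : ∃ N : ℕ, ¬ ∃ y : M, x = (X ^ N : ℚ[X]) • y := by
    by_contra! hcon
    refine hx ((Submodule.mem_bot ℚ[X]).1 ?_)
    rw [← Ideal.iInf_pow_smul_eq_bot_of_isTorsionFree (M := M) (Ideal.span {(X : ℚ[X])}) hI,
      Submodule.mem_iInf]
    intro N
    obtain ⟨y, hy⟩ := hcon N
    rw [hy, Ideal.span_singleton_pow]
    exact Submodule.smul_mem_smul (Ideal.mem_span_singleton_self _) trivial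
  have hpos : Nat.find h1 ≠ 0 := fun h0 => Nat.find_spec h1 ⟨x, by rw [h0]; simp⟩
  obtain ⟨y, hy⟩ := not_not.1 (Nat.find_min h1 (Nat.pred_lt hpos))
  refine ⟨_, y, hy, fun z hz => Nat.find_spec h1 ⟨z, ?_⟩⟩
  conv_lhs => rw [hy, hz, ← mul_smul, ← pow_succ, Nat.pred_eq_sub_one,
    Nat.sub_add_cancel (Nat.pos_of_ne_zero hpos)]

theorem mem_gr_of_X_pow_smul {M : GrMod} [Module.IsTorsionFree ℚ[X] M] {m : ℕ} {i : ℤ} {y : M}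
    (h : (X ^ m : ℚ[X]) • y ∈ M.gr i) : y ∈ M.gr (i - 2 * m) := by
  have h1 := M.proj_X_pow_smul m i y
  rw [M.proj_same _ _ h] at h1
  have h2 := smul_right_injective M (pow_ne_zero m (X_ne_zero (R := ℚ))) h1
  rw [h2]
  exact M.proj_mem _ _

theorem exists_homogeneous_not_X_dvd (M : GrMod) [Module.IsTorsionFree ℚ[X] M]
    [Module.Finite ℚ[X] M] {x : M} {i : ℤ} (hx : x ≠ 0) (hi : x ∈ M.gr i) :
    ∃ (m : ℕ) (y : M), x = (X ^ m : ℚ[X]) • y ∧ y ∈ M.gr (i - 2 * m) ∧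
      ∀ z : M, y ≠ (X : ℚ[X]) • z := by
  obtain ⟨m, y, rfl, hy⟩ := M.exists_not_X_dvd hx
  exact ⟨m, y, rfl, mem_gr_of_X_pow_smul hi, hy⟩

/-- A morphism to `ℚ[X]{i}` whose values are divisible by `X ^ m` factors through `X ^ m`. -/
theorem exists_factor_mulXPow {M : GrMod} {m : ℕ} {i : ℤ} (f : M ⟶ QX i)
    (hf : ∀ x, ∃ q : ℚ[X], lin f x = (X ^ m * q : ℚ[X])) :
    ∃ g : M ⟶ QX (2 * m + i), g ≫ mulXPow m i = f := by
  choose q hq using hf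
  have hinj : ∀ a b : ℚ[X], (X ^ m * a : ℚ[X]) = X ^ m * b → a = b :=
    fun a b h => mul_left_cancel₀ (pow_ne_zero m X_ne_zero) h
  refine ⟨ofLin (N := QX (2 * m + i)) { toFun := q, map_add' := ?_, map_smul' := ?_ } ?_, ?_⟩
  · intro x y
    refine hinj _ _ (((hq (x + y)).symm.trans (map_add _ _ _)).trans ?_)
    rw [hq, hq]
    exact (mul_add (X ^ m : ℚ[X]) (q x) (q y)).symm
  · intro p x
    refine hinj _ _ (((hq (p • x)).symm.trans (map_smul _ _ _)).trans ?_)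
    rw [hq]
    exact mul_left_comm (p : ℚ[X]) (X ^ m) (q x)
  · intro j x hx n hn
    have h1 := lin_mem f j x hx
    rw [hq] at h1
    have h2 := h1 (n + m) (by rwa [coeff_X_pow_mul])
    push_cast at h2
    omega
  · exact hom_ext' (LinearMap.ext fun x => (hq x).symm)

end GrMod

namespace GrMod

/-! ### Decomposition of complexes of free modules -/

instance (i : ℤ) : Module.IsTorsionFree ℚ[X] (QX i) :=
  inferInstanceAs (Module.IsTorsionFree ℚ[X] ℚ[X])

/-- One step of the Smith normal form. Choose `d x = X ^ m y` with `x` homogeneous, `y` not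
divisible by `X` and `m` least possible; then `d` is divisible by `X ^ m` in this degree. A morphism
`φ` to a free module with `φ y = 1` gives `ψ` with `X ^ m ψ = φ d`, so `ψ x = 1`, and `φ`, `ψ` form
a retraction onto the complex spanned by `x` and `y`. -/
theorem exists_twoTerm_retract {K : CochainComplex GrMod ℤ}
    [∀ h, Module.Finite ℚ[X] (K.X h)] [∀ h, Module.IsTorsionFree ℚ[X] (K.X h)]
    {h₀ : ℤ} (hd : K.d h₀ (h₀ + 1) ≠ 0) :
    ∃ (h : ℤ) (m : ℕ) (i : ℤ) (s : twoTerm h (mulXPow m i) ⟶ K) (r : K ⟶ twoTerm h (mulXPow m i)),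
      s ≫ r = 𝟙 _ := by
  classical
  have hex : ∃ m : ℕ, ∃ (h j : ℤ) (x : K.X h), x ∈ (K.X h).gr j ∧ ∃ y : K.X (h + 1),
      lin (K.d h (h + 1)) x = (X ^ m : ℚ[X]) • y ∧ ∀ z : K.X (h + 1), y ≠ (X : ℚ[X]) • z := by
    by_contra! hcon
    refine hd (hom_ext' (LinearMap.ext fun x => ?_))
    refine (K.X h₀).gr_induction x (by simp) (fun j x hx => ?_) (fun a b ha hb => ?_)
    · by_contra hne
      obtain ⟨m, y, hy, hy'⟩ := exists_not_X_dvd _ hne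
      obtain ⟨z, hz⟩ := hcon m h₀ j x hx y hy
      exact hy' z hz
    · rw [map_add, map_add, ha, hb]
  obtain ⟨h, j, x, hx, y, hxy, hy⟩ := Nat.find_spec hex
  have hmin := fun k => Nat.find_min (m := k) hex
  generalize Nat.find hex = m at hxy hmin
  have hdiv : ∀ z : K.X h, ∃ w : K.X (h + 1), lin (K.d h (h + 1)) z = (X ^ m : ℚ[X]) • w := by
    intro z
    refine (K.X h).gr_induction z ⟨0, by simp⟩ (fun j z hz => ?_) ?_
    · by_cases h0 : lin (K.d h (h + 1)) z = 0
      · exact ⟨0, by rw [h0, smul_zero]⟩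
      · obtain ⟨k, w, hw, hw'⟩ := exists_not_X_dvd _ h0
        have hmk : m ≤ k := not_lt.1 fun hlt => hmin k hlt ⟨h, j, z, hz, w, hw, hw'⟩
        exact ⟨(X ^ (k - m) : ℚ[X]) • w, by rw [hw, ← mul_smul, ← pow_add, Nat.add_sub_cancel' hmk]⟩
    · rintro a b ⟨w, hw⟩ ⟨w', hw'⟩
      exact ⟨w + w', by rw [map_add, hw, hw', smul_add]⟩
  have hXm : (X ^ m : ℚ[X]) ≠ 0 := pow_ne_zero m X_ne_zero
  obtain ⟨i, rfl⟩ : ∃ i, j = 2 * m + i := ⟨j - 2 * m, by ring⟩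
  have hyi : y ∈ (K.X (h + 1)).gr i := by
    have := mem_gr_of_X_pow_smul (hxy ▸ lin_mem (K.d h (h + 1)) _ x hx)
    rwa [add_sub_cancel_left] at this
  obtain ⟨φ, hφ⟩ := exists_hom_QX _ hyi hy
  obtain ⟨ψ, hψ⟩ := exists_factor_mulXPow (m := m) (K.d h (h + 1) ≫ φ) fun z => by
    obtain ⟨w, hw⟩ := hdiv z
    refine ⟨lin φ w, ?_⟩
    change lin φ (lin (K.d h (h + 1)) z) = _
    rw [hw, map_smul]
    rfl
  have hψ' : ∀ z, (X ^ m : ℚ[X]) • lin ψ z = lin φ (lin (K.d h (h + 1)) z) := fun z =>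
    congrArg (fun f => lin f z) hψ
  have hdd : ∀ (k l : ℤ) (z : K.X h), lin (K.d k l) (lin (K.d h k) z) = 0 := fun k l z =>
    congrArg (fun f => lin f z) (K.d_comp_d h k l)
  refine ⟨h, m, i, exists_retract_twoTerm (ofElement hx) (ofElement hyi) ψ φ ?_ hψ ?_ ?_ ?_ ?_⟩
  · refine QX_hom_ext ?_
    change lin (K.d h (h + 1)) ((1 : ℚ[X]) • x) = (X ^ m * 1 : ℚ[X]) • y
    rw [one_smul, mul_one, hxy]
  · refine QX_hom_ext ?_
    change lin (K.d (h + 1) (h + 1 + 1)) ((1 : ℚ[X]) • y) = 0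
    -- `X ^ m d y = d d x = 0`, and `X ^ m` can be cancelled.
    have := hdd (h + 1) (h + 1 + 1) x
    rw [hxy, map_smul, smul_eq_zero_iff_right hXm] at this
    rw [one_smul, this]
  · intro k _
    refine hom_ext' (LinearMap.ext fun z => ?_)
    have h1 := hψ' (lin (K.d k h) z)
    have h2 : lin (K.d h (h + 1)) (lin (K.d k h) z) = 0 :=
      congrArg (fun f => lin f z) (K.d_comp_d k h (h + 1))
    rw [h2, map_zero] at h1
    exact (smul_eq_zero_iff_right hXm).1 h1
  · refine QX_hom_ext ?_
    change lin ψ ((1 : ℚ[X]) • x) = (1 : ℚ[X])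
    rw [one_smul]
    have h1 := hψ' x
    rw [hxy, map_smul, hφ] at h1
    exact smul_right_injective (QX (2 * m + i)) hXm h1
  · refine QX_hom_ext ?_
    change lin φ ((1 : ℚ[X]) • y) = (1 : ℚ[X])
    rw [one_smul, hφ]

theorem exists_single_retract {K : CochainComplex GrMod ℤ} (hd : ∀ h k, K.d h k = 0) (h : ℤ)
    [Module.Finite ℚ[X] (K.X h)] [Module.IsTorsionFree ℚ[X] (K.X h)] [Nontrivial (K.X h)] :
    ∃ (a : ℤ) (s : (HomologicalComplex.single GrMod (ComplexShape.up ℤ) h).obj (QX a) ⟶ K)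
      (r : K ⟶ (HomologicalComplex.single GrMod (ComplexShape.up ℤ) h).obj (QX a)),
      s ≫ r = 𝟙 _ := by
  obtain ⟨j, x, hx, hne⟩ : ∃ (j : ℤ) (x : K.X h), x ∈ (K.X h).gr j ∧ x ≠ 0 := by
    by_contra! hcon
    obtain ⟨x, hx⟩ := exists_ne (0 : K.X h)
    exact hx ((K.X h).gr_induction x rfl hcon fun a b ha hb => by rw [ha, hb, add_zero])
  obtain ⟨m, y, -, hy, hy'⟩ := exists_homogeneous_not_X_dvd _ hne hx
  obtain ⟨φ, hφ⟩ := exists_hom_QX _ hy hy'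
  refine ⟨_, exists_retract_single (ofElement hy) φ (fun k => ?_) (fun k => ?_) ?_⟩
  · rw [hd, Limits.comp_zero]
  · rw [hd, Limits.zero_comp]
  · refine QX_hom_ext ?_
    change lin φ ((1 : ℚ[X]) • y) = (1 : ℚ[X])
    rw [one_smul, hφ]

theorem linearEquiv_of_iso {M N : GrMod} (e : M ≅ N) : Nonempty (M ≃ₗ[ℚ[X]] N) :=
  ⟨LinearEquiv.ofLinearMap (lin e.hom) (lin e.inv) (congrArg lin e.inv_hom_id)
    (congrArg lin e.hom_inv_id)⟩

theorem linearEquiv_of_iso_biprod {M P Q : GrMod} (e : M ≅ P ⊞ Q) :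
    Nonempty (M ≃ₗ[ℚ[X]] P × Q) := by
  obtain ⟨e'⟩ := linearEquiv_of_iso e
  have hl : ∀ x, lin (biprod.fst : P ⊞ Q ⟶ P) (lin biprod.inl x) = x := fun x =>
    congrArg (fun f => lin f x) (biprod.inl_fst : _ = 𝟙 P)
  have hr : ∀ x, lin (biprod.snd : P ⊞ Q ⟶ Q) (lin biprod.inr x) = x := fun x =>
    congrArg (fun f => lin f x) (biprod.inr_snd : _ = 𝟙 Q)
  have hlr : ∀ x, lin (biprod.snd : P ⊞ Q ⟶ Q) (lin biprod.inl x) = 0 := fun x =>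
    congrArg (fun f => lin f x) (biprod.inl_snd : _ = (0 : P ⟶ Q))
  have hrl : ∀ x, lin (biprod.fst : P ⊞ Q ⟶ P) (lin biprod.inr x) = 0 := fun x =>
    congrArg (fun f => lin f x) (biprod.inr_fst : _ = (0 : Q ⟶ P))
  have E : ↥(P ⊞ Q) ≃ₗ[ℚ[X]] P × Q := LinearEquiv.ofLinearMap
    ((lin biprod.fst).prod (lin biprod.snd)) ((lin biprod.inl).coprod (lin biprod.inr))
    (LinearMap.ext fun x => Prod.ext
      ((map_add (lin biprod.fst) (lin biprod.inl x.1) (lin biprod.inr x.2)).trans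
        (by rw [hl, hrl, add_zero]; rfl))
      ((map_add (lin biprod.snd) (lin biprod.inl x.1) (lin biprod.inr x.2)).trans
        (by rw [hr, hlr, zero_add]; rfl)))
    (congrArg lin (biprod.total : _ = 𝟙 (P ⊞ Q)))
  exact ⟨e'.trans E⟩

theorem exists_linearEquiv_prod_kernel {P K : CochainComplex GrMod ℤ} (s : P ⟶ K) (r : K ⟶ P)
    (h : s ≫ r = 𝟙 P) (k : ℤ) : Nonempty (K.X k ≃ₗ[ℚ[X]] P.X k × (kernel r).X k) := by
  obtain ⟨e⟩ := iso_biprod_kernel s r h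
  exact linearEquiv_of_iso_biprod
    ((HomologicalComplex.eval GrMod (ComplexShape.up ℤ) k).mapIso e ≪≫
      (HomologicalComplex.eval GrMod (ComplexShape.up ℤ) k).mapBiprod P (kernel r))

/-- The descent for the induction: the complement of a retract keeps all hypotheses on `K`, and its
total rank drops because `P` has rank one in degree `k`. -/
theorem finrank_kernel_lt {P K : CochainComplex GrMod ℤ}
    [∀ h, Module.Finite ℚ[X] (K.X h)] [∀ h, Module.IsTorsionFree ℚ[X] (K.X h)] (s : P ⟶ K)
    (r : K ⟶ P) (h : s ≫ r = 𝟙 P) {k : ℤ} {a : ℤ} (hk : Nonempty (QX a ≅ P.X k))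
    (S : Finset ℤ) (hS : ∀ h ∉ S, Subsingleton (K.X h)) :
    (∀ h, Module.Finite ℚ[X] ((kernel r).X h)) ∧
    (∀ h, Module.IsTorsionFree ℚ[X] ((kernel r).X h)) ∧
    (∀ h ∉ S, Subsingleton ((kernel r).X h)) ∧
    ∑ h ∈ S, Module.finrank ℚ[X] ((kernel r).X h) < ∑ h ∈ S, Module.finrank ℚ[X] (K.X h) := by
  have e := fun l => (exists_linearEquiv_prod_kernel s r h l).some
  have hinj : ∀ l, Function.Injective
      ((e l).symm.toLinearMap ∘ₗ LinearMap.inr ℚ[X] (P.X l) ((kernel r).X l)) := fun l =>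
    (e l).symm.injective.comp LinearMap.inr_injective
  have hsurj : ∀ l, Function.Surjective
      (LinearMap.snd ℚ[X] (P.X l) ((kernel r).X l) ∘ₗ (e l).toLinearMap) := fun l =>
    Prod.snd_surjective.comp (e l).surjective
  have hsurj' : ∀ l, Function.Surjective
      (LinearMap.fst ℚ[X] (P.X l) ((kernel r).X l) ∘ₗ (e l).toLinearMap) := fun l =>
    Prod.fst_surjective.comp (e l).surjective
  have hinj' : ∀ l, Function.Injective
      ((e l).symm.toLinearMap ∘ₗ LinearMap.inl ℚ[X] (P.X l) ((kernel r).X l)) := fun l =>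
    (e l).symm.injective.comp LinearMap.inl_injective
  have f1 : ∀ l, Module.Finite ℚ[X] ((kernel r).X l) := fun l => .of_surjective _ (hsurj l)
  have f2 : ∀ l, Module.Finite ℚ[X] (P.X l) := fun l => .of_surjective _ (hsurj' l)
  have t1 : ∀ l, Module.IsTorsionFree ℚ[X] ((kernel r).X l) := fun l =>
    (hinj l).moduleIsTorsionFree _ (map_smul _)
  have t2 : ∀ l, Module.IsTorsionFree ℚ[X] (P.X l) := fun l =>
    (hinj' l).moduleIsTorsionFree _ (map_smul _)
  have hrank : ∀ l, Module.finrank ℚ[X] (K.X l) =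
      Module.finrank ℚ[X] (P.X l) + Module.finrank ℚ[X] ((kernel r).X l) := fun l => by
    rw [(e l).finrank_eq, Module.finrank_prod]
  have hP : Module.finrank ℚ[X] (P.X k) = 1 := by
    obtain ⟨e⟩ := linearEquiv_of_iso hk.some
    rw [← e.finrank_eq]
    exact Module.finrank_self ℚ[X]
  refine ⟨f1, t1, fun l hl => ?_, ?_⟩
  · have := hS l hl
    exact (hsurj l).subsingleton
  · refine Finset.sum_lt_sum (fun l _ => by rw [hrank l]; omega) ⟨k, ?_, by rw [hrank k, hP]; omega⟩
    by_contra hk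
    have := hS k hk
    have h0 : Module.finrank ℚ[X] (K.X k) = 0 := Module.finrank_zero_of_subsingleton
    have := hrank k
    omega

/-- A bounded complex of graded modules that are finitely generated and free over `ℚ[X]` is a direct
sum of complexes with one term and of complexes `X ^ m`. -/
theorem exists_isSum (S : Finset ℤ) : ∀ (n : ℕ) (K : CochainComplex GrMod ℤ)
    [∀ h, Module.Finite ℚ[X] (K.X h)] [∀ h, Module.IsTorsionFree ℚ[X] (K.X h)]
    (_ : ∀ h ∉ S, Subsingleton (K.X h)) (_ : ∑ h ∈ S, Module.finrank ℚ[X] (K.X h) ≤ n),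
    ∃ (ι κ : Type) (_ : Fintype ι) (_ : Fintype κ) (h : ι → ℤ) (m : ι → ℕ) (i : ι → ℤ)
      (h' : κ → ℤ) (a : κ → ℤ), IsSum K (Sum.elim
        (fun k => twoTerm (h k) (mulXPow (m k) (i k)))
        (fun l =>
          (HomologicalComplex.single GrMod (ComplexShape.up ℤ) (h' l)).obj (QX (a l)))) := by
  intro n
  induction n with
  | zero =>
    intro K _ _ hS hn
    have h0 : ∀ h, Subsingleton (K.X h) := fun h => by
      by_cases hh : h ∈ S
      · exact Module.finrank_zero_iff.1
          (Finset.sum_eq_zero_iff.1 (Nat.le_zero.1 hn) h hh)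
      · exact hS h hh
    refine ⟨Empty, Empty, inferInstance, inferInstance, nofun, nofun, nofun, nofun, nofun,
      nofun, nofun, nofun, nofun, ?_⟩
    rw [Finset.sum_of_isEmpty]
    ext h : 1
    have := h0 h
    exact hom_ext' (LinearMap.ext fun x => Subsingleton.elim _ _)
  | succ n ih =>
    intro K _ _ hS hn
    -- Two-term summands are split off while the differential is nonzero, one-term summands
    -- afterwards.
    by_cases hd : ∀ h, K.d h (h + 1) = 0
    · have hd' : ∀ h k, K.d h k = 0 := fun h k => by
        by_cases hk : h + 1 = k
        · subst hk; exact hd h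
        · exact K.shape h k hk
      by_cases hK : ∀ h, Subsingleton (K.X h)
      · refine ih K hS ?_
        rw [Finset.sum_eq_zero fun h _ => ?_]
        · exact n.zero_le
        · have := hK h
          exact Module.finrank_zero_of_subsingleton
      · push Not at hK
        obtain ⟨h, hh⟩ := hK
        obtain ⟨a, s, r, hsr⟩ := exists_single_retract hd' h
        obtain ⟨f1, t1, hS', hlt⟩ := finrank_kernel_lt s r hsr (k := h) (a := a)
          ⟨(HomologicalComplex.singleObjXSelf (ComplexShape.up ℤ) h (QX a)).symm⟩ S hS
        obtain ⟨ι, κ, _, _, H, m, i, H', A, hsum⟩ := ih (kernel r) hS' (by omega)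
        refine ⟨ι, Unit ⊕ κ, inferInstance, inferInstance, H, m, i, Sum.elim (fun _ => h) H',
          Sum.elim (fun _ => a) A,
          (hsum.of_retract s r hsr).reindex ((Equiv.sumAssoc _ _ _).symm.trans
            ((Equiv.sumCongr (Equiv.sumComm _ _) (Equiv.refl _)).trans (Equiv.sumAssoc _ _ _))) ?_⟩
        rintro (k | k | k) <;> exact ⟨Iso.refl _⟩
    · push Not at hd
      obtain ⟨h₀, hd⟩ := hd
      obtain ⟨h, m, i, s, r, hsr⟩ := exists_twoTerm_retract hd
      obtain ⟨f1, t1, hS', hlt⟩ := finrank_kernel_lt s r hsr (k := h) (a := 2 * m + i)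
        ⟨(HomologicalComplex.doubleXIso₀ (c := ComplexShape.up ℤ) (mulXPow m i) rfl).symm⟩ S hS
      obtain ⟨ι, κ, _, _, H, M, I, H', A, hsum⟩ := ih (kernel r) hS' (by omega)
      refine ⟨Unit ⊕ ι, κ, inferInstance, inferInstance, Sum.elim (fun _ => h) H,
        Sum.elim (fun _ => m) M, Sum.elim (fun _ => i) I, H', A,
        (hsum.of_retract s r hsr).reindex (Equiv.sumAssoc _ _ _) ?_⟩
      rintro ((k | k) | k) <;> exact ⟨Iso.refl _⟩

end GrMod

namespace GrMod

/-! ### Cycles and boundaries in direct sums -/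

theorem lin_f_d {K L : CochainComplex GrMod ℤ} (φ : K ⟶ L) (h k : ℤ) (x : K.X h) :
    lin (φ.f k) (lin (K.d h k) x) = lin (L.d h k) (lin (φ.f h) x) :=
  (congrArg (fun f => lin f x) (φ.comm h k)).symm

theorem lin_hom_inv {M N : GrMod} (e : M ≅ N) (x : M) : lin e.inv (lin e.hom x) = x :=
  congrArg (fun f => lin f x) e.hom_inv_id

theorem lin_inv_hom {M N : GrMod} (e : M ≅ N) (x : N) : lin e.hom (lin e.inv x) = x :=
  congrArg (fun f => lin f x) e.inv_hom_id

theorem subsingleton_of_isZero {M : GrMod} (h : IsZero M) : Subsingleton M :=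
  subsingleton_of_forall_eq 0 fun x => congrArg (fun f => lin f x) (h.eq_of_src (𝟙 M) 0)

theorem twoTerm_data {M N : GrMod} (h : ℤ) (f : M ⟶ N) :
    ∃ (a : (twoTerm h f).X h ≅ M) (b : (twoTerm h f).X (h + 1) ≅ N),
      (twoTerm h f).d h (h + 1) = a.hom ≫ f ≫ b.inv ∧
      ∀ k, k ≠ h → k ≠ h + 1 → IsZero ((twoTerm h f).X k) := by
  have hne : h ≠ h + 1 := by omega
  exact ⟨HomologicalComplex.doubleXIso₀ (c := ComplexShape.up ℤ) f rfl,
    HomologicalComplex.doubleXIso₁ (c := ComplexShape.up ℤ) f rfl hne,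
    HomologicalComplex.double_d (c := ComplexShape.up ℤ) f rfl hne,
    HomologicalComplex.isZero_double_X (c := ComplexShape.up ℤ) f rfl⟩

theorem sum_lin_apply {K : CochainComplex GrMod ℤ} {ι : Type*} [Fintype ι]
    {f : ι → CochainComplex GrMod ℤ} {i : ∀ k, f k ⟶ K} {p : ∀ k, K ⟶ f k}
    (h : ∑ k, p k ≫ i k = 𝟙 K) {l : ℤ} (z : K.X l) :
    ∑ k, lin ((i k).f l) (lin ((p k).f l) z) = z := by
  have hf : (∑ k, p k ≫ i k).f l = ∑ k, (p k ≫ i k).f l :=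
    map_sum (HomologicalComplex.Hom.fAddMonoidHom l) _ _
  have h1 : ∑ k, lin ((p k ≫ i k).f l) z = z := by
    rw [← LinearMap.sum_apply, ← lin_sum, ← hf, h]
    rfl
  exact h1

/-- A nonzero multiple of `z` is a boundary. -/
def IsTorsionClass {K : CochainComplex GrMod ℤ} {h : ℤ} (z : K.X h) : Prop :=
  ∃ p : ℚ[X], p ≠ 0 ∧ ∃ (h' : ℤ) (y : K.X h'), p • z = lin (K.d h' h) y

namespace IsTorsionClass

variable {K L : CochainComplex GrMod ℤ} {h : ℤ} {z w : K.X h}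

theorem exists_eq (hz : IsTorsionClass z) (h' : ℤ) (hh : h' + 1 = h) :
    ∃ p : ℚ[X], p ≠ 0 ∧ ∃ y : K.X h', p • z = lin (K.d h' h) y := by
  obtain ⟨p, hp, k, y, hy⟩ := hz
  by_cases hk : k = h'
  · subst hk; exact ⟨p, hp, y, hy⟩
  · rw [K.shape k h fun hk' => hk (by have : k + 1 = h := hk'; omega)] at hy
    exact ⟨p, hp, 0, hy.trans (map_zero _).symm⟩

theorem map (φ : K ⟶ L) (hz : IsTorsionClass z) : IsTorsionClass (lin (φ.f h) z) := by
  obtain ⟨p, hp, k, y, hy⟩ := hz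
  exact ⟨p, hp, k, lin (φ.f k) y, by rw [← map_smul, hy, lin_f_d]⟩

theorem zero : IsTorsionClass (0 : K.X h) := ⟨1, _root_.one_ne_zero, h, 0, by simp⟩

theorem add (hz : IsTorsionClass z) (hw : IsTorsionClass w) : IsTorsionClass (z + w) := by
  obtain ⟨p, hp, y, hy⟩ := hz.exists_eq (h - 1) (by omega)
  obtain ⟨q, hq, x, hx⟩ := hw.exists_eq (h - 1) (by omega)
  refine ⟨p * q, mul_ne_zero hp hq, h - 1, q • y + p • x, ?_⟩
  rw [map_add, map_smul, map_smul, ← hy, ← hx, smul_add, mul_smul, mul_smul, smul_comm p q z]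

theorem sum {ι : Type*} (s : Finset ι) {z : ι → K.X h} (hz : ∀ k ∈ s, IsTorsionClass (z k)) :
    IsTorsionClass (∑ k ∈ s, z k) :=
  Finset.sum_induction _ _ (fun _ _ => add) zero hz

end IsTorsionClass

/-- `X ^ m` is injective, so there are no nonzero cycles in the source; in the target, `X ^ m` times
any element is a boundary. -/
theorem isTorsionClass_twoTerm {h : ℤ} {m : ℕ} {i : ℤ} {l : ℤ}
    (z : (twoTerm h (mulXPow m i)).X l) (hz : lin ((twoTerm h (mulXPow m i)).d l (l + 1)) z = 0) :
    IsTorsionClass z := by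
  obtain ⟨a, b, hd, h0⟩ := twoTerm_data h (mulXPow m i)
  have hXm : (X ^ m : ℚ[X]) ≠ 0 := pow_ne_zero m X_ne_zero
  have hd' : ∀ x, lin b.hom (lin ((twoTerm h (mulXPow m i)).d h (h + 1)) x) =
      (X ^ m : ℚ[X]) • lin a.hom x := fun x => by
    rw [hd]; exact lin_inv_hom b _
  by_cases hl : l = h
  · subst hl
    have h1 := hd' z
    rw [hz, map_zero] at h1
    have h2 : lin a.hom z = 0 := (smul_eq_zero_iff_right (M := QX i) hXm).1 h1.symm
    rw [← lin_hom_inv a z, h2, map_zero]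
    exact .zero
  · by_cases hl' : l = h + 1
    · subst hl'
      refine ⟨X ^ m, hXm, h, lin a.inv (lin b.hom z), ?_⟩
      have h1 := hd' (lin a.inv (lin b.hom z))
      have h2 : lin a.hom (lin a.inv (lin b.hom z)) = lin b.hom z := lin_inv_hom a _
      have h3 : lin b.hom ((X ^ m : ℚ[X]) • z) =
        lin b.hom (lin ((twoTerm h (mulXPow m i)).d h (h + 1)) (lin a.inv (lin b.hom z))) :=
        (map_smul _ _ _).trans ((congrArg (fun u => (X ^ m : ℚ[X]) • u) h2).symm.trans h1.symm)
      rw [← lin_hom_inv b ((X ^ m : ℚ[X]) • z), h3, lin_hom_inv]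
    · have := subsingleton_of_isZero (h0 l hl hl')
      rw [Subsingleton.elim z 0]
      exact .zero

section single

variable {K : CochainComplex GrMod ℤ} {h : ℤ} {M : GrMod}

/-- The morphism of graded modules that corresponds to a morphism from the complex
`0 → M → 0`. -/
def singleIn (s : (HomologicalComplex.single GrMod (ComplexShape.up ℤ) h).obj M ⟶ K) : M ⟶ K.X h :=
  (HomologicalComplex.singleObjXSelf (ComplexShape.up ℤ) h M).inv ≫ s.f h

/-- The morphism of graded modules that corresponds to a morphism to the complex `0 → M → 0`. -/
def singleOut (r : K ⟶ (HomologicalComplex.single GrMod (ComplexShape.up ℤ) h).obj M) : K.X h ⟶ M :=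
  r.f h ≫ (HomologicalComplex.singleObjXSelf (ComplexShape.up ℤ) h M).hom

theorem d_singleIn (s : (HomologicalComplex.single GrMod (ComplexShape.up ℤ) h).obj M ⟶ K)
    (k : ℤ) (x : M) : lin (K.d h k) (lin (singleIn s) x) = 0 := by
  have : singleIn s ≫ K.d h k = 0 := by
    rw [singleIn, Category.assoc, s.comm, HomologicalComplex.single_obj_d, Limits.zero_comp,
      Limits.comp_zero]
  exact congrArg (fun f => lin f x) this

theorem singleOut_d (r : K ⟶ (HomologicalComplex.single GrMod (ComplexShape.up ℤ) h).obj M)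
    (k : ℤ) (x : K.X k) : lin (singleOut r) (lin (K.d k h) x) = 0 := by
  have : K.d k h ≫ singleOut r = 0 := by
    rw [singleOut, ← Category.assoc, ← r.comm, HomologicalComplex.single_obj_d, Limits.comp_zero,
      Limits.zero_comp]
  exact congrArg (fun f => lin f x) this

theorem singleOut_singleIn {N : GrMod}
    (s : (HomologicalComplex.single GrMod (ComplexShape.up ℤ) h).obj M ⟶ K)
    (r : K ⟶ (HomologicalComplex.single GrMod (ComplexShape.up ℤ) h).obj N) (x : M) :
    lin (singleOut r) (lin (singleIn s) x) =
      lin (HomologicalComplex.singleObjXSelf (ComplexShape.up ℤ) h N).hom (lin ((s ≫ r).f h)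
        (lin (HomologicalComplex.singleObjXSelf (ComplexShape.up ℤ) h M).inv x)) := rfl

theorem singleOut_singleIn_self
    {s : (HomologicalComplex.single GrMod (ComplexShape.up ℤ) h).obj M ⟶ K}
    {r : K ⟶ (HomologicalComplex.single GrMod (ComplexShape.up ℤ) h).obj M} (hsr : s ≫ r = 𝟙 _)
    (x : M) : lin (singleOut r) (lin (singleIn s) x) = x := by
  rw [singleOut_singleIn, hsr]
  exact lin_inv_hom _ x

theorem singleOut_singleIn_zero {N : GrMod}
    {s : (HomologicalComplex.single GrMod (ComplexShape.up ℤ) h).obj M ⟶ K}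
    {r : K ⟶ (HomologicalComplex.single GrMod (ComplexShape.up ℤ) h).obj N} (hsr : s ≫ r = 0)
    (x : M) : lin (singleOut r) (lin (singleIn s) x) = 0 := by
  rw [singleOut_singleIn, hsr]
  exact map_zero _

end single

/-- The generator of `ℚ[X]{i}`. -/
def one (i : ℤ) : QX i := (1 : ℚ[X])

theorem one_ne_zero (i : ℤ) : one i ≠ 0 := _root_.one_ne_zero (α := ℚ[X])

theorem one_mem_gr (i : ℤ) : one i ∈ (QX i).gr i := fun n hn => by
  change (1 : ℚ[X]).coeff n ≠ 0 at hn
  rw [coeff_one] at hn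
  split_ifs at hn with h
  · subst h; simp
  · exact absurd rfl hn

/-- The generator of a one-term summand is not a torsion class, while two-term summands have only
torsion cohomology. So the one-term summands count the rank of the cohomology, which is one in
degree `0` and zero elsewhere. -/
theorem exists_unique_single {K : CochainComplex GrMod ℤ} {ι κ : Type} [Fintype ι] [Fintype κ]
    {h : ι → ℤ} {m : ι → ℕ} {i : ι → ℤ} {h' : κ → ℤ} {a : κ → ℤ}
    (hK : IsSum K (Sum.elim (fun k => twoTerm (h k) (mulXPow (m k) (i k)))
      (fun l => (HomologicalComplex.single GrMod (ComplexShape.up ℤ) (h' l)).obj (QX (a l)))))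
    (htors : ∀ h, h ≠ 0 → ∀ z : K.X h, lin (K.d h (h + 1)) z = 0 → IsTorsionClass z)
    {e : K.X 0} (he : lin (K.d 0 (0 + 1)) e = 0) (he' : ¬ IsTorsionClass e)
    (hrank : ∀ z : K.X 0, lin (K.d 0 (0 + 1)) z = 0 → ∃ p q : ℚ[X], p ≠ 0 ∧
      ∃ (k : ℤ) (y : K.X k), p • z - q • e = lin (K.d k 0) y) :
    (∀ l, h' l = 0) ∧ Nonempty κ ∧ Subsingleton κ := by
  obtain ⟨s, r, h1, h2, h3⟩ := hK
  let b : ∀ l, K.X (h' l) := fun l => lin (singleIn (s (Sum.inr l))) (one (a l))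
  let ψ : ∀ l, K.X (h' l) ⟶ QX (a l) := fun l => singleOut (r (Sum.inr l))
  have hbd : ∀ l k, lin (K.d (h' l) k) (b l) = 0 := fun l k => d_singleIn _ k _
  have hψ : ∀ l k (x : K.X k), lin (ψ l) (lin (K.d k (h' l)) x) = 0 := fun l k x =>
    singleOut_d _ k x
  have hone : ∀ l, lin (ψ l) (b l) = one (a l) := fun l =>
    singleOut_singleIn_self (h1 (Sum.inr l)) _
  have hnt : ∀ l, ¬ IsTorsionClass (b l) := by
    rintro l ⟨p, hp, k, y, hy⟩
    have := hψ l k y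
    rw [← hy, map_smul, hone] at this
    exact hp ((smul_eq_zero.1 this).resolve_right (one_ne_zero _))
  have hh : ∀ l, h' l = 0 := fun l => by
    by_contra hne
    exact hnt l (htors _ hne _ (hbd l _))
  refine ⟨hh, ?_, ?_⟩
  · by_contra hκ
    rw [not_nonempty_iff] at hκ
    refine he' ?_
    rw [← sum_lin_apply h3 e]
    refine IsTorsionClass.sum _ fun k _ => IsTorsionClass.map (s k) ?_
    rcases k with k | k
    · exact isTorsionClass_twoTerm _ ((lin_f_d (r (Sum.inl k)) 0 (0 + 1) e).symm.trans
        ((congrArg (lin ((r (Sum.inl k)).f (0 + 1))) he).trans (map_zero _)))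
    · exact hκ.elim k
  -- Up to torsion, `b l` and `b l'` are both proportional to `e`. Applying `ψ l` to the first
  -- relation shows `q ≠ 0`; applying `ψ l'` then shows `ψ l' e = 0`, and the second relation
  -- contradicts `ψ l' (b l') = 1`.
  · refine ⟨fun l l' => by_contra fun hne => ?_⟩
    obtain rfl : h' = fun _ => 0 := funext hh
    have hcross : ∀ l l', l ≠ l' → lin (ψ l') (b l) = 0 := fun l l' hne =>
      singleOut_singleIn_zero (h2 (Sum.inr l) (Sum.inr l') (by simpa using hne)) _
    obtain ⟨p, q, hp, k, y, hy⟩ := hrank _ (hbd l _)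
    obtain ⟨p', q', hp', k', y', hy'⟩ := hrank _ (hbd l' _)
    have e1 := congrArg (lin (ψ l)) hy
    have e2 := congrArg (lin (ψ l')) hy
    have e4 := congrArg (lin (ψ l')) hy'
    rw [hψ, map_sub, map_smul, map_smul, sub_eq_zero] at e1 e2 e4
    rw [hone] at e1 e4
    rw [hcross l l' hne, smul_zero, eq_comm] at e2
    have hq : q ≠ 0 := fun h => smul_ne_zero hp (one_ne_zero (a l))
      (e1.trans (by rw [h, zero_smul]))
    rw [(smul_eq_zero.1 e2).resolve_left hq, smul_zero] at e4
    exact smul_ne_zero hp' (one_ne_zero (a l')) e4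

/-! ### Contractible complexes -/

theorem isContractible_of_isSum {K : CochainComplex GrMod ℤ} {ι : Type*} [Fintype ι]
    {f : ι → CochainComplex GrMod ℤ} (hK : IsSum K f) (hf : ∀ k, IsContractible (f k)) :
    IsContractible K := by
  classical
  obtain ⟨i, p, -, -, h3⟩ := hK
  have key : ∀ s : Finset ι, Nonempty (Homotopy (∑ k ∈ s, p k ≫ i k) 0) := by
    intro s
    induction s using Finset.induction_on with
    | empty => exact ⟨Homotopy.ofEq (by simp)⟩
    | insert k s hk ih =>
      obtain ⟨H⟩ := ih
      obtain ⟨H'⟩ := hf k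
      rw [Finset.sum_insert hk]
      have H1 : Homotopy (p k ≫ i k) 0 :=
        (Homotopy.ofEq (by simp)).trans (((H'.compRight (i k)).compLeft (p k)).trans
          (Homotopy.ofEq (by simp)))
      exact ⟨(H1.add H).trans (Homotopy.ofEq (by simp))⟩
  obtain ⟨H⟩ := key Finset.univ
  exact ⟨(Homotopy.ofEq h3.symm).trans H⟩

theorem isContractible_twoTerm {M N : GrMod} (h : ℤ) (f : M ⟶ N) [IsIso f] :
    IsContractible (twoTerm h f) := by
  obtain ⟨a, b, hd, h0⟩ := twoTerm_data h f
  let u : (twoTerm h f).X (h + 1) ⟶ (twoTerm h f).X h := b.hom ≫ inv f ≫ a.inv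
  have hu : (twoTerm h f).d h (h + 1) ≫ u = 𝟙 _ := by simp [hd, u]
  have hu' : u ≫ (twoTerm h f).d h (h + 1) = 𝟙 _ := by simp [hd, u]
  let H : ∀ k l, (ComplexShape.up ℤ).Rel l k → ((twoTerm h f).X k ⟶ (twoTerm h f).X l) :=
    fun k l hkl => if hl : l = h then
      eqToHom (by subst hl; exact congrArg _ (hkl : l + 1 = k).symm) ≫ u ≫ eqToHom (by rw [hl])
    else 0
  have hH : H (h + 1) h rfl = u := by simp [H]
  refine ⟨(Homotopy.ofEq ?_).trans (Homotopy.nullHomotopy' H)⟩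
  ext k : 1
  by_cases hk : k = h
  · subst hk
    have r : (ComplexShape.up ℤ).Rel (k - 1) k := sub_add_cancel k 1
    rw [Homotopy.nullHomotopicMap'_f (k₂ := k - 1) (k₁ := k) (k₀ := k + 1) r rfl, hH, hu,
      (h0 (k - 1) (by omega) (by omega)).eq_of_tgt (H k (k - 1) r) 0]
    simp
  · by_cases hk' : k = h + 1
    · subst hk'
      rw [Homotopy.nullHomotopicMap'_f (k₂ := h) (k₁ := h + 1) (k₀ := h + 1 + 1) rfl rfl, hH, hu',
        (h0 (h + 1 + 1) (by omega) (by omega)).eq_of_tgt ((twoTerm h f).d _ _) 0]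
      simp
    · exact (h0 k hk hk').eq_of_src _ _

theorem isIso_mulXPow_zero (i : ℤ) : IsIso (mulXPow 0 i) := by
  have h1 : ∀ p : ℚ[X], lin (mulXPow 0 i) p = p := fun p => by
    change (X ^ 0 * p : ℚ[X]) = p
    rw [pow_zero, one_mul]
  obtain ⟨j, hj⟩ : ∃ j, j = 2 * ((0 : ℕ) : ℤ) + i := ⟨_, rfl⟩
  refine ⟨ofLin (M := QX i) (N := QX (2 * ((0 : ℕ) : ℤ) + i)) LinearMap.id fun k p hp n hn => ?_,
    ?_, ?_⟩
  · have := hp n hn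
    simpa using this
  · exact hom_ext' (LinearMap.ext h1)
  · exact hom_ext' (LinearMap.ext h1)

end GrMod

/-- The normal form may contain summands `X ^ 0`. These are isomorphisms, hence contractible, and
together they form `E`. -/
theorem GrMod.exists_isStarDecomposition {K : CochainComplex GrMod ℤ}
    [∀ h, Module.Finite ℚ[X] (K.X h)] [∀ h, Module.IsTorsionFree ℚ[X] (K.X h)]
    (S : Finset ℤ) (hS : ∀ h ∉ S, Subsingleton (K.X h))
    (htors : ∀ h, h ≠ 0 → ∀ z : K.X h, lin (K.d h (h + 1)) z = 0 → IsTorsionClass z)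
    {e : K.X 0} (he : lin (K.d 0 (0 + 1)) e = 0) (he' : ¬ IsTorsionClass e)
    (hrank : ∀ z : K.X 0, lin (K.d 0 (0 + 1)) z = 0 → ∃ p q : ℚ[X], p ≠ 0 ∧
      ∃ (k : ℤ) (y : K.X k), p • z - q • e = lin (K.d k 0) y) :
    ∃ (a : ℤ) (r : ℕ) (h : Fin r → ℤ) (m : Fin r → ℕ) (i : Fin r → ℤ)
      (E : CochainComplex GrMod ℤ), IsStarDecomposition K a r h m i E := by
  classical
  obtain ⟨ι, κ, _, _, h, m, i, h', a, hK⟩ := exists_isSum S _ K hS le_rfl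
  obtain ⟨hh, ⟨l⟩, hκ⟩ := exists_unique_single hK htors he he' hrank
  obtain rfl : h' = fun _ => 0 := funext hh
  let P := {k : ι // 0 < m k}
  let Z := {k : ι // ¬ 0 < m k}
  let n := Fintype.card P
  let eP : Fin n ≃ P := (Fintype.equivFin P).symm
  let f : ι → CochainComplex GrMod ℤ := fun k => twoTerm (h k) (mulXPow (m k) (i k))
  let n' := Fintype.card Z
  let eZ : Fin n' ≃ Z := (Fintype.equivFin Z).symm
  let E : CochainComplex GrMod ℤ := ⨁ fun k : Fin n' => f (eZ k).1
  refine ⟨a l, n, fun k => h (eP k).1, fun k => m (eP k).1, fun k => i (eP k).1, E,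
    fun k => (eP k).2, ?_, ?_⟩
  · refine isContractible_of_isSum (IsSum.biproduct _) fun k => ?_
    have hm : m (eZ k).1 = 0 := by have := (eZ k).2; omega
    have : IsIso (mulXPow (m (eZ k).1) (i (eZ k).1)) := by
      rw [hm]; exact isIso_mulXPow_zero _
    exact isContractible_twoTerm _ _
  · have h1 := (IsSum.biproduct fun k : Fin n => f (eP k).1).biprod
      ((IsSum.biproduct fun k : Fin n' => f (eZ k).1).biprod (IsSum.unit (oneTerm (QX (a l)))))
    have eκ : Unit ≃ κ := ⟨fun _ => l, fun _ => (), fun _ => rfl, fun _ => Subsingleton.elim _ _⟩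
    refine (hK.reindex (g := Sum.elim (fun k : Fin n => f (eP k).1)
      (Sum.elim (fun k : Fin n' => f (eZ k).1) (fun _ : Unit => oneTerm (QX (a l)))))
      ((Equiv.sumAssoc _ _ _).symm.trans (Equiv.sumCongr
      ((Equiv.sumCongr eP eZ).trans (Equiv.sumCompl fun k => 0 < m k)) eκ)) ?_).iso h1
    rintro (k | k | k)
    · exact ⟨Iso.refl _⟩
    · exact ⟨Iso.refl _⟩
    · have : eκ () = l := Subsingleton.elim _ _
      refine ⟨eqToIso ?_⟩
      change oneTerm (QX (a l)) = oneTerm (QX (a (eκ ())))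
      rw [this]

namespace GrMod

/-! ### Cohomology modulo `X ^ 2 - 1` -/

/-- `z` represents zero in the cohomology of `K / (X ^ 2 - 1) K`. -/
def IsLeeBoundary {K : CochainComplex GrMod ℤ} {h : ℤ} (z : K.X h) : Prop :=
  ∃ (h' : ℤ) (y : K.X h') (w : K.X h), z = lin (K.d h' h) y + (X ^ 2 - 1 : ℚ[X]) • w

/-- The cohomology of `K / (X ^ 2 - 1) K` vanishes. -/
def IsLeeAcyclic (K : CochainComplex GrMod ℤ) : Prop :=
  ∀ (h : ℤ) (z : K.X h),
    (∃ w : K.X (h + 1), lin (K.d h (h + 1)) z = (X ^ 2 - 1 : ℚ[X]) • w) → IsLeeBoundary z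

namespace IsLeeBoundary

variable {K L : CochainComplex GrMod ℤ} {h : ℤ} {z w : K.X h}

theorem map (φ : K ⟶ L) (hz : IsLeeBoundary z) : IsLeeBoundary (lin (φ.f h) z) := by
  obtain ⟨k, y, w, hy⟩ := hz
  exact ⟨k, lin (φ.f k) y, lin (φ.f h) w, by rw [hy, map_add, map_smul, lin_f_d]⟩

theorem zero : IsLeeBoundary (0 : K.X h) := ⟨h, 0, 0, by simp⟩

theorem exists_eq (hz : IsLeeBoundary z) (h' : ℤ) (hh : h' + 1 = h) :
    ∃ (y : K.X h') (w : K.X h), z = lin (K.d h' h) y + (X ^ 2 - 1 : ℚ[X]) • w := by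
  obtain ⟨k, y, w, hy⟩ := hz
  by_cases hk : k = h'
  · subst hk; exact ⟨y, w, hy⟩
  · rw [K.shape k h fun hk' => hk (by have : k + 1 = h := hk'; omega)] at hy
    exact ⟨0, w, hy.trans (congrArg (· + (X ^ 2 - 1 : ℚ[X]) • w) (map_zero _).symm)⟩

theorem add (hz : IsLeeBoundary z) (hw : IsLeeBoundary w) : IsLeeBoundary (z + w) := by
  obtain ⟨y, u, hy⟩ := hz.exists_eq (h - 1) (by omega)
  obtain ⟨x, v, hx⟩ := hw.exists_eq (h - 1) (by omega)
  refine ⟨h - 1, y + x, u + v, ?_⟩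
  rw [hy, hx, map_add, smul_add]
  abel

theorem sum {ι : Type*} (s : Finset ι) {z : ι → K.X h} (hz : ∀ k ∈ s, IsLeeBoundary (z k)) :
    IsLeeBoundary (∑ k ∈ s, z k) :=
  Finset.sum_induction _ _ (fun _ _ => add) zero hz

end IsLeeBoundary

/-- Modulo `X ^ 2 - 1` the square of `X ^ m` is `1`, so the differential is invertible. Explicitly,
every `x` is `X ^ m X ^ m x` minus a multiple of `X ^ 2 - 1`, which provides the witnesses. -/
theorem isLeeAcyclic_twoTerm (h : ℤ) (m : ℕ) (i : ℤ) :
    IsLeeAcyclic (twoTerm h (mulXPow m i)) := by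
  obtain ⟨a, b, hd, h0⟩ := twoTerm_data h (mulXPow m i)
  obtain ⟨c, hc⟩ : (X ^ 2 - 1 : ℚ[X]) ∣ (X ^ m) ^ 2 - 1 := by
    rw [← pow_mul, mul_comm, pow_mul]
    simpa using sub_dvd_pow_sub_pow (X ^ 2 : ℚ[X]) 1 m
  have hsm : ∀ {M : GrMod} (x : M),
      x = (X ^ m : ℚ[X]) • (X ^ m : ℚ[X]) • x + (X ^ 2 - 1 : ℚ[X]) • (-c) • x := fun x => by
    rw [smul_smul, smul_smul, ← add_smul, ← pow_two, mul_neg, ← hc]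
    simp
  have hd' : ∀ x, lin b.hom (lin ((twoTerm h (mulXPow m i)).d h (h + 1)) x) =
      (X ^ m : ℚ[X]) • lin a.hom x := fun x => by
    rw [hd]; exact lin_inv_hom b _
  rintro l z ⟨w, hz⟩
  by_cases hl : l = h
  · subst hl
    refine ⟨l, 0, lin a.inv ((X ^ m : ℚ[X]) • lin b.hom w) + (-c) • z, ?_⟩
    have h1 := hd' z
    rw [hz, map_smul] at h1
    have h2 : (X ^ m : ℚ[X]) • lin a.hom z = (X ^ 2 - 1 : ℚ[X]) • lin b.hom w := h1.symm
    rw [map_zero, zero_add, smul_add]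
    refine (hsm z).trans (congrArg (· + (X ^ 2 - 1 : ℚ[X]) • (-c) • z) ?_)
    have h3 : (X ^ m : ℚ[X]) • (X ^ m : ℚ[X]) • lin a.hom z =
        (X ^ 2 - 1 : ℚ[X]) • ((X ^ m : ℚ[X]) • lin b.hom w) :=
      (congrArg (fun u => (X ^ m : ℚ[X]) • u) h2).trans
        (smul_comm (X ^ m : ℚ[X]) (X ^ 2 - 1 : ℚ[X]) (lin b.hom w))
    have h4 := congrArg (lin a.inv) h3
    rw [map_smul, map_smul, lin_hom_inv] at h4
    exact h4.trans (map_smul (lin a.inv) _ _)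
  · by_cases hl' : l = h + 1
    · subst hl'
      refine ⟨h, lin a.inv ((X ^ m : ℚ[X]) • lin b.hom z), (-c) • z, ?_⟩
      refine (hsm z).trans (congrArg (· + (X ^ 2 - 1 : ℚ[X]) • (-c) • z) ?_)
      have h1 := hd' (lin a.inv ((X ^ m : ℚ[X]) • lin b.hom z))
      have h2 : lin a.hom (lin a.inv ((X ^ m : ℚ[X]) • lin b.hom z)) =
        (X ^ m : ℚ[X]) • lin b.hom z := lin_inv_hom a _
      have h3 : lin b.hom ((X ^ m : ℚ[X]) • (X ^ m : ℚ[X]) • z) =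
        lin b.hom (lin ((twoTerm h (mulXPow m i)).d h (h + 1))
          (lin a.inv ((X ^ m : ℚ[X]) • lin b.hom z))) := by
        rw [map_smul, map_smul]
        exact (congrArg (fun u => (X ^ m : ℚ[X]) • u) h2).symm.trans h1.symm
      rw [← lin_hom_inv b ((X ^ m : ℚ[X]) • (X ^ m : ℚ[X]) • z), h3, lin_hom_inv]
    · have := subsingleton_of_isZero (h0 l hl hl')
      rw [Subsingleton.elim z 0]
      exact .zero

theorem IsContractible.isLeeAcyclic {K : CochainComplex GrMod ℤ} (hK : IsContractible K) :
    IsLeeAcyclic K := by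
  obtain ⟨H⟩ := hK
  rintro h z ⟨w, hz⟩
  have h1 := H.comm h
  rw [dNext_eq H.hom (show (ComplexShape.up ℤ).Rel h (h + 1) from rfl),
    prevD_eq H.hom (show (ComplexShape.up ℤ).Rel (h - 1) h from sub_add_cancel h 1)] at h1
  have h2 := congrArg (fun f => lin f z) h1
  have h3 : z = lin (H.hom (h + 1) h) (lin (K.d h (h + 1)) z) +
    lin (K.d (h - 1) h) (lin (H.hom h (h - 1)) z) + 0 := h2
  refine ⟨h - 1, lin (H.hom h (h - 1)) z, lin (H.hom (h + 1) h) w, ?_⟩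
  rw [← map_smul, ← hz]
  conv_lhs => rw [h3]
  abel

theorem eq_zero_of_mem_iSup_gr {a j : ℤ} (hj : j < a) {x : QX a}
    (hx : x ∈ ⨆ i : Set.Iic j, (QX a).gr i) : x = 0 := by
  have : (⨆ i : Set.Iic j, (QX a).gr i) ≤ ⊥ := iSup_le fun i p hp => by
    refine AddSubgroup.mem_bot.2 (Polynomial.ext (p := show ℚ[X] from p) (q := 0) fun n => ?_)
    by_contra hn
    have h1 := hp n hn
    have h2 : (i : ℤ) ≤ j := i.2
    omega
  exact AddSubgroup.mem_bot.1 (this hx)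

theorem lin_mem_iSup_gr {M N : GrMod} (f : M ⟶ N) {j : ℤ} {x : M}
    (hx : x ∈ ⨆ i : Set.Iic j, M.gr i) : lin f x ∈ ⨆ i : Set.Iic j, N.gr i := by
  have : (⨆ i : Set.Iic j, M.gr i) ≤
      (⨆ i : Set.Iic j, N.gr i).comap (lin f).toAddMonoidHom := iSup_le fun i x hx =>
    AddSubgroup.mem_iSup_of_mem (S := fun i : Set.Iic j => N.gr i) i (lin_mem f _ x hx)
  exact this hx

/-- Only the summand `ℚ[X]{a}` has cohomology modulo `X ^ 2 - 1`. It has no nonzero elements in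
filtration degrees below `a`, so classes represented there vanish; and its generator, of degree `a`,
survives. -/
theorem setOf_hasLeeClass {K : CochainComplex GrMod ℤ} {ι : Type*} [Fintype ι]
    {f : ι → CochainComplex GrMod ℤ} {a : ℤ}
    (hK : IsSum K (Sum.elim f (fun _ : Unit => oneTerm (QX a))))
    (hf : ∀ k, IsLeeAcyclic (f k)) : {j | HasLeeClass K j} = Set.Ici a := by
  obtain ⟨s, r, h1, -, h3⟩ := hK
  let σ : (HomologicalComplex.single GrMod (ComplexShape.up ℤ) 0).obj (QX a) ⟶ K := s (Sum.inr ())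
  let ρ : K ⟶ (HomologicalComplex.single GrMod (ComplexShape.up ℤ) 0).obj (QX a) := r (Sum.inr ())
  have hσρ : σ ≫ ρ = 𝟙 _ := h1 (Sum.inr ())
  ext j
  constructor
  · rintro ⟨h, z, hz, ⟨w, hw⟩, hz'⟩
    by_contra hj
    have hj : j < a := not_le.1 hj
    refine hz' ?_
    change IsLeeBoundary z
    rw [← sum_lin_apply h3 z]
    refine IsLeeBoundary.sum _ fun k _ => IsLeeBoundary.map (s k) ?_
    rcases k with k | k
    · refine hf k h _ ⟨lin ((r (Sum.inl k)).f (h + 1)) w, ?_⟩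
      exact (lin_f_d (r (Sum.inl k)) h (h + 1) z).symm.trans
        ((congrArg (lin ((r (Sum.inl k)).f (h + 1))) hw).trans (map_smul _ _ _))
    · have : lin (ρ.f h) z = 0 := by
        by_cases hh : h = 0
        · subst hh
          have h4 := eq_zero_of_mem_iSup_gr hj (lin_mem_iSup_gr (singleOut ρ) hz)
          have h5 := congrArg (lin (HomologicalComplex.singleObjXSelf (ComplexShape.up ℤ) 0
            (QX a)).inv) h4
          rw [map_zero] at h5
          rw [← h5]
          exact (lin_hom_inv _ _).symm
        · have := subsingleton_of_isZero
            (HomologicalComplex.isZero_single_obj_X (ComplexShape.up ℤ) 0 (QX a) h hh)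
          exact Subsingleton.elim _ _
      have h6 : IsLeeBoundary (lin (ρ.f h) z) := by rw [this]; exact .zero
      exact h6
  · intro (hj : a ≤ j)
    refine ⟨0, lin (singleIn σ) (one a), ?_, ⟨0, ?_⟩, ?_⟩
    · exact AddSubgroup.mem_iSup_of_mem (S := fun i : Set.Iic j => (K.X 0).gr i) ⟨a, hj⟩
        (lin_mem _ _ _ (one_mem_gr a))
    · rw [d_singleIn, smul_zero]
    · rintro ⟨h', y, w, hy⟩
      have h4 := congrArg (lin (singleOut ρ)) hy
      rw [singleOut_singleIn_self hσρ, map_add, singleOut_d, zero_add, map_smul] at h4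
      have h5 : (1 : ℚ[X]) = (X ^ 2 - 1) * (show ℚ[X] from lin (singleOut ρ) w) := h4
      -- `1` is not a multiple of `X ^ 2 - 1`, since the latter vanishes at `1`.
      have h6 := congrArg (Polynomial.eval 1) h5
      rw [eval_mul] at h6
      simp at h6

theorem IsStarDecomposition.isSum {K : CochainComplex GrMod ℤ} {a : ℤ} {r : ℕ} {h : Fin r → ℤ}
    {m : Fin r → ℕ} {i : Fin r → ℤ} {E : CochainComplex GrMod ℤ}
    (hK : IsStarDecomposition K a r h m i E) :
    IsSum K (Sum.elim (fun k => twoTerm (h k) (mulXPow (m k) (i k)))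
      (Sum.elim (fun _ : Unit => E) (fun _ : Unit => oneTerm (QX a)))) := by
  obtain ⟨e⟩ := hK.iso
  exact ((IsSum.biproduct _).biprod ((IsSum.unit E).biprod (IsSum.unit _))).of_iso e.symm

theorem IsStarDecomposition.sInf_hasLeeClass {K : CochainComplex GrMod ℤ} {a : ℤ} {r : ℕ}
    {h : Fin r → ℤ} {m : Fin r → ℕ} {i : Fin r → ℤ} {E : CochainComplex GrMod ℤ}
    (hK : IsStarDecomposition K a r h m i E) : sInf {j | HasLeeClass K j} = a := by
  rw [setOf_hasLeeClass (f := Sum.elim (fun k => twoTerm (h k) (mulXPow (m k) (i k)))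
    (fun _ : Unit => E)) (a := a) (hK.isSum.reindex (Equiv.sumAssoc _ _ _) ?_) ?_]
  · exact csInf_Ici
  · rintro ((k | k) | k) <;> exact ⟨Iso.refl _⟩
  · rintro (k | k)
    · exact isLeeAcyclic_twoTerm _ _ _
    · exact hK.contractible.isLeeAcyclic

end GrMod

/-! ### The decomposition of `C_t(D)` and the Rasmussen invariant -/

namespace GaussCode

variable {D : GaussCode}

theorem IsAlternating.exists_isStarDecomposition (hD : D.IsAlternating) (hG : D.IsGradedComplex) :
    ∃ (r : ℕ) (h : Fin r → ℤ) (m : Fin r → ℕ) (i : Fin r → ℤ) (E : CochainComplex GrMod ℤ),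
      GrMod.IsStarDecomposition (D.Ct hG) (-D.rasmussen hG - 1) r h m i E := by
  obtain ⟨S, hS⟩ := exists_finset_subsingleton_chain D
  have f1 : ∀ h, Module.Finite ℚ[X] ((D.Ct hG).X h) := fun h =>
    inferInstanceAs (Module.Finite ℚ[X] (D.chain h))
  have t1 : ∀ h, Module.IsTorsionFree ℚ[X] ((D.Ct hG).X h) := fun h =>
    inferInstanceAs (Module.IsTorsionFree ℚ[X] (D.chain h))
  obtain ⟨e, he, he', hrank⟩ := Ct_rank_one hD hG
  obtain ⟨a, r, h, m, i, E, hE⟩ := GrMod.exists_isStarDecomposition (K := D.Ct hG) S hS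
    (fun h h0 z hz => by
      obtain ⟨p, hp, y, hy⟩ := Ct_torsion hD hG (h' := h - 1) (sub_add_cancel h 1) h0 z hz
      exact ⟨p, hp, h - 1, y, hy⟩) he
    (fun hte => by
      obtain ⟨p, hp, y, hy⟩ := hte.exists_eq (-1) rfl
      exact he' p hp y hy)
    (fun z hz => by
      obtain ⟨p, q, hp, y, hy⟩ := hrank z hz
      exact ⟨p, q, hp, -1, y, hy⟩)
  refine ⟨r, h, m, i, E, ?_⟩
  -- The shift `a` is the least filtration degree of a nonzero Lee class, whatever decomposition was
  -- found.
  have : -D.rasmussen hG - 1 = a := by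
    rw [rasmussen, hE.sInf_hasLeeClass]; ring
  rwa [this]

end GaussCode

namespace GrMod

/-! ### Reduction modulo a power of `X` -/

theorem iso_map_twoTerm (F : GrMod ⥤ GrMod) [F.Additive] {M N : GrMod} (h : ℤ) (f : M ⟶ N) :
    Nonempty (twoTerm h (F.map f) ≅
      (F.mapHomologicalComplex (ComplexShape.up ℤ)).obj (twoTerm h f)) := by
  obtain ⟨a, b, hd, h0⟩ := twoTerm_data h f
  refine iso_twoTerm (K := (F.mapHomologicalComplex (ComplexShape.up ℤ)).obj (twoTerm h f))
    (F.mapIso a.symm) (F.mapIso b.symm) ?_ fun k hk hk' => F.map_isZero (h0 k hk hk')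
  change F.map a.inv ≫ F.map ((twoTerm h f).d h (h + 1)) = F.map f ≫ F.map b.inv
  rw [hd, ← F.map_comp, ← F.map_comp, Iso.inv_hom_id_assoc]

theorem iso_map_oneTerm (F : GrMod ⥤ GrMod) [F.Additive] (M : GrMod) :
    Nonempty (oneTerm (F.obj M) ≅
      (F.mapHomologicalComplex (ComplexShape.up ℤ)).obj (oneTerm M)) :=
  ⟨((HomologicalComplex.singleMapHomologicalComplex F (ComplexShape.up ℤ) 0).app M).symm⟩

theorem IsContractible.map (F : GrMod ⥤ GrMod) [F.Additive] {E : CochainComplex GrMod ℤ}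
    (hE : IsContractible E) :
    IsContractible ((F.mapHomologicalComplex (ComplexShape.up ℤ)).obj E) := by
  obtain ⟨H⟩ := hE
  exact ⟨(Homotopy.ofEq (by simp)).trans ((F.mapHomotopy H).trans (Homotopy.ofEq (by simp)))⟩

theorem map_mulXPow_eq_zero {k m : ℕ} (hkm : k ≤ m) (i : ℤ) :
    (modXPow k).map (mulXPow m i) = 0 := by
  refine hom_ext' (LinearMap.ext fun x => ?_)
  obtain ⟨p, rfl⟩ := Submodule.mkQ_surjective _ x
  refine (Submodule.Quotient.mk_eq_zero _).2 ⟨(X ^ (m - k) * (show ℚ[X] from p) : ℚ[X]), ?_⟩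
  change (X ^ k * (X ^ (m - k) * (show ℚ[X] from p)) : ℚ[X]) = X ^ m * (show ℚ[X] from p)
  rw [← mul_assoc, ← pow_add, Nat.add_sub_cancel' hkm]

theorem iso_twoTerm_mulXA (h : ℤ) {m : ℕ} (hm : m = 1) (i : ℤ) :
    Nonempty (twoTerm h (mulXA i) ≅ twoTerm h ((modXPow 2).map (mulXPow m i))) := by
  subst hm
  -- The degree `2 * m + i` for `m = 1` contains a cast and is not `2 + i` by definition, so the
  -- degree of the source is generalized.
  have key : ∀ (j : ℤ) (hj : j = 2 + i) (f : QX j ⟶ QX i)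
      (_ : ∀ p : ℚ[X], lin f p = (X * p : ℚ[X])),
      Nonempty (twoTerm h (mulXA i) ≅ twoTerm h ((modXPow 2).map f)) := by
    rintro _ rfl f hf
    refine ⟨eqToIso (congrArg (fun g => twoTerm h ((modXPow 2).map g)) ?_)⟩
    exact hom_ext' (LinearMap.ext fun p => (hf p).symm)
  refine key _ (by simp) _ fun p => ?_
  change (X ^ 1 * p : ℚ[X]) = X * p
  rw [pow_one]

theorem IsStarDecomposition.isSum_map {K : CochainComplex GrMod ℤ} {a : ℤ} {r : ℕ} {h : Fin r → ℤ}
    {m : Fin r → ℕ} {i : Fin r → ℤ} {E : CochainComplex GrMod ℤ}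
    (hK : IsStarDecomposition K a r h m i E) (F : GrMod ⥤ GrMod) [F.Additive] :
    IsSum ((F.mapHomologicalComplex (ComplexShape.up ℤ)).obj K)
      (Sum.elim (fun k => twoTerm (h k) (F.map (mulXPow (m k) (i k))))
        (Sum.elim (fun _ : Unit => (F.mapHomologicalComplex (ComplexShape.up ℤ)).obj E)
          (fun _ : Unit => oneTerm (F.obj (QX a))))) := by
  refine (hK.isSum.map (F.mapHomologicalComplex (ComplexShape.up ℤ))).reindex (Equiv.refl _) ?_
  rintro (k | k | k)
  · exact iso_map_twoTerm F _ _
  · exact ⟨Iso.refl _⟩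
  · exact iso_map_oneTerm F _

theorem IsStarDecomposition.exists_iso_modXPow_two {K : CochainComplex GrMod ℤ} {a : ℤ} {r : ℕ}
    {h : Fin r → ℤ} {m : Fin r → ℕ} {i : Fin r → ℤ} {E : CochainComplex GrMod ℤ}
    (hK : IsStarDecomposition K a r h m i E) :
    ∃ E' : CochainComplex GrMod ℤ, IsContractible E' ∧
      Nonempty (modXPowComplex 2 K ≅
        (⨁ fun k : {k : Fin r // 1 < m k} =>
          twoTerm (h k) (0 : A (2 * m k + i k) ⟶ A (i k))) ⊞
        ((⨁ fun k : {k : Fin r // m k = 1} => twoTerm (h k) (mulXA (i k))) ⊞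
        (oneTerm (A a) ⊞ E'))) := by
  classical
  refine ⟨_, hK.contractible.map (modXPow 2), ?_⟩
  have h2 := (IsSum.biproduct fun k : {k : Fin r // 1 < m k} =>
      twoTerm (h k) (0 : A (2 * m k + i k) ⟶ A (i k))).biprod
    ((IsSum.biproduct fun k : {k : Fin r // m k = 1} => twoTerm (h k) (mulXA (i k))).biprod
    ((IsSum.unit (oneTerm (A a))).biprod
      (IsSum.unit (((modXPow 2).mapHomologicalComplex (ComplexShape.up ℤ)).obj E))))
  refine ((hK.isSum_map (modXPow 2)).reindex ((Equiv.sumAssoc _ _ _).symm.trans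
    (Equiv.sumCongr ((Equiv.sumCongr (Equiv.refl _) (Equiv.subtypeEquivRight fun k => ?_)).trans
      (Equiv.sumCompl fun k => 1 < m k)) (Equiv.sumComm _ _))) ?_).iso h2
  · have := hK.pos k
    omega
  · rintro (k | k | k | k)
    · refine ⟨eqToIso (congrArg (twoTerm (h k)) ?_)⟩
      exact (map_mulXPow_eq_zero k.2 (i k)).symm
    · exact iso_twoTerm_mulXA _ k.2 _
    · exact ⟨Iso.refl _⟩
    · exact ⟨Iso.refl _⟩

end GrMod

/-! ### Dimensions over `ℚ` -/

/-- The `ℚ`-vector space that underlies a `ℚ[X]`-module. -/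
@[reducible]
def ratModule (M : Type*) [AddCommGroup M] [Module ℚ[X] M] : Module ℚ M :=
  Module.compHom M (algebraMap ℚ ℚ[X])

section rat

attribute [local instance] ratModule

section restrict

variable {M N K : Type*} [AddCommGroup M] [Module ℚ[X] M] [AddCommGroup N] [Module ℚ[X] N]
  [AddCommGroup K] [Module ℚ[X] K]

/-- A `ℚ[X]`-linear map, as a `ℚ`-linear map. -/
def LinearMap.toRat (f : M →ₗ[ℚ[X]] N) : M →ₗ[ℚ] N where
  toFun := f
  map_add' := f.map_add
  map_smul' c x := f.map_smul (algebraMap ℚ ℚ[X] c) x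

/-- A `ℚ[X]`-linear equivalence, as a `ℚ`-linear equivalence. -/
def LinearEquiv.toRat (e : M ≃ₗ[ℚ[X]] N) :
    M ≃ₗ[ℚ] N :=
  { e.toLinearMap.toRat with
    invFun := e.symm
    left_inv := e.left_inv
    right_inv := e.right_inv }

/-- The dimension over `ℚ` of a `ℚ[X]`-module. -/
def ratDim (M : Type*) [AddCommGroup M] [Module ℚ[X] M] : ℕ :=
  Module.finrank ℚ M

theorem LinearEquiv.ratDim_eq (e : M ≃ₗ[ℚ[X]] N) : ratDim M = ratDim N := e.toRat.finrank_eq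

theorem ratDim_eq_zero [Subsingleton M] : ratDim M = 0 :=
  Module.finrank_zero_of_subsingleton

theorem ratDim_of_exact [Module.Finite ℚ M] (f : N →ₗ[ℚ[X]] M)
    (g : M →ₗ[ℚ[X]] K) (hf : Function.Injective f) (hg : Function.Surjective g)
    (hfg : ∀ x, g x = 0 ↔ ∃ y, f y = x) : ratDim M = ratDim N + ratDim K := by
  have h1 := LinearMap.finrank_range_add_finrank_ker g.toRat
  have h2 : LinearMap.ker g.toRat = LinearMap.range f.toRat := by
    ext x; exact hfg x
  have h3 : LinearMap.range g.toRat = ⊤ := LinearMap.range_eq_top.2 hg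
  rw [h2, h3, finrank_top, LinearMap.finrank_range_of_inj (show Function.Injective f.toRat from hf)]
    at h1
  rw [ratDim, ratDim, ratDim, ← h1, add_comm]

theorem ratDim_ker_add_range [Module.Finite ℚ M] (f : M →ₗ[ℚ[X]] N) :
    ratDim M = ratDim (LinearMap.ker f) + ratDim (LinearMap.range f) :=
  ratDim_of_exact (LinearMap.ker f).subtype f.rangeRestrict Subtype.val_injective
    f.surjective_rangeRestrict fun x =>
      ⟨fun h => ⟨⟨x, congrArg Subtype.val h⟩, rfl⟩, fun ⟨y, hy⟩ => Subtype.ext (hy ▸ y.2)⟩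

theorem ratDim_range_add_quotient [Module.Finite ℚ M]
    (S : Submodule ℚ[X] M) : ratDim M = ratDim S + ratDim (M ⧸ S) :=
  ratDim_of_exact S.subtype S.mkQ Subtype.val_injective S.mkQ_surjective fun x => by
    rw [Submodule.mkQ_apply, Submodule.Quotient.mk_eq_zero]
    exact ⟨fun h => ⟨⟨x, h⟩, rfl⟩, fun ⟨y, hy⟩ => hy ▸ y.2⟩

theorem finite_rat_of_surjective [Module.Finite ℚ M] (f : M →ₗ[ℚ[X]] N)
    (hf : Function.Surjective f) : Module.Finite ℚ N :=
  Module.Finite.of_surjective f.toRat hf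

theorem finite_rat_of_injective [Module.Finite ℚ N] (f : M →ₗ[ℚ[X]] N)
    (hf : Function.Injective f) : Module.Finite ℚ M :=
  Module.Finite.of_injective f.toRat hf

end restrict

theorem DirectSum.exists_linearEquiv_of_subsingleton {ι : Type*} [DecidableEq ι] {M : ι → Type*}
    [∀ k, AddCommGroup (M k)] [∀ k, Module ℚ (M k)] (s : Finset ι)
    (hs : ∀ k ∉ s, Subsingleton (M k)) : Nonempty ((DirectSum ι M) ≃ₗ[ℚ] ∀ k : s, M k) := by
  let f : (DirectSum ι M) →ₗ[ℚ] ∀ k : s, M k :=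
    LinearMap.pi fun k => DirectSum.component ℚ ι M k
  refine ⟨LinearEquiv.ofBijective f ⟨fun x y hxy => ?_, fun y => ⟨DFinsupp.mk s y, ?_⟩⟩⟩
  · refine DFinsupp.ext fun k => ?_
    by_cases hk : k ∈ s
    · exact congrFun hxy ⟨k, hk⟩
    · have := hs k hk
      exact Subsingleton.elim _ _
  · funext k
    exact DFinsupp.mk_of_mem k.2

namespace GrMod

/-! ### Total cohomology -/

/-- Total cohomology, with its structure of a vector space over `ℚ`. -/
abbrev RatTotalHomology (K : CochainComplex GrMod ℤ) : Type :=
  DirectSum ℤ fun h => (forgetComplex K).homology h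

/-- The structures over `ℚ` from `RestrictScalars` and from `ratModule` agree by definition; the
latter lets linear maps over `ℚ[X]` be reused without transport. -/
theorem linearEquiv_totalHomology (K : CochainComplex GrMod ℤ) :
    Nonempty (TotalHomology K ≃ₗ[ℚ] RatTotalHomology K) :=
  ⟨LinearEquiv.refl ℚ (RatTotalHomology K)⟩

/-- Total cohomology as a functor. -/
def totalHomology : CochainComplex GrMod ℤ ⥤ ModuleCat.{0} ℚ where
  obj K := ModuleCat.of ℚ (RatTotalHomology K)
  map {K L} φ := ModuleCat.ofHom (DirectSum.lmap fun h =>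
    (HomologicalComplex.homologyMap ((forgetGr.mapHomologicalComplex _).map φ) h).hom.toRat)
  map_id K := by
    refine ModuleCat.hom_ext (LinearMap.ext fun x => DFinsupp.ext fun h => ?_)
    have : HomologicalComplex.homologyMap
        ((forgetGr.mapHomologicalComplex (ComplexShape.up ℤ)).map (𝟙 K)) h = 𝟙 _ := by
      rw [CategoryTheory.Functor.map_id, HomologicalComplex.homologyMap_id]
    exact congrArg (fun f => f.hom (x h)) this
  map_comp {K L N} φ ψ := by
    refine ModuleCat.hom_ext (LinearMap.ext fun x => DFinsupp.ext fun h => ?_)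
    have := HomologicalComplex.homologyMap_comp
      ((forgetGr.mapHomologicalComplex (ComplexShape.up ℤ)).map φ)
      ((forgetGr.mapHomologicalComplex (ComplexShape.up ℤ)).map ψ) h
    rw [← Functor.map_comp] at this
    exact congrArg (fun f => f.hom (x h)) this

instance : totalHomology.Additive where
  map_add {K L φ ψ} := by
    refine ModuleCat.hom_ext (LinearMap.ext fun (x : RatTotalHomology K) => ?_)
    refine DFinsupp.ext (β := fun h => (forgetComplex L).homology h) fun h => ?_
    have := HomologicalComplex.homologyMap_add
      ((forgetGr.mapHomologicalComplex (ComplexShape.up ℤ)).map φ)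
      ((forgetGr.mapHomologicalComplex (ComplexShape.up ℤ)).map ψ) h
    rw [← Functor.map_add] at this
    exact congrArg (fun f => f.hom (x h)) this

theorem _root_.CategoryTheory.IsSum.linearEquiv {R : Type*} [Ring R] {M : ModuleCat.{0} R}
    {ι : Type*} [Fintype ι] {f : ι → ModuleCat.{0} R} (hM : IsSum M f) : Nonempty (M ≃ₗ[R] ∀ k, f k) := by
  classical
  obtain ⟨i, p, h1, h2, h3⟩ := hM
  refine ⟨LinearEquiv.ofLinearMap (LinearMap.pi fun k => (p k).hom)
    (∑ k, (i k).hom ∘ₗ LinearMap.proj k) ?_ ?_⟩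
  · refine LinearMap.ext fun x => funext fun k => ?_
    have h4 : ∀ l, (p k).hom ((i l).hom (x l)) = if h : l = k then h ▸ x l else 0 := fun l => by
      by_cases h : l = k
      · subst h
        rw [dif_pos rfl]
        exact congrArg (fun g => g.hom (x l)) (h1 l)
      · rw [dif_neg h]
        exact congrArg (fun g => g.hom (x l)) (h2 l k h)
    simp only [LinearMap.comp_apply, LinearMap.pi_apply, LinearMap.sum_apply, map_sum,
      LinearMap.proj_apply, h4, LinearMap.id_apply]
    rw [Finset.sum_eq_single k]
    · simp
    · intro l _ hl
      rw [dif_neg hl]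
    · intro h; exact absurd (Finset.mem_univ k) h
  · refine LinearMap.ext fun x => ?_
    have := congrArg (fun g => g.hom x) h3
    simp only [ModuleCat.hom_sum, LinearMap.sum_apply] at this
    simpa using this

theorem totalHomology_isSum {K : CochainComplex GrMod ℤ} {ι : Type*} [Fintype ι]
    {f : ι → CochainComplex GrMod ℤ} (hK : IsSum K f)
    (hf : ∀ k, Module.Finite ℚ (RatTotalHomology (f k))) :
    Module.Finite ℚ (RatTotalHomology K) ∧ Module.finrank ℚ (RatTotalHomology K) =
      ∑ k, Module.finrank ℚ (RatTotalHomology (f k)) := by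
  obtain ⟨e⟩ := (hK.map totalHomology).linearEquiv
  have e' : RatTotalHomology K ≃ₗ[ℚ] ∀ k, RatTotalHomology (f k) := e
  exact ⟨Module.Finite.equiv e'.symm, by rw [e'.finrank_eq, Module.finrank_pi_fintype]⟩

theorem subsingleton_totalHomology {K : CochainComplex GrMod ℤ} (hK : IsContractible K) :
    Subsingleton (RatTotalHomology K) := by
  obtain ⟨H⟩ := hK
  have : ∀ h, Subsingleton ((forgetComplex K).homology h) := fun h => by
    have h1 := (forgetGr.mapHomotopy H).homologyMap_eq h
    rw [CategoryTheory.Functor.map_id, HomologicalComplex.homologyMap_id, Functor.map_zero,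
      HomologicalComplex.homologyMap_zero] at h1
    exact subsingleton_of_forall_eq 0 fun x => congrArg (fun g => g.hom x) h1
  exact ⟨fun x y => DFinsupp.ext fun h => Subsingleton.elim _ _⟩

theorem linearEquiv_homology_ker (L : CochainComplex (ModuleCat.{0} ℚ[X]) ℤ) (h : ℤ)
    (hd : L.d (h - 1) h = 0) :
    Nonempty (L.homology h ≃ₗ[ℚ[X]] LinearMap.ker (L.d h (h + 1)).hom) := by
  have e1 := L.isoHomologyπ (h - 1) h (by simp) hd
  have e2 := (L.sc h).moduleCatCyclesIso
  have e3 : LinearMap.ker (L.sc h).g.hom = LinearMap.ker (L.d h (h + 1)).hom := by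
    have : (ComplexShape.up ℤ).next h = h + 1 := by simp
    change LinearMap.ker (L.d h ((ComplexShape.up ℤ).next h)).hom = _
    rw [this]
  exact ⟨(e1.symm ≪≫ e2).toLinearEquiv.trans (LinearEquiv.ofEq _ _ e3)⟩

theorem linearEquiv_homology_quotient (L : CochainComplex (ModuleCat.{0} ℚ[X]) ℤ) (h : ℤ)
    (hd : L.d (h + 1) (h + 1 + 1) = 0) :
    Nonempty (L.homology (h + 1) ≃ₗ[ℚ[X]]
      (L.X (h + 1) ⧸ LinearMap.range (L.d h (h + 1)).hom)) := by
  have e1 := L.isoHomologyι (h + 1) (h + 1 + 1) (by simp) hd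
  have e2 := (L.sc (h + 1)).moduleCatOpcyclesIso
  have e3 : LinearMap.range (L.sc (h + 1)).f.hom = LinearMap.range (L.d h (h + 1)).hom := by
    have : (ComplexShape.up ℤ).prev (h + 1) = h := by simp
    change LinearMap.range (L.d ((ComplexShape.up ℤ).prev (h + 1)) (h + 1)).hom = _
    rw [this]
  exact ⟨(e1 ≪≫ e2).toLinearEquiv.trans (Submodule.quotEquivOfEq _ _ e3)⟩

/-- The cohomology consists of the kernel and the cokernel of `f`, so the rank of `f` is lost twice.
The equation is additive to avoid subtraction in `ℕ`. -/
theorem ratDim_twoTerm {M N : GrMod} (h : ℤ) (f : M ⟶ N) [Module.Finite ℚ M] [Module.Finite ℚ N] :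
    Module.Finite ℚ (RatTotalHomology (twoTerm h f)) ∧
      Module.finrank ℚ (RatTotalHomology (twoTerm h f)) + 2 * ratDim (LinearMap.range (lin f)) =
        ratDim M + ratDim N := by
  have hT := twoTerm_data h f
  generalize twoTerm h f = T at hT ⊢
  obtain ⟨a, b, hd, h0⟩ := hT
  let L := forgetComplex T
  have a' : M ≃ₗ[ℚ[X]] T.X h := (linearEquiv_of_iso a).some.symm
  have b' : N ≃ₗ[ℚ[X]] T.X (h + 1) := (linearEquiv_of_iso b).some.symm
  have fM : Module.Finite ℚ (T.X h) := Module.Finite.equiv a'.toRat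
  have fN : Module.Finite ℚ (T.X (h + 1)) := Module.Finite.equiv b'.toRat
  have hz : ∀ k, k ≠ h → k ≠ h + 1 → Subsingleton (L.homology k) := fun k hk hk' => by
    have h1 : IsZero (L.X k) := forgetGr.map_isZero (h0 k hk hk')
    exact ModuleCat.subsingleton_of_isZero ((HomologicalComplex.exactAt_iff_isZero_homology _ _).1
      (HomologicalComplex.ExactAt.of_isZero h1))
  have hd0 : L.d (h - 1) h = 0 :=
    (forgetGr.map_isZero (h0 (h - 1) (by omega) (by omega)) : IsZero (L.X (h - 1))).eq_of_src _ _
  have hd1 : L.d (h + 1) (h + 1 + 1) = 0 :=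
    (forgetGr.map_isZero (h0 (h + 1 + 1) (by omega) (by omega)) :
      IsZero (L.X (h + 1 + 1))).eq_of_tgt _ _
  obtain ⟨e0⟩ := linearEquiv_homology_ker L h hd0
  obtain ⟨e1⟩ := linearEquiv_homology_quotient L h hd1
  have e0' : L.homology h ≃ₗ[ℚ[X]] LinearMap.ker (lin (T.d h (h + 1))) := e0
  have e1' : L.homology (h + 1) ≃ₗ[ℚ[X]]
    (T.X (h + 1) ⧸ LinearMap.range (lin (T.d h (h + 1)))) := e1
  have r1 := ratDim_ker_add_range (lin (T.d h (h + 1)))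
  have r2 := ratDim_range_add_quotient (LinearMap.range (lin (T.d h (h + 1))))
  have f0 : Module.Finite ℚ (L.homology h) :=
    finite_rat_of_injective ((LinearMap.ker _).subtype ∘ₗ e0'.toLinearMap)
      (Subtype.val_injective.comp e0'.injective)
  have f1 : Module.Finite ℚ (L.homology (h + 1)) :=
    finite_rat_of_surjective (e1'.symm.toLinearMap ∘ₗ Submodule.mkQ _)
      (e1'.symm.surjective.comp (Submodule.mkQ_surjective _))
  rw [← e0'.ratDim_eq, ← a'.ratDim_eq] at r1
  rw [← e1'.ratDim_eq, ← b'.ratDim_eq] at r2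
  have hr : ratDim (LinearMap.range (lin f)) = ratDim (LinearMap.range (lin (T.d h (h + 1)))) := by
    have e : LinearMap.range (lin (T.d h (h + 1))) =
        (LinearMap.range (lin f)).map (lin b.inv) := by
      rw [hd, lin_comp, lin_comp, LinearMap.range_comp_of_range_eq_top, LinearMap.range_comp]
      exact LinearMap.range_eq_top.2 fun x => ⟨lin a.inv x, lin_inv_hom a x⟩
    rw [e]
    exact (Submodule.equivMapOfInjective (lin b.inv)
      (Function.LeftInverse.injective (lin_inv_hom b)) _).ratDim_eq
  obtain ⟨e⟩ := DirectSum.exists_linearEquiv_of_subsingleton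
    (M := fun k => L.homology k) {h, h + 1} fun k hk => by
      simp only [Finset.mem_insert, Finset.mem_singleton, not_or] at hk
      exact hz k hk.1 hk.2
  have hfin : ∀ k : ({h, h + 1} : Finset ℤ), Module.Finite ℚ (L.homology k) := by
    rintro ⟨k, hk⟩
    simp only [Finset.mem_insert, Finset.mem_singleton] at hk
    rcases hk with rfl | rfl
    · exact f0
    · exact f1
  have hsum : Module.finrank ℚ (RatTotalHomology T) =
      ratDim (L.homology h) + ratDim (L.homology (h + 1)) := by
    rw [LinearEquiv.finrank_eq e, Module.finrank_pi_fintype]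
    rw [Finset.univ_eq_attach,
      Finset.sum_attach {h, h + 1} fun k => Module.finrank ℚ (L.homology k)]
    exact Finset.sum_pair (by omega)
  exact ⟨Module.Finite.equiv e.symm, by rw [hsum, hr]; omega⟩

end GrMod

end rat

namespace GrMod

/-! ### Dimensions of the cohomology of the summands -/

/-- The class of a polynomial in `A`. -/
def mkA (i : ℤ) : ℚ[X] →ₗ[ℚ[X]] A i :=
  show QX i →ₗ[ℚ[X]] A i from (XPowRange 2 (QX i)).mkQ

theorem mkA_surjective (i : ℤ) : Function.Surjective (mkA i) := Submodule.mkQ_surjective _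

theorem mkA_eq_zero {i : ℤ} {p : ℚ[X]} : mkA i p = 0 ↔ X ^ 2 ∣ p :=
  (Submodule.Quotient.mk_eq_zero _).trans
    ⟨fun ⟨q, hq⟩ => ⟨q, hq.symm⟩, fun ⟨q, hq⟩ => ⟨q, hq.symm⟩⟩

theorem X_sq_dvd_iff {p : ℚ[X]} : X ^ 2 ∣ p ↔ p.coeff 0 = 0 ∧ p.coeff 1 = 0 := by
  rw [X_pow_dvd_iff]
  constructor
  · exact fun h => ⟨h 0 (by norm_num), h 1 (by norm_num)⟩
  · rintro ⟨h0, h1⟩ d hd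
    interval_cases d
    · exact h0
    · exact h1

/-- The class of a polynomial in `A / X A`. -/
def mkB (i : ℤ) : ℚ[X] →ₗ[ℚ[X]] (modXPow 1).obj (A i) := (XPowRange 1 (A i)).mkQ ∘ₗ mkA i

theorem mkB_surjective (i : ℤ) : Function.Surjective (mkB i) :=
  (Submodule.mkQ_surjective _).comp (mkA_surjective i)

theorem mkB_eq_zero {i : ℤ} {p : ℚ[X]} : mkB i p = 0 ↔ X ∣ p := by
  refine (Submodule.Quotient.mk_eq_zero _).trans ⟨?_, ?_⟩
  · rintro ⟨q, hq⟩
    obtain ⟨q, rfl⟩ := mkA_surjective i q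
    have h1 : mkA i (X ^ 1 * q) = mkA i p := hq
    rw [← sub_eq_zero, ← map_sub, mkA_eq_zero] at h1
    have h2 : X ∣ X ^ 1 * q - p := (dvd_pow_self X two_ne_zero).trans h1
    have h3 : X ∣ X ^ 1 * q := by rw [pow_one]; exact dvd_mul_right _ _
    simpa using dvd_sub h3 h2
  · rintro ⟨q, rfl⟩
    exact ⟨mkA i q, congrArg (fun p : ℚ[X] => p • mkA i q) (pow_one X)⟩

section rat

attribute [local instance] ratModule

theorem finite_A (i : ℤ) : Module.Finite ℚ (A i) ∧ ratDim (A i) = 2 := by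
  let f : ℚ × ℚ →ₗ[ℚ] A i := (LinearMap.toSpanSingleton ℚ (A i) (mkA i 1)).coprod
    (LinearMap.toSpanSingleton ℚ (A i) (mkA i X))
  have hf : ∀ c, f c = mkA i (C c.1 + C c.2 * X) := fun c => by
    have : f c = (C c.1 : ℚ[X]) • mkA i 1 + (C c.2 : ℚ[X]) • mkA i X := rfl
    rw [this, ← map_smul, ← map_smul, ← map_add, smul_eq_mul, smul_eq_mul, mul_one]
  have hinj : Function.Injective f := by
    rw [injective_iff_map_eq_zero]
    rintro ⟨c, d⟩ h
    rw [hf, mkA_eq_zero, X_sq_dvd_iff] at h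
    simpa [coeff_C] using h
  have hsurj : Function.Surjective f := fun x => by
    obtain ⟨p, rfl⟩ := mkA_surjective i x
    refine ⟨(p.coeff 0, p.coeff 1), ?_⟩
    rw [hf, ← sub_eq_zero, ← map_sub, mkA_eq_zero, X_sq_dvd_iff]
    simp [coeff_C]
  let e := LinearEquiv.ofBijective f ⟨hinj, hsurj⟩
  refine ⟨Module.Finite.equiv e, ?_⟩
  rw [ratDim, ← e.finrank_eq, Module.finrank_prod, Module.finrank_self]

theorem finite_B (i : ℤ) :
    Module.Finite ℚ ((modXPow 1).obj (A i)) ∧ ratDim ((modXPow 1).obj (A i)) = 1 := by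
  have := (finite_A i).1
  refine ⟨finite_rat_of_surjective (XPowRange 1 (A i)).mkQ (Submodule.mkQ_surjective _), ?_⟩
  refine finrank_eq_one (mkB i 1) (fun h => ?_) fun x => ?_
  · rw [mkB_eq_zero] at h
    exact not_isUnit_X (isUnit_of_dvd_one h)
  · obtain ⟨p, rfl⟩ := mkB_surjective i x
    refine ⟨p.coeff 0, ?_⟩
    change (C (p.coeff 0) : ℚ[X]) • mkB i 1 = mkB i p
    rw [← map_smul, ← sub_eq_zero, ← map_sub, mkB_eq_zero, X_dvd_iff]
    simp

theorem ratDim_range_zero {M N : GrMod} : ratDim (LinearMap.range (lin (0 : M ⟶ N))) = 0 := by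
  rw [lin_zero, LinearMap.range_zero]
  exact ratDim_eq_zero

theorem ratDim_range_mulXPow_one (i : ℤ) :
    ratDim (LinearMap.range (lin ((modXPow 2).map (mulXPow 1 i)))) = 1 := by
  have hX : ∀ p : ℚ[X], lin ((modXPow 2).map (mulXPow 1 i)) (mkA _ p) = mkA i (X * p) := fun p => by
    rw [← pow_one X]; rfl
  refine finrank_eq_one (⟨mkA i (X * 1), ⟨_, hX 1⟩⟩ :
    LinearMap.range (lin ((modXPow 2).map (mulXPow 1 i)))) (fun h => ?_) ?_
  · have h1 := congrArg Subtype.val h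
    have h2 : mkA i (X * 1) = 0 := h1
    rw [mkA_eq_zero, X_sq_dvd_iff] at h2
    simp at h2
  · rintro ⟨_, x, rfl⟩
    obtain ⟨p, rfl⟩ := mkA_surjective _ x
    refine ⟨p.coeff 0, Subtype.ext ?_⟩
    change (C (p.coeff 0) : ℚ[X]) • mkA i (X * 1) = lin ((modXPow 2).map (mulXPow 1 i)) (mkA _ p)
    rw [hX, ← map_smul, ← sub_eq_zero, ← map_sub, mkA_eq_zero, X_sq_dvd_iff]
    simp

/-- A one-term complex is a two-term complex with zero target, so the previous count applies. -/
theorem ratDim_oneTerm (M : GrMod) [Module.Finite ℚ M] :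
    Module.Finite ℚ (RatTotalHomology (oneTerm M)) ∧
      Module.finrank ℚ (RatTotalHomology (oneTerm M)) = ratDim M := by
  have hZ : IsZero ((oneTerm M).X (0 + 1)) :=
    HomologicalComplex.isZero_single_obj_X (ComplexShape.up ℤ) 0 M _ (by norm_num)
  have : Subsingleton ((oneTerm M).X (0 + 1)) := subsingleton_of_isZero hZ
  obtain ⟨e⟩ := iso_twoTerm (K := oneTerm M) (h := 0) (f := (0 : M ⟶ (oneTerm M).X (0 + 1)))
    (HomologicalComplex.singleObjXSelf (ComplexShape.up ℤ) 0 M).symm (Iso.refl _)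
    (hZ.eq_of_tgt _ _) fun k hk _ =>
      HomologicalComplex.isZero_single_obj_X (ComplexShape.up ℤ) 0 M _ hk
  obtain ⟨h1, h2⟩ := ratDim_twoTerm 0 (0 : M ⟶ (oneTerm M).X (0 + 1))
  rw [ratDim_range_zero, ratDim_eq_zero (M := (oneTerm M).X (0 + 1))] at h2
  have e' : RatTotalHomology (twoTerm 0 (0 : M ⟶ (oneTerm M).X (0 + 1))) ≃ₗ[ℚ]
    RatTotalHomology (oneTerm M) := (totalHomology.mapIso e).toLinearEquiv
  exact ⟨Module.Finite.equiv e', by rw [← e'.finrank_eq]; exact h2⟩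

theorem map_map_mulXPow_eq_zero {m : ℕ} (hm : 0 < m) (i : ℤ) :
    (modXPow 2 ⋙ modXPow 1).map (mulXPow m i) = 0 := by
  refine hom_ext' (LinearMap.ext fun x => ?_)
  obtain ⟨p, rfl⟩ := mkB_surjective _ x
  have : mkB i (X ^ m * p) = 0 := mkB_eq_zero.2 ((dvd_pow_self X hm.ne').mul_right p)
  exact this

/-- Stated for an additive functor `F` so as to serve both for reduction modulo `X ^ 2` and for the
further reduction modulo `X`. The number `n k` is the contribution of the `k`-th two-term summand,
which `hn` determines. -/
theorem IsStarDecomposition.finrank_map {K : CochainComplex GrMod ℤ} {a : ℤ} {r : ℕ}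
    {h : Fin r → ℤ} {m : Fin r → ℕ} {i : Fin r → ℤ} {E : CochainComplex GrMod ℤ}
    (hK : IsStarDecomposition K a r h m i E) (F : GrMod ⥤ GrMod) [F.Additive] (n : Fin r → ℕ)
    (hF : ∀ j, Module.Finite ℚ (F.obj (QX j)))
    (hn : ∀ k, n k + 2 * ratDim (LinearMap.range (lin (F.map (mulXPow (m k) (i k))))) =
      ratDim (F.obj (QX (2 * m k + i k))) + ratDim (F.obj (QX (i k)))) :
    Module.Finite ℚ (TotalHomology ((F.mapHomologicalComplex (ComplexShape.up ℤ)).obj K)) ∧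
    Module.finrank ℚ (TotalHomology ((F.mapHomologicalComplex (ComplexShape.up ℤ)).obj K)) =
      ∑ k, n k + ratDim (F.obj (QX a)) := by
  have hE := subsingleton_totalHomology (hK.contractible.map F)
  obtain ⟨e⟩ := linearEquiv_totalHomology ((F.mapHomologicalComplex (ComplexShape.up ℤ)).obj K)
  have h1 := fun k => ratDim_twoTerm (h k) (F.map (mulXPow (m k) (i k)))
  have h2 := ratDim_oneTerm (F.obj (QX a))
  obtain ⟨h3, h4⟩ := totalHomology_isSum (hK.isSum_map F) (by
    rintro (k | k | k)
    · exact (h1 k).1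
    · change Module.Finite ℚ (RatTotalHomology ((F.mapHomologicalComplex _).obj E))
      infer_instance
    · exact h2.1)
  refine ⟨Module.Finite.equiv e.symm, ?_⟩
  rw [e.finrank_eq, h4, Fintype.sum_sum_type, Fintype.sum_sum_type]
  congr 1
  · refine Finset.sum_congr rfl fun k _ => ?_
    have h5 := (h1 k).2
    rw [← hn k] at h5
    exact Nat.add_right_cancel h5
  · have h6 : Module.finrank ℚ
        (RatTotalHomology ((F.mapHomologicalComplex (ComplexShape.up ℤ)).obj E)) = 0 :=
      Module.finrank_zero_of_subsingleton
    rw [Fintype.sum_unique, Fintype.sum_unique]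
    change Module.finrank ℚ
        (RatTotalHomology ((F.mapHomologicalComplex (ComplexShape.up ℤ)).obj E)) +
      Module.finrank ℚ (RatTotalHomology (oneTerm (F.obj (QX a)))) = _
    rw [h6, h2.2, zero_add]

end rat

/-- Modulo `X ^ 2`, a two-term summand contributes `4` if its differential becomes zero, that is for
`m > 1`, and `2` if `m = 1`, since `X` has rank one on `A`; the one-term summand contributes `2`. In
the reduced complex all differentials of two-term summands vanish, and the contributions are `2`,
`2` and `1`. -/
theorem IsStarDecomposition.finrank_totalHomology {K : CochainComplex GrMod ℤ} {a : ℤ} {r : ℕ}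
    {h : Fin r → ℤ} {m : Fin r → ℕ} {i : Fin r → ℤ} {E : CochainComplex GrMod ℤ}
    (hK : IsStarDecomposition K a r h m i E) :
    Module.Finite ℚ (TotalHomology (modXPowComplex 2 K)) ∧
    Module.Finite ℚ (TotalHomology (modXPowComplex 1 (modXPowComplex 2 K))) ∧
    Module.finrank ℚ (TotalHomology (modXPowComplex 2 K)) =
      Module.finrank ℚ (TotalHomology (modXPowComplex 1 (modXPowComplex 2 K))) + 1 +
        2 * Nat.card {k : Fin r // 1 < m k} := by
  classical
  obtain ⟨f1, d1⟩ := hK.finrank_map (modXPow 2) (fun k => 2 + if 1 < m k then 2 else 0)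
    (fun j => (finite_A j).1) fun k => by
      rw [show ratDim ((modXPow 2).obj (QX (2 * m k + i k))) = 2 from (finite_A _).2,
        show ratDim ((modXPow 2).obj (QX (i k))) = 2 from (finite_A _).2]
      have := hK.pos k
      split_ifs with hm
      · rw [map_mulXPow_eq_zero hm, ratDim_range_zero]
      · have hm : m k = 1 := by omega
        rw [hm, ratDim_range_mulXPow_one]
  obtain ⟨f2, d2⟩ := hK.finrank_map (modXPow 2 ⋙ modXPow 1) (fun k => 2)
    (fun j => (finite_B j).1) fun k => by
      rw [show ratDim ((modXPow 2 ⋙ modXPow 1).obj (QX (2 * m k + i k))) = 1 from (finite_B _).2,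
        show ratDim ((modXPow 2 ⋙ modXPow 1).obj (QX (i k))) = 1 from (finite_B _).2,
        map_map_mulXPow_eq_zero (hK.pos k), ratDim_range_zero]
  refine ⟨f1, f2, ?_⟩
  refine d1.trans ?_
  rw [show Module.finrank ℚ (TotalHomology (modXPowComplex 1 (modXPowComplex 2 K))) = _ from d2,
    show ratDim ((modXPow 2).obj (QX a)) = 2 from (finite_A _).2,
    show ratDim ((modXPow 2 ⋙ modXPow 1).obj (QX a)) = 1 from (finite_B _).2,
    Finset.sum_add_distrib, Nat.card_eq_fintype_card, Fintype.card_subtype, Finset.card_filter,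
    Finset.mul_sum]
  simp only [mul_ite, mul_one, mul_zero]
  omega

end GrMod

namespace GrMod

/-! ### Chains of multiplications by `X` -/

/-- Lifting to `K` gives `d x = X y + X ^ 2 u`. Applying `d` and cancelling `X`, which
torsion-freeness allows, gives `d y = -X d u`. This is the obstruction to long chains of maps `X`.
-/
theorem exists_d_eq_X_smul_d {K : CochainComplex GrMod ℤ} [∀ h, Module.IsTorsionFree ℚ[X] (K.X h)]
    {j k l : ℤ} (x : (forgetComplex (modXPowComplex 2 K)).X j)
    (y : (forgetComplex (modXPowComplex 2 K)).X k)
    (hxy : ((forgetComplex (modXPowComplex 2 K)).d j k).hom x = (X : ℚ[X]) • y) :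
    ∃ u, ((forgetComplex (modXPowComplex 2 K)).d k l).hom y =
      (X : ℚ[X]) • ((forgetComplex (modXPowComplex 2 K)).d k l).hom u := by
  obtain ⟨x, rfl⟩ := (XPowRange 2 (K.X j)).mkQ_surjective x
  obtain ⟨y, rfl⟩ := (XPowRange 2 (K.X k)).mkQ_surjective y
  have h1 : (XPowRange 2 (K.X k)).mkQ (lin (K.d j k) x) =
      (XPowRange 2 (K.X k)).mkQ ((X : ℚ[X]) • y) := hxy
  rw [← sub_eq_zero, ← map_sub, Submodule.mkQ_apply, Submodule.Quotient.mk_eq_zero] at h1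
  obtain ⟨u, hu⟩ := h1
  have hu : (X ^ 2 : ℚ[X]) • u = lin (K.d j k) x - (X : ℚ[X]) • y := hu
  have h2 := congrArg (lin (K.d k l)) hu
  have h3 : lin (K.d k l) (lin (K.d j k) x) = 0 := congrArg (fun f => lin f x) (K.d_comp_d j k l)
  rw [map_sub, h3, zero_sub, map_smul, map_smul, pow_two, mul_smul, ← smul_neg] at h2
  have h4 := smul_right_injective (K.X l) (X_ne_zero (R := ℚ)) h2
  have h5 : lin (K.d k l) y = (X : ℚ[X]) • lin (K.d k l) (-u) := by
    rw [map_neg, smul_neg, eq_neg_iff_add_eq_zero, add_comm, ← eq_neg_iff_add_eq_zero]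
    exact h4
  refine ⟨(XPowRange 2 (K.X k)).mkQ (-u), ?_⟩
  change (XPowRange 2 (K.X l)).mkQ (lin (K.d k l) y) =
    (X : ℚ[X]) • (XPowRange 2 (K.X l)).mkQ (lin (K.d k l) (-u))
  rw [h5, map_smul]

/-- The term of `xChain l h` in degree `k`. -/
abbrev XChainTerm (l : ℕ) (h k : ℤ) : Type :=
  {i : Fin (l + 1) // h + (i : ℕ) = k} → ℚ[X] ⧸ Ideal.span {(X ^ 2 : ℚ[X])}

theorem xChain_d (l : ℕ) (h k : ℤ) (f : XChainTerm l h k) :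
    @Eq (XChainTerm l h (k + 1)) (((xChain l h).d k (k + 1)).hom f)
      (fun _ => ∑ i, (X : ℚ[X]) • f i) := by
  have h1 : (xChain l h).d k (k + 1) = ModuleCat.ofHom (LinearMap.pi fun _ =>
      ∑ i : {i : Fin (l + 1) // h + (i : ℕ) = k}, (X : ℚ[X]) • LinearMap.proj (R := ℚ[X])
        (φ := fun _ => ℚ[X] ⧸ Ideal.span {(X ^ 2 : ℚ[X])}) i) :=
    CochainComplex.of_d (fun k => ModuleCat.of ℚ[X] (XChainTerm l h k))
      (fun k => ModuleCat.ofHom (LinearMap.pi fun _ =>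
        ∑ i : {i : Fin (l + 1) // h + (i : ℕ) = k}, (X : ℚ[X]) • LinearMap.proj (R := ℚ[X])
          (φ := fun _ => ℚ[X] ⧸ Ideal.span {(X ^ 2 : ℚ[X])}) i)) k
  refine (congrArg (fun φ => φ.hom f) h1).trans (funext fun j => ?_)
  exact LinearMap.sum_apply _ _ f

theorem xChain_d_const (l : ℕ) (h k : ℤ) (i : Fin (l + 1)) (hi : h + (i : ℕ) = k) :
    @Eq (XChainTerm l h (k + 1)) (((xChain l h).d k (k + 1)).hom (fun _ => 1 : XChainTerm l h k))
      ((X : ℚ[X]) • (fun _ => 1)) := by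
  let _ : Unique {i : Fin (l + 1) // h + (i : ℕ) = k} :=
    ⟨⟨⟨i, hi⟩⟩, fun j => Subtype.ext (Fin.ext
      (by have := j.2; change ((j : Fin (l + 1)) : ℕ) = (i : ℕ); omega))⟩
  refine (xChain_d l h k _).trans (funext fun j => ?_)
  rw [Fintype.sum_unique]
  rfl

theorem X_smul_X_smul (z : ℚ[X] ⧸ Ideal.span {(X ^ 2 : ℚ[X])}) :
    (X : ℚ[X]) • (X : ℚ[X]) • z = 0 := by
  obtain ⟨z, rfl⟩ := Ideal.Quotient.mk_surjective z
  refine Ideal.Quotient.eq_zero_iff_mem.2 (Ideal.mem_span_singleton.2 ⟨z, ?_⟩)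
  change X * (X * z) = X ^ 2 * z
  ring

/-- The property in `exists_d_eq_X_smul_d` passes to the summand. There the generators `x`, `y` of
the first two terms satisfy `d x = X y` and `d y = X`, whereas `X d u` is a multiple of `X ^ 2` and
hence zero. -/
theorem isEmpty_iso_xChain_biprod {K : CochainComplex GrMod ℤ}
    [∀ h, Module.IsTorsionFree ℚ[X] (K.X h)] {l : ℕ} (hl : 2 ≤ l) (h : ℤ)
    (L : CochainComplex (ModuleCat.{0} ℚ[X]) ℤ) :
    IsEmpty (forgetComplex (modXPowComplex 2 K) ≅ xChain l h ⊞ L) := by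
  refine ⟨fun e => ?_⟩
  let s : xChain l h ⟶ forgetComplex (modXPowComplex 2 K) := biprod.inl ≫ e.inv
  let r : forgetComplex (modXPowComplex 2 K) ⟶ xChain l h := e.hom ≫ biprod.fst
  have hsr : s ≫ r = 𝟙 _ := by simp [s, r]
  have hrs : ∀ k x, (r.f k).hom ((s.f k).hom x) = x := fun k x =>
    congrArg (fun φ => ModuleCat.Hom.hom (HomologicalComplex.Hom.f φ k) x) hsr
  have hs : ∀ j k x, (s.f k).hom (((xChain l h).d j k).hom x) =
      ((forgetComplex (modXPowComplex 2 K)).d j k).hom ((s.f j).hom x) := fun j k x =>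
    congrArg (fun φ => φ.hom x) (s.comm j k).symm
  have hr : ∀ j k x, (r.f k).hom (((forgetComplex (modXPowComplex 2 K)).d j k).hom x) =
      ((xChain l h).d j k).hom ((r.f j).hom x) := fun j k x =>
    congrArg (fun φ => φ.hom x) (r.comm j k).symm
  obtain ⟨x, y, hx, hy⟩ : ∃ (x : (xChain l h).X h) (y : (xChain l h).X (h + 1)),
      ((xChain l h).d h (h + 1)).hom x = (X : ℚ[X]) • y ∧
      @Eq (XChainTerm l h (h + 1 + 1)) (((xChain l h).d (h + 1) (h + 1 + 1)).hom y)
        ((X : ℚ[X]) • (fun _ => 1)) :=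
    ⟨(fun _ => 1 : XChainTerm l h h), (fun _ => 1 : XChainTerm l h (h + 1)),
      xChain_d_const l h h ⟨0, by omega⟩ (by simp),
      xChain_d_const l h (h + 1) ⟨1, by omega⟩ (by simp)⟩
  obtain ⟨u, hu⟩ := exists_d_eq_X_smul_d (l := h + 1 + 1) ((s.f h).hom x) ((s.f (h + 1)).hom y)
    (by rw [← hs, hx, map_smul])
  have h1 := congrArg (r.f (h + 1 + 1)).hom hu
  rw [map_smul, hr, hr, hrs] at h1
  have h2 : (X : ℚ[X]) • (fun _ => 1) = (X : ℚ[X]) • (fun _ => ∑ i, (X : ℚ[X]) •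
      (id ((r.f (h + 1)).hom u) : XChainTerm l h (h + 1)) i : XChainTerm l h (h + 1 + 1)) :=
    hy.symm.trans (h1.trans (congrArg (fun z : XChainTerm l h (h + 1 + 1) => (X : ℚ[X]) • z)
      (xChain_d l h (h + 1) _)))
  -- The third term of the chain exists because `2 ≤ l`; its only coordinate has index `2`.
  have h3 := congrFun h2 ⟨⟨2, by omega⟩, by simp; ring⟩
  rw [Pi.smul_apply, Pi.smul_apply, ← Finset.smul_sum, X_smul_X_smul] at h3
  have h5 : (X : ℚ[X]) * 1 ∈ Ideal.span {(X ^ 2 : ℚ[X])} := Ideal.Quotient.eq_zero_iff_mem.1 h3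
  rw [Ideal.mem_span_singleton, X_sq_dvd_iff] at h5
  simp at h5

end GrMod

end

theorem mainTheorem10 (D : KnotDiagram) :
    ∃ hD : D.IsGradedComplex,
      (∃ (r : ℕ) (h : Fin r → ℤ) (m : Fin r → ℕ) (i : Fin r → ℤ) (E : CochainComplex GrMod ℤ),
        GrMod.IsStarDecomposition (D.Ct hD) (-D.rasmussen hD - 1) r h m i E) ∧
      (∀ (r : ℕ) (h : Fin r → ℤ) (m : Fin r → ℕ) (i : Fin r → ℤ) (E : CochainComplex GrMod ℤ),
        GrMod.IsStarDecomposition (D.Ct hD) (-D.rasmussen hD - 1) r h m i E →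
          (∃ E' : CochainComplex GrMod ℤ, GrMod.IsContractible E' ∧
            Nonempty (D.C hD ≅
              (⨁ fun k : {k : Fin r // 1 < m k} =>
                GrMod.twoTerm (h k) (0 : GrMod.A (2 * m k + i k) ⟶ GrMod.A (i k))) ⊞
              ((⨁ fun k : {k : Fin r // m k = 1} => GrMod.twoTerm (h k) (GrMod.mulXA (i k))) ⊞
              (GrMod.oneTerm (GrMod.A (-D.rasmussen hD - 1)) ⊞ E')))) ∧
          Module.finrank ℚ (GrMod.TotalHomology (D.C hD)) =
            Module.finrank ℚ (GrMod.TotalHomology (D.reducedC hD)) + 1 +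
              2 * Nat.card {k : Fin r // 1 < m k}) ∧
      Module.Finite ℚ (GrMod.TotalHomology (D.C hD)) ∧
      Module.Finite ℚ (GrMod.TotalHomology (D.reducedC hD)) ∧
      (∀ (l : ℕ) (h : ℤ), 2 ≤ l → ∀ L : CochainComplex (ModuleCat.{0} ℚ[X]) ℤ,
        IsEmpty (GrMod.forgetComplex (D.C hD) ≅ GrMod.xChain l h ⊞ L)) := by
  have hA : D.IsAlternating := fun c b => GaussCode.IsPlanar.odd_pass_add_pass _ D.planar c b
  have hG := hA.isGradedComplex
  have t1 : ∀ h, Module.IsTorsionFree ℚ[X] ((D.Ct hG).X h) := fun h =>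
    inferInstanceAs (Module.IsTorsionFree ℚ[X] (D.chain h))
  obtain ⟨r, h, m, i, E, hE⟩ := hA.exists_isStarDecomposition hG
  exact ⟨hG, ⟨r, h, m, i, E, hE⟩,
    fun r h m i E hE => ⟨hE.exists_iso_modXPow_two, hE.finrank_totalHomology.2.2⟩,
    hE.finrank_totalHomology.1, hE.finrank_totalHomology.2.1,
    fun l h hl L => GrMod.isEmpty_iso_xChain_biprod hl h L⟩
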